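/- \textbf{Language and logic.} Work in the language of Epistemic Arithmetic: the language $0,S,+,\cdot,=$ of Peano Arithmetic extended by a modal operator $K$, formulas being identified up to renaming of bound variables. A structure $M$ consists of a first-order structure together with a truth value $M\models K(\phi)[s]$ for each formula $\phi$ and assignment $s$, which depends only on the values of $s$ at the free variables of $\phi$ and respects substitution of variables for variables ($M\models K(\phi(x|y))[s]$ iff $M\models K(\phi)[s(x|s(y))]$). Truth of other formulas is defined as usual; $\phi$ is \emph{valid} if it is true in every structure under every assignment, and $\Gamma\models\phi$ means that $\phi$ is true in every structure in which all of $\Gamma$ is true. Let $W_n$ be the domain of the $n$-th partial recursive function, $\langle\cdot,\cdot\rangle$ a computable pairing function, $gn(\phi)$ the Gödel number of $\phi$, $\overline m$ the numeral of $m$, and fix any formula of Peano Arithmetic in three variables $x,y,e$ that defines the relation $\langle x,y\rangle\in W_e$ in $\mathbb N$ (such formulas exist); $\langle x,\ulcorner\phi\urcorner\rangle\in W_{\overline n}$ denotes its instance with $y,e$ replaced by the numerals of $gn(\phi)$ and $n$. \textbf{The system $S_n$.} Its global axioms are: universal closures of $K(\phi\to\psi)\to K(\phi)\to K(\psi)$;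 universal closures of $K(\phi)\to K(K(\phi))$; the axioms of Peano Arithmetic with induction for all formulas of the modal language; and $\forall x\,(K(\phi)\leftrightarrow\langle x,\ulcorner\phi\urcorner\rangle\in W_{\overline n})$ whenever $x$ is the lone free variable of $\phi$. Its local axioms are the universal closures of $K(\phi)\to\phi$. A proof in $S_n$ is a finite sequence of formulas each of which is (1) a local axiom, (2) a global axiom, (3) valid, (4) obtained from two earlier members by modus ponens, or (5) $K(\phi_j)$ for an earlier member $\phi_j$ such that every member up to and including $\phi_j$ is an instance of (2)--(5) (the rule of global necessitation). \textbf{The set $S'_{n0}$.} Let $A_n$ be the least set of sentences that contains the global axioms of $S_n$ and the universal closures of $K(\phi)$ for valid $\phi$, and that contains $K(\phi)$ whenever it contains $\phi$. Let $S'_{n0}$ be the least set of sentences that contains $A_n$ and all $\phi^s$ ($\phi$ valid, $s:\text{variables}\to\mathbb N$, where $\phi^s$ is $\phi$ with each free variable $v$ replaced by $\overline{s(v)}$), and that contains $K(\phi)$ whenever it contains $\phi$. \textbf{Theorem.} (a) There is an $n\in\mathbb N$ such that $$W_n=\{\langle m,gn(\phi)\rangle : \phi \text{ is a formula with } FV(\phi)\subseteq\{x\}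 \text{ for some variable } x, \text{ and } S'_{n0}\models\phi(x|\overline m)\}.\qquad(*)$$ (b) For every $n$ satisfying $(*)$ the system $S_n$ is $\omega$-consistent: there is no formula $\phi$ with at most one free variable $x$ such that $S_n$ proves $\exists x\,\phi$ and proves $\neg\phi(x|\overline m)$ for every $m\in\mathbb N$. Moreover $S_n$ proves $K\bigl(\forall x\,(K(\phi)\leftrightarrow\langle x,\ulcorner\phi\urcorner\rangle\in W_{\overline n})\bigr)$ for every $\phi$ with lone free variable $x$. So a truthful knowing machine can know its own code. -/

import Mathlib

namespace EpistemicArithmetic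

/-! ## Syntax

The language of Peano Arithmetic (`0, S, +, ·, =`) extended by a modal operator `K`.
Variables are de Bruijn indices, so that formulas which differ only in the names of bound variables
are identified and substitution never captures. In an assignment, index `k` outside all quantifiers
is the `k`-th variable; `all φ` binds index `0` of `φ`. -/

/-- Terms of the language of Peano Arithmetic. -/
inductive Term : Type
  | var : ℕ → Term
  | zero : Term
  | succ : Term → Term
  | add : Term → Term → Term
  | mul : Term → Term → Term

/-- Formulas of the language of Epistemic Arithmetic. -/
inductive Formula : Type
  | eq : Term → Term → Formula
  | bot : Formula
  | imp : Formula → Formula → Formula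
  | all : Formula → Formula
  | know : Formula → Formula

/-- The numeral of `n`, that is `S(S(⋯S(0)))`. -/
def numeral : ℕ → Term
  | 0 => Term.zero
  | n + 1 => Term.succ (numeral n)

namespace Term

/-- Simultaneous substitution in a term. -/
def subst (σ : ℕ → Term) : Term → Term
  | var k => σ k
  | zero => zero
  | succ t => succ (t.subst σ)
  | add t u => add (t.subst σ) (u.subst σ)
  | mul t u => mul (t.subst σ) (u.subst σ)

/-- The variables of a term. -/
def fv : Term → Set ℕ
  | var k => {k}
  | zero => ∅
  | succ t => t.fv
  | add t u => t.fv ∪ u.fv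
  | mul t u => t.fv ∪ u.fv

/-- The Gödel number of a term. -/
def gn : Term → ℕ
  | var k => Nat.pair 0 k
  | zero => Nat.pair 1 0
  | succ t => Nat.pair 2 t.gn
  | add t u => Nat.pair 3 (Nat.pair t.gn u.gn)
  | mul t u => Nat.pair 4 (Nat.pair t.gn u.gn)

end Term

/-- The substitution which acts like `σ` under one quantifier. -/
def liftSubst (σ : ℕ → Term) : ℕ → Term
  | 0 => Term.var 0
  | k + 1 => (σ k).subst fun j => Term.var (j + 1)

namespace Formula

/-- Simultaneous (capture-avoiding) substitution of terms for free variables. -/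
def subst : (ℕ → Term) → Formula → Formula
  | σ, eq t u => eq (t.subst σ) (u.subst σ)
  | _, bot => bot
  | σ, imp φ ψ => imp (φ.subst σ) (ψ.subst σ)
  | σ, all φ => all (φ.subst (liftSubst σ))
  | σ, know φ => know (φ.subst σ)

/-- The free variables of a formula. -/
def fv : Formula → Set ℕ
  | eq t u => t.fv ∪ u.fv
  | bot => ∅
  | imp φ ψ => φ.fv ∪ ψ.fv
  | all φ => {k | k + 1 ∈ φ.fv}
  | know φ => φ.fv

/-- The Gödel number of a formula. -/
def gn : Formula → ℕ
  | eq t u => Nat.pair 0 (Nat.pair t.gn u.gn)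
  | bot => Nat.pair 1 0
  | imp φ ψ => Nat.pair 2 (Nat.pair φ.gn ψ.gn)
  | all φ => Nat.pair 3 φ.gn
  | know φ => Nat.pair 4 φ.gn

/-- The formula does not contain `K`, i.e. it is a formula of Peano Arithmetic. -/
def Arithmetical : Formula → Prop
  | eq _ _ => True
  | bot => True
  | imp φ ψ => φ.Arithmetical ∧ ψ.Arithmetical
  | all φ => φ.Arithmetical
  | know _ => False

def neg (φ : Formula) : Formula := imp φ bot

def and (φ ψ : Formula) : Formula := neg (imp φ (neg ψ))

def iff (φ ψ : Formula) : Formula := and (imp φ ψ) (imp ψ φ)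

/-- `φ(x|t)`: substitution of the term `t` for the variable `x`. -/
def inst (x : ℕ) (t : Term) (φ : Formula) : Formula :=
  φ.subst (Function.update Term.var x t)

/-- `φ^s`: every free variable `x` is replaced by the numeral of `s x`. -/
def assign (s : ℕ → ℕ) (φ : Formula) : Formula :=
  φ.subst fun x => numeral (s x)

/-- `∀ x φ` for the variable `x`: the occurrences of `x` become bound, and the other variables
are shifted because of the new quantifier. -/
def allVar (x : ℕ) (φ : Formula) : Formula :=
  all (φ.subst fun k => Term.var (if k = x then 0 else k + 1))

/-- `∃ x φ` for the variable `x`. -/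
def exVar (x : ℕ) (φ : Formula) : Formula := neg (allVar x (neg φ))

/-- `ψ` is a universal closure `∀ x₁ ⋯ ∀ xₙ φ` of `φ`, where `x₁, …, xₙ` are the free variables of
`φ` in some order. -/
def IsClosure (ψ φ : Formula) : Prop :=
  ∃ xs : List ℕ, xs.Nodup ∧ (∀ x, x ∈ xs ↔ x ∈ φ.fv) ∧ ψ = xs.foldr allVar φ

end Formula

/-! ## Semantics: the base logic -/

/-- A structure of the base logic: a first-order structure together with a truth value for every
purely modal formula `K(φ)` and every assignment. The truth value depends only on the values of the
free variables of `φ`, and it respects substitution of variables for variables. (It also respects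
renaming of bound variables, since such formulas are identified here.) -/
structure ModalStructure : Type 1 where
  carrier : Type
  zero : carrier
  succ : carrier → carrier
  add : carrier → carrier → carrier
  mul : carrier → carrier → carrier
  know : Formula → (ℕ → carrier) → Prop
  know_local : ∀ (φ : Formula) (s t : ℕ → carrier), (∀ x ∈ φ.fv, s x = t x) →
    (know φ s ↔ know φ t)
  know_rename : ∀ (φ : Formula) (f : ℕ → ℕ) (s : ℕ → carrier),
    know (φ.subst fun x => Term.var (f x)) s ↔ know φ fun x => s (f x)

/-- The assignment which gives `a` to index `0` and shifts `s`. -/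
def consAssignment {A : Type} (a : A) (s : ℕ → A) : ℕ → A
  | 0 => a
  | k + 1 => s k

namespace ModalStructure

/-- The value of a term. -/
def val (M : ModalStructure) (s : ℕ → M.carrier) : Term → M.carrier
  | Term.var k => s k
  | Term.zero => M.zero
  | Term.succ t => M.succ (M.val s t)
  | Term.add t u => M.add (M.val s t) (M.val s u)
  | Term.mul t u => M.mul (M.val s t) (M.val s u)

/-- `M ⊨ φ[s]`. -/
def Sat (M : ModalStructure) : Formula → (ℕ → M.carrier) → Prop
  | Formula.eq t u, s => M.val s t = M.val s u
  | Formula.bot, _ => False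
  | Formula.imp φ ψ, s => M.Sat φ s → M.Sat ψ s
  | Formula.all φ, s => ∀ a : M.carrier, M.Sat φ (consAssignment a s)
  | Formula.know φ, s => M.know φ s

end ModalStructure

/-- `φ` is (logically) valid: true in every structure under every assignment. -/
def Valid (φ : Formula) : Prop :=
  ∀ (M : ModalStructure) (s : ℕ → M.carrier), M.Sat φ s

/-- `Γ ⊨ φ`: `φ` is true in every structure in which all of `Γ` is true. -/
def Entails (Γ : Set Formula) (φ : Formula) : Prop :=
  ∀ M : ModalStructure, (∀ ψ ∈ Γ, ∀ s, M.Sat ψ s) → ∀ s, M.Sat φ s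

/-! ## Systems with global and local axioms and the rule of global necessitation -/

/-- Line `i` of the sequence `d` is a global axiom, or valid, or follows from two earlier lines by
modus ponens, or is `K(d j)` for some `j < i` such that all the lines up to line `j` are themselves
of one of these four kinds. -/
inductive GlobalLine (G : Set Formula) (d : ℕ → Formula) : ℕ → Prop
  | ax (i : ℕ) : d i ∈ G → GlobalLine G d i
  | valid (i : ℕ) : Valid (d i) → GlobalLine G d i
  | mp (i j k : ℕ) : j < i → k < i → d k = Formula.imp (d j) (d i) → GlobalLine G d i
  | nec (i j : ℕ) : j < i → (∀ k ≤ j, GlobalLine G d k) → d i = Formula.know (d j) →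
      GlobalLine G d i

/-- A set of global axioms and a set of local axioms; modus ponens and the rule of global
necessitation are implicit. -/
structure AxiomSystem : Type where
  globalAx : Set Formula
  localAx : Set Formula

/-- `φ` is provable in the system: there is a finite sequence `d 0, …, d N` with `d N = φ`, all of
whose lines are local axioms or of one of the four kinds in `GlobalLine`. -/
def AxiomSystem.Proves (S : AxiomSystem) (φ : Formula) : Prop :=
  ∃ (d : ℕ → Formula) (N : ℕ), d N = φ ∧ ∀ i ≤ N, d i ∈ S.localAx ∨ GlobalLine S.globalAx d i

/-- ω-consistency: there is no formula `φ` with at most the variable `x` free such that `∃ x φ` and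
all of `¬φ(0), ¬φ(1), ¬φ(2), …` are provable. -/
def AxiomSystem.OmegaConsistent (S : AxiomSystem) : Prop :=
  ¬ ∃ (φ : Formula) (x : ℕ), φ.fv ⊆ {x} ∧ S.Proves (φ.exVar x) ∧
    ∀ m : ℕ, S.Proves (Formula.neg (φ.inst x (numeral m)))

/-! ## Recursively enumerable sets and their membership formulas -/

/-- `W_n`, the `n`-th recursively enumerable set: the domain of the `n`-th partial recursive
function. -/
def W (n : ℕ) : Set ℕ :=
  {p | (Nat.Partrec.Code.eval (Denumerable.ofNat Nat.Partrec.Code n) p).Dom}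

/-- The standard model of arithmetic. It is used for arithmetical formulas only, so that the
interpretation of `K` does not matter. -/
def natStructure : ModalStructure where
  carrier := ℕ
  zero := 0
  succ := Nat.succ
  add := fun a b => a + b
  mul := fun a b => a * b
  know := fun _ _ => False
  know_local := fun _ _ _ _ => Iff.rfl
  know_rename := fun _ _ _ => Iff.rfl

/-- `θ` is a formula of Peano Arithmetic, in the variables `0, 1, 2`, which says that the pair of
variables `0` and `1` lies in the recursively enumerable set whose index is variable `2`. -/
def SaysPairMemW (θ : Formula) : Prop :=
  θ.Arithmetical ∧ θ.fv ⊆ {0, 1, 2} ∧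
    ∀ s : ℕ → ℕ, natStructure.Sat θ s ↔ Nat.pair (s 0) (s 1) ∈ W (s 2)

/-! ## The systems `S_n` -/

/-- The axioms of Epistemic Arithmetic: those of Peano Arithmetic, with the induction schema
extended to the modal language. -/
inductive EAAxiom : Formula → Prop
  | succ_ne_zero : EAAxiom (.all (.neg (.eq (.succ (.var 0)) .zero)))
  | succ_inj : EAAxiom (.all (.all (.imp (.eq (.succ (.var 1)) (.succ (.var 0)))
      (.eq (.var 1) (.var 0)))))
  | add_zero : EAAxiom (.all (.eq (.add (.var 0) .zero) (.var 0)))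
  | add_succ : EAAxiom (.all (.all (.eq (.add (.var 1) (.succ (.var 0)))
      (.succ (.add (.var 1) (.var 0))))))
  | mul_zero : EAAxiom (.all (.eq (.mul (.var 0) .zero) .zero))
  | mul_succ : EAAxiom (.all (.all (.eq (.mul (.var 1) (.succ (.var 0)))
      (.add (.mul (.var 1) (.var 0)) (.var 1)))))
  | induction (φ : Formula) (x : ℕ) (ψ : Formula) :
      ψ.IsClosure (.imp (φ.inst x .zero)
        (.imp (.allVar x (.imp φ (φ.inst x (.succ (.var x))))) (.allVar x φ))) →
      EAAxiom ψ

/-- The sentence `∀x (K(φ) ↔ ⟨x, ⌜φ⌝⟩ ∈ W_n)`, where membership is expressed by the formula `θ`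
with the numerals of `gn φ` and `n`. -/
def codeAxiom (θ : Formula) (n : ℕ) (φ : Formula) (x : ℕ) : Formula :=
  .allVar x (.iff (.know φ) (θ.subst fun
    | 0 => .var x
    | 1 => numeral φ.gn
    | 2 => numeral n
    | k + 3 => .var (k + 3)))

/-- The global axioms of `S_n`. -/
inductive GlobalAxiom (θ : Formula) (n : ℕ) : Formula → Prop
  | distrib (φ ψ χ : Formula) :
      χ.IsClosure (.imp (.know (.imp φ ψ)) (.imp (.know φ) (.know ψ))) → GlobalAxiom θ n χ
  | know_know (φ χ : Formula) :
      χ.IsClosure (.imp (.know φ) (.know (.know φ))) → GlobalAxiom θ n χ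
  | arithmetic (χ : Formula) : EAAxiom χ → GlobalAxiom θ n χ
  | code (φ : Formula) (x : ℕ) : φ.fv = {x} → GlobalAxiom θ n (codeAxiom θ n φ x)

/-- The local axioms of `S_n`: universal closures of `K(φ) → φ`. -/
inductive LocalAxiom : Formula → Prop
  | factive (φ χ : Formula) : χ.IsClosure (.imp (.know φ) φ) → LocalAxiom χ

/-- The system `S_n`. -/
def systemS (θ : Formula) (n : ℕ) : AxiomSystem where
  globalAx := {φ | GlobalAxiom θ n φ}
  localAx := {φ | LocalAxiom φ}

/-! ## The theory of the machine, and its fixed points -/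

/-- The global axioms of `S_n`, the universal closures of `K(φ)` for valid `φ`, and `K` of all
these axioms, recursively. -/
inductive KnownAxiom (θ : Formula) (n : ℕ) : Formula → Prop
  | ax (φ : Formula) : GlobalAxiom θ n φ → KnownAxiom θ n φ
  | valid (φ χ : Formula) : Valid φ → χ.IsClosure (.know φ) → KnownAxiom θ n χ
  | nec (φ : Formula) : KnownAxiom θ n φ → KnownAxiom θ n (.know φ)

/-- The axioms `S'_{n0}`: the previous ones, `φ^s` for all valid `φ` and assignments `s`, and `K` of
all these axioms, recursively. -/
inductive MachineAxiom (θ : Formula) (n : ℕ) : Formula → Prop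
  | base (φ : Formula) : KnownAxiom θ n φ → MachineAxiom θ n φ
  | assignedValid (φ : Formula) (s : ℕ → ℕ) : Valid φ → MachineAxiom θ n (φ.assign s)
  | nec (φ : Formula) : MachineAxiom θ n φ → MachineAxiom θ n (.know φ)

/-- `W_n = {⟨m, gn(φ)⟩ : FV(φ) ⊆ {x} and S'_{n0} ⊨ φ(x|m)}`. -/
def IsOwnCode (θ : Formula) (n : ℕ) : Prop :=
  W n = {p | ∃ (m : ℕ) (φ : Formula) (x : ℕ), p = Nat.pair m φ.gn ∧ φ.fv ⊆ {x} ∧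
    Entails {ψ | MachineAxiom θ n ψ} (φ.inst x (numeral m))}

end EpistemicArithmetic

/-! Write Γ for S'_{n0}. The intended model has domain ℕ and reads K(φ) under s as "Γ entails φ^s".
If n satisfies (*), this model satisfies Γ: distribution is modus ponens for entailment, the code
axioms restate (*), induction holds because the domain is ℕ, and Kψ for ψ in Γ is immediate.
Positive introspection needs compactness of the base logic: if Γ entails a sentence φ, then finitely
many members of Γ validly imply φ; this implication and those members are known by axioms of Γ, and
distribution yields Γ ⊨ Kφ (`Entails.know`).

Since the model satisfies Γ, whatever Γ entails is true in it, which is factivity. Necessitation is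
sound because a derivation without local axioms has only lines that Γ entails under every assignment
(`entails_of_globalLines`). So every theorem of S_n is true in a model with domain ℕ, where an
existential theorem has a numeral as witness; ω-consistency follows. The code axioms are global, so
one necessitation puts them under K.

For the existence of n, entailment from S'_{n0} is recursively enumerable uniformly in n, and
Kleene's recursion theorem applies. Enumerability and compactness both come from a completeness
theorem for sentences (`entails_iff_derives`). A structure ties K(φ) to its substitution instances
only for variables, so the calculus instantiates quantifiers by variables alone and has a separate
axiom that gives each term a value.

Enumerability is obtained by writing the syntax, the calculus and the axioms as a Horn clause
program over ℕ. Every such program can be run by a primitive recursive function (`primrec_hornRun`),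
and this one deduces exactly the true facts about its goal relation (`program_sound`,
`computes_goal`). That a formula for ⟨x,y⟩ ∈ W_e exists is Gödel's β-function argument. -/

namespace EpistemicArithmetic

/-! ## Syntactic lemmas -/

namespace Term

theorem subst_ext {σ τ : ℕ → Term} : ∀ {t : Term}, (∀ k ∈ t.fv, σ k = τ k) →
    t.subst σ = t.subst τ
  | var k, h => h k rfl
  | zero, _ => rfl
  | succ t, h => by simp only [subst]; rw [subst_ext (t := t) h]
  | add t u, h => by
    simp only [subst]
    rw [subst_ext (t := t) fun k hk => h k (Or.inl hk),
      subst_ext (t := u) fun k hk => h k (Or.inr hk)]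
  | mul t u, h => by
    simp only [subst]
    rw [subst_ext (t := t) fun k hk => h k (Or.inl hk),
      subst_ext (t := u) fun k hk => h k (Or.inr hk)]

theorem subst_subst (σ τ : ℕ → Term) (t : Term) :
    (t.subst σ).subst τ = t.subst fun k => (σ k).subst τ := by
  induction t <;> simp_all [subst]

theorem subst_var (t : Term) : t.subst var = t := by
  induction t <;> simp_all [subst]

theorem mem_fv_subst {σ : ℕ → Term} {t : Term} {k : ℕ} :
    k ∈ (t.subst σ).fv ↔ ∃ j ∈ t.fv, k ∈ (σ j).fv := by
  induction t with
  | var j => simp [subst, fv]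
  | zero => simp [subst, fv]
  | succ t ih => simpa [subst, fv] using ih
  | add t u iht ihu => simp only [subst, fv, Set.mem_union, iht, ihu]; grind
  | mul t u iht ihu => simp only [subst, fv, Set.mem_union, iht, ihu]; grind

theorem le_gn_of_mem_fv {t : Term} {k : ℕ} (h : k ∈ t.fv) : k ≤ t.gn := by
  induction t with
  | var j => obtain rfl := h; exact Nat.right_le_pair _ _
  | zero => exact h.elim
  | succ t ih => exact (ih h).trans (Nat.right_le_pair _ _)
  | add t u iht ihu =>
    refine le_trans ?_ (Nat.right_le_pair _ _)
    rcases h with h | h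
    · exact (iht h).trans (Nat.left_le_pair _ _)
    · exact (ihu h).trans (Nat.right_le_pair _ _)
  | mul t u iht ihu =>
    refine le_trans ?_ (Nat.right_le_pair _ _)
    rcases h with h | h
    · exact (iht h).trans (Nat.left_le_pair _ _)
    · exact (ihu h).trans (Nat.right_le_pair _ _)

theorem gn_injective : Function.Injective gn := by
  intro t
  induction t with
  | var j => intro u h; cases u <;> simp_all [gn]
  | zero => intro u h; cases u <;> simp_all [gn]
  | succ t ih =>
    intro u h
    cases u <;> simp [gn] at h
    rw [ih h]
  | add t u iht ihu =>
    intro w h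
    cases w <;> simp [gn] at h
    rw [iht h.1, ihu h.2]
  | mul t u iht ihu =>
    intro w h
    cases w <;> simp [gn] at h
    rw [iht h.1, ihu h.2]

end Term

theorem fv_numeral (n : ℕ) : (numeral n).fv = ∅ := by
  induction n with
  | zero => rfl
  | succ n ih => exact ih

theorem subst_numeral (σ : ℕ → Term) (n : ℕ) : (numeral n).subst σ = numeral n := by
  induction n with
  | zero => rfl
  | succ n ih => simp [numeral, Term.subst, ih]

theorem liftSubst_var : liftSubst Term.var = Term.var := by
  funext k; cases k <;> rfl

theorem liftSubst_comp (σ τ : ℕ → Term) (k : ℕ) :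
    (liftSubst σ k).subst (liftSubst τ) = liftSubst (fun k => (σ k).subst τ) k := by
  cases k with
  | zero => rfl
  | succ k => simp [liftSubst, Term.subst_subst, Term.subst]

theorem liftSubst_rename (f : ℕ → ℕ) :
    liftSubst (fun k => Term.var (f k)) =
      fun k => Term.var (consAssignment 0 (fun k => f k + 1) k) := by
  funext k; cases k <;> rfl

namespace Formula

theorem subst_ext {σ τ : ℕ → Term} {φ : Formula} (h : ∀ k ∈ φ.fv, σ k = τ k) :
    φ.subst σ = φ.subst τ := by
  induction φ generalizing σ τ with
  | eq t u =>
    simp only [subst]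
    rw [Term.subst_ext (t := t) fun k hk => h k (Or.inl hk),
      Term.subst_ext (t := u) fun k hk => h k (Or.inr hk)]
  | bot => rfl
  | imp φ ψ ihφ ihψ =>
    simp only [subst]
    rw [ihφ fun k hk => h k (Or.inl hk), ihψ fun k hk => h k (Or.inr hk)]
  | all φ ih =>
    simp only [subst]
    rw [ih]
    rintro (_ | k) hk
    · rfl
    · simp only [liftSubst]; rw [h k hk]
  | know φ ih => simp only [subst]; rw [ih h]

theorem subst_subst (σ τ : ℕ → Term) (φ : Formula) :
    (φ.subst σ).subst τ = φ.subst fun k => (σ k).subst τ := by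
  induction φ generalizing σ τ with
  | eq t u => simp [subst, Term.subst_subst]
  | bot => rfl
  | imp φ ψ ihφ ihψ => simp [subst, ihφ, ihψ]
  | all φ ih => simp only [subst, ih, liftSubst_comp]
  | know φ ih => simp [subst, ih]

theorem subst_var (φ : Formula) : φ.subst Term.var = φ := by
  induction φ with
  | eq t u => simp [subst, Term.subst_var]
  | bot => rfl
  | imp φ ψ ihφ ihψ => simp [subst, ihφ, ihψ]
  | all φ ih => simp [subst, liftSubst_var, ih]
  | know φ ih => simp [subst, ih]

theorem subst_of_fv_eq_empty {φ : Formula} (h : φ.fv = ∅) (σ : ℕ → Term) : φ.subst σ = φ := by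
  conv_rhs => rw [← subst_var φ]
  exact subst_ext fun k hk => by simp [h] at hk

theorem mem_fv_subst {σ : ℕ → Term} {φ : Formula} {k : ℕ} :
    k ∈ (φ.subst σ).fv ↔ ∃ j ∈ φ.fv, k ∈ (σ j).fv := by
  induction φ generalizing σ k with
  | eq t u => simp only [subst, fv, Set.mem_union, Term.mem_fv_subst]; grind
  | bot => simp [subst, fv]
  | imp φ ψ ihφ ihψ => simp only [subst, fv, Set.mem_union, ihφ, ihψ]; grind
  | all φ ih =>
    simp only [subst, fv, Set.mem_ofPred_eq, ih]
    constructor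
    · rintro ⟨_ | j, hj, hk⟩
      · simp [liftSubst, Term.fv] at hk
      · obtain ⟨i, hi, hik⟩ := Term.mem_fv_subst.1 hk
        simp only [Term.fv, Set.mem_singleton_iff, Nat.add_right_cancel_iff] at hik
        exact ⟨j, hj, hik ▸ hi⟩
    · rintro ⟨j, hj, hk⟩
      exact ⟨j + 1, hj, Term.mem_fv_subst.2 ⟨k, hk, rfl⟩⟩
  | know φ ih => simp only [subst, fv, ih]

theorem fv_subst_eq_empty {σ : ℕ → Term} {φ : Formula} (h : ∀ k ∈ φ.fv, (σ k).fv = ∅) :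
    (φ.subst σ).fv = ∅ := by
  ext k
  simp only [mem_fv_subst, Set.mem_empty_iff_false, iff_false, not_exists, not_and]
  intro j hj
  simp [h j hj]

theorem fv_assign (s : ℕ → ℕ) (φ : Formula) : (φ.assign s).fv = ∅ :=
  fv_subst_eq_empty fun _ _ => fv_numeral _

theorem fv_inst_numeral {φ : Formula} {x : ℕ} (h : φ.fv ⊆ {x}) (m : ℕ) :
    (φ.inst x (numeral m)).fv = ∅ :=
  fv_subst_eq_empty fun k hk => by
    obtain rfl := h hk
    simp [fv_numeral]

theorem fv_allVar (x : ℕ) (φ : Formula) : (φ.allVar x).fv = φ.fv \ {x} := by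
  ext k
  simp only [allVar, fv, Set.mem_ofPred_eq, mem_fv_subst, Term.fv, Set.mem_singleton_iff,
    Set.mem_sdiff]
  constructor
  · rintro ⟨j, hj, h⟩
    split_ifs at h with hjx
    obtain rfl : k = j := by omega
    exact ⟨hj, hjx⟩
  · rintro ⟨hk, hkx⟩
    exact ⟨k, hk, by simp [hkx]⟩

theorem fv_finite (φ : Formula) : ∃ N, ∀ k ∈ φ.fv, k < N := by
  have ht : ∀ t : Term, ∃ N, ∀ k ∈ t.fv, k < N := fun t =>
    ⟨t.gn + 1, fun k hk => Nat.lt_succ_of_le (Term.le_gn_of_mem_fv hk)⟩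
  induction φ with
  | eq t u =>
    obtain ⟨N, hN⟩ := ht t
    obtain ⟨M, hM⟩ := ht u
    exact ⟨max N M, fun k hk => hk.elim (fun h => lt_max_of_lt_left (hN k h))
      fun h => lt_max_of_lt_right (hM k h)⟩
  | bot => exact ⟨0, fun k hk => hk.elim⟩
  | imp φ ψ ihφ ihψ =>
    obtain ⟨N, hN⟩ := ihφ
    obtain ⟨M, hM⟩ := ihψ
    exact ⟨max N M, fun k hk => hk.elim (fun h => lt_max_of_lt_left (hN k h))
      fun h => lt_max_of_lt_right (hM k h)⟩
  | all φ ih => obtain ⟨N, hN⟩ := ih; exact ⟨N, fun k hk => by have := hN _ hk; omega⟩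
  | know φ ih => exact ih

/-- A pair is at least as large as its components. The bound makes variable `gn φ + 1` fresh for
`all φ`, hence usable as a Henkin constant. -/
theorem le_gn_of_mem_fv {φ : Formula} {k : ℕ} (h : k ∈ φ.fv) : k ≤ φ.gn := by
  induction φ generalizing k with
  | eq t u =>
    refine le_trans ?_ (Nat.right_le_pair _ _)
    rcases h with h | h
    · exact (Term.le_gn_of_mem_fv h).trans (Nat.left_le_pair _ _)
    · exact (Term.le_gn_of_mem_fv h).trans (Nat.right_le_pair _ _)
  | bot => exact h.elim
  | imp φ ψ ihφ ihψ =>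
    refine le_trans ?_ (Nat.right_le_pair _ _)
    rcases h with h | h
    · exact (ihφ h).trans (Nat.left_le_pair _ _)
    · exact (ihψ h).trans (Nat.right_le_pair _ _)
  | all φ ih => exact (Nat.le_succ k).trans ((ih h).trans (Nat.right_le_pair _ _))
  | know φ ih => exact (ih h).trans (Nat.right_le_pair _ _)

theorem gn_injective : Function.Injective gn := by
  intro φ
  induction φ with
  | eq t u =>
    intro χ h
    cases χ <;> simp [gn] at h
    rw [Term.gn_injective h.1, Term.gn_injective h.2]
  | bot => intro χ h; cases χ <;> simp_all [gn]
  | imp φ ψ ihφ ihψ =>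
    intro χ h
    cases χ <;> simp [gn] at h
    rw [ihφ h.1, ihψ h.2]
  | all φ ih =>
    intro χ h
    cases χ <;> simp [gn] at h
    rw [ih h]
  | know φ ih =>
    intro χ h
    cases χ <;> simp [gn] at h
    rw [ih h]

/-- `φ` with variable `k` in place of index `0`, the other indices being lowered: the instance at
`k` of the formula under the quantifier of `all φ`. -/
def openAt (k : ℕ) (φ : Formula) : Formula :=
  φ.subst (consAssignment (Term.var k) Term.var)

/-- Universal closure, described one quantifier at a time from the inside. -/
inductive Closes : Formula → Formula → Prop
  | refl (φ : Formula) : φ.fv = ∅ → Closes φ φ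
  | step (φ ψ : Formula) (x : ℕ) : x ∈ φ.fv → Closes ψ (φ.allVar x) → Closes ψ φ

theorem Closes.fv_eq_empty {ψ φ : Formula} (h : Closes ψ φ) : ψ.fv = ∅ := by
  induction h with
  | refl _ h => exact h
  | step _ _ _ _ _ ih => exact ih

/-- The fold binds the last variable of the list first, so the induction removes variables from the
end. The one-step form is the one that a program can check. -/
theorem isClosure_iff {ψ φ : Formula} : ψ.IsClosure φ ↔ Closes ψ φ := by
  constructor
  · rintro ⟨xs, hnd, hmem, rfl⟩
    induction xs using List.reverseRecOn generalizing φ with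
    | nil => exact .refl _ (Set.eq_empty_of_forall_notMem fun x hx => by simpa using (hmem x).2 hx)
    | append_singleton xs x ih =>
      rw [List.foldr_append, List.foldr_cons, List.foldr_nil]
      refine .step _ _ x ((hmem x).1 (by simp)) (ih ?_ ?_)
      · exact (List.nodup_append.1 hnd).1
      · intro y
        rw [fv_allVar, Set.mem_sdiff, ← hmem y]
        have : x ∉ xs := fun hx => (List.nodup_append.1 hnd).2.2 x hx x (by simp) rfl
        simp only [List.mem_append, List.mem_singleton, Set.mem_singleton_iff]
        grind
  · intro h
    induction h with
    | refl φ h => exact ⟨[], by simp, by simp [h], rfl⟩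
    | step φ ψ x hx _ ih =>
      obtain ⟨xs, hnd, hmem, rfl⟩ := ih
      simp only [fv_allVar, Set.mem_sdiff, Set.mem_singleton_iff] at hmem
      refine ⟨xs ++ [x], ?_, ?_, by simp⟩
      · rw [List.nodup_append]
        refine ⟨hnd, by simp, ?_⟩
        intro a ha b hb
        simp only [List.mem_singleton] at hb
        subst hb
        exact ((hmem a).1 ha).2
      · intro y
        simp only [List.mem_append, List.mem_singleton, hmem]
        grind

theorem IsClosure.fv_eq_empty {ψ φ : Formula} (h : ψ.IsClosure φ) : ψ.fv = ∅ :=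
  (isClosure_iff.1 h).fv_eq_empty

theorem isClosure_self {φ : Formula} (h : φ.fv = ∅) : φ.IsClosure φ :=
  isClosure_iff.2 (.refl φ h)

theorem exists_isClosure (φ : Formula) : ∃ ψ : Formula, ψ.IsClosure φ := by
  obtain ⟨N, hN⟩ := φ.fv_finite
  have hfin : φ.fv.Finite := (Set.finite_lt_nat N).subset hN
  exact ⟨_, hfin.toFinset.toList, Finset.nodup_toList _, by simp, rfl⟩

end Formula

/-! ## Semantic lemmas -/

@[simp] theorem consAssignment_zero {A : Type} (a : A) (s : ℕ → A) : consAssignment a s 0 = a := rfl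

@[simp] theorem consAssignment_succ {A : Type} (a : A) (s : ℕ → A) (k : ℕ) :
    consAssignment a s (k + 1) = s k := rfl

theorem consAssignment_comp {A B : Type} (g : A → B) (a : A) (s : ℕ → A) :
    (fun k => g (consAssignment a s k)) = consAssignment (g a) fun k => g (s k) := by
  funext k; cases k <;> rfl

namespace ModalStructure

variable {M : ModalStructure}

theorem val_ext {s s' : ℕ → M.carrier} {t : Term} (h : ∀ k ∈ t.fv, s k = s' k) :
    M.val s t = M.val s' t := by
  induction t with
  | var k => exact h k rfl
  | zero => rfl
  | succ t ih => simp only [val]; rw [ih h]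
  | add t u iht ihu =>
    simp only [val]; rw [iht fun k hk => h k (Or.inl hk), ihu fun k hk => h k (Or.inr hk)]
  | mul t u iht ihu =>
    simp only [val]; rw [iht fun k hk => h k (Or.inl hk), ihu fun k hk => h k (Or.inr hk)]

theorem val_subst (s : ℕ → M.carrier) (σ : ℕ → Term) (t : Term) :
    M.val s (t.subst σ) = M.val (fun k => M.val s (σ k)) t := by
  induction t <;> simp_all [val, Term.subst]

theorem sat_ext {φ : Formula} {s s' : ℕ → M.carrier} (h : ∀ k ∈ φ.fv, s k = s' k) :
    M.Sat φ s ↔ M.Sat φ s' := by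
  induction φ generalizing s s' with
  | eq t u =>
    simp only [Sat]
    rw [val_ext (t := t) fun k hk => h k (Or.inl hk), val_ext (t := u) fun k hk => h k (Or.inr hk)]
  | bot => rfl
  | imp φ ψ ihφ ihψ =>
    simp only [Sat]
    rw [ihφ fun k hk => h k (Or.inl hk), ihψ fun k hk => h k (Or.inr hk)]
  | all φ ih =>
    refine forall_congr' fun a => ih ?_
    rintro (_ | k) hk
    · rfl
    · exact h k hk
  | know φ _ => exact M.know_local φ s s' h

theorem sat_of_fv_eq_empty {φ : Formula} (h : φ.fv = ∅) (s s' : ℕ → M.carrier) :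
    M.Sat φ s ↔ M.Sat φ s' :=
  sat_ext fun k hk => by simp [h] at hk

theorem val_liftSubst (a : M.carrier) (s : ℕ → M.carrier) (σ : ℕ → Term) :
    (fun k => M.val (consAssignment a s) (liftSubst σ k)) =
      consAssignment a fun k => M.val s (σ k) := by
  funext k
  cases k with
  | zero => rfl
  | succ k => exact val_subst _ _ _

/-- This is as far as a substitution lemma goes for the whole language: the modal case is
`know_rename`, and nothing similar is required of compound terms. -/
theorem sat_rename (f : ℕ → ℕ) (φ : Formula) (s : ℕ → M.carrier) :
    M.Sat (φ.subst fun k => Term.var (f k)) s ↔ M.Sat φ fun k => s (f k) := by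
  induction φ generalizing f s with
  | eq t u => simp only [Sat, Formula.subst, val_subst]; rfl
  | bot => rfl
  | imp φ ψ ihφ ihψ => simp only [Sat, Formula.subst, ihφ, ihψ]
  | all φ ih =>
    simp only [Sat, Formula.subst, liftSubst_rename, ih]
    refine forall_congr' fun a => iff_of_eq (congrArg _ ?_)
    funext k
    cases k <;> rfl
  | know φ _ => exact M.know_rename φ f s

/-- Without K there is no obstacle to substituting compound terms. -/
theorem sat_arithmetical_subst {φ : Formula} (h : φ.Arithmetical) (σ : ℕ → Term)
    (s : ℕ → M.carrier) : M.Sat (φ.subst σ) s ↔ M.Sat φ fun k => M.val s (σ k) := by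
  induction φ generalizing σ s with
  | eq t u => simp only [Sat, Formula.subst, val_subst]
  | bot => rfl
  | imp φ ψ ihφ ihψ => simp only [Sat, Formula.subst, ihφ h.1, ihψ h.2]
  | all φ ih => simp only [Sat, Formula.subst, ih h, val_liftSubst]
  | know φ _ => exact h.elim

theorem sat_allVar {x : ℕ} {φ : Formula} {s : ℕ → M.carrier} :
    M.Sat (φ.allVar x) s ↔ ∀ a, M.Sat φ (Function.update s x a) := by
  simp only [Formula.allVar, Sat, sat_rename]
  refine forall_congr' fun a => iff_of_eq (congrArg _ ?_)
  funext k
  by_cases h : k = x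
  · subst h; simp
  · simp [h]

theorem sat_neg {φ : Formula} {s : ℕ → M.carrier} : M.Sat φ.neg s ↔ ¬ M.Sat φ s := Iff.rfl

theorem sat_exVar {x : ℕ} {φ : Formula} {s : ℕ → M.carrier} :
    M.Sat (φ.exVar x) s ↔ ∃ a, M.Sat φ (Function.update s x a) := by
  simp only [Formula.exVar, sat_neg, sat_allVar, not_forall, not_not]

theorem sat_and {φ ψ : Formula} {s : ℕ → M.carrier} :
    M.Sat (φ.and ψ) s ↔ M.Sat φ s ∧ M.Sat ψ s := by
  simp only [Formula.and, Formula.neg, Sat]; tauto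

theorem sat_iff {φ ψ : Formula} {s : ℕ → M.carrier} :
    M.Sat (φ.iff ψ) s ↔ (M.Sat φ s ↔ M.Sat ψ s) := by
  simp only [Formula.iff, sat_and, Sat]; tauto

theorem sat_closes {ψ φ : Formula} (h : ψ.Closes φ) :
    (∀ s, M.Sat ψ s) ↔ ∀ s, M.Sat φ s := by
  induction h with
  | refl => rfl
  | step φ ψ x _ _ ih =>
    simp only [ih, sat_allVar]
    exact ⟨fun h s => by simpa using h s (s x), fun h s a => h _⟩

theorem sat_isClosure {ψ φ : Formula} (h : ψ.IsClosure φ) :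
    (∀ s, M.Sat ψ s) ↔ ∀ s, M.Sat φ s :=
  sat_closes (Formula.isClosure_iff.1 h)

theorem sat_openAt {φ : Formula} {k : ℕ} {s : ℕ → M.carrier} :
    M.Sat (φ.openAt k) s ↔ M.Sat φ (consAssignment (s k) s) := by
  have : consAssignment (Term.var k) Term.var = fun j => Term.var (consAssignment k id j) := by
    funext j; cases j <;> rfl
  rw [Formula.openAt, this, sat_rename]
  refine iff_of_eq (congrArg _ ?_)
  funext j
  cases j <;> rfl

end ModalStructure

theorem valid_iff_of_isClosure {ψ φ : Formula} (h : ψ.IsClosure φ) : Valid φ ↔ Valid ψ :=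
  forall_congr' fun _ => (ModalStructure.sat_isClosure h).symm

theorem entails_empty_iff {φ : Formula} : Entails ∅ φ ↔ Valid φ := by
  simp [Entails, Valid]

/-! ## The axioms are sentences -/

theorem fv_eaAxiom {φ : Formula} (h : EAAxiom φ) : φ.fv = ∅ := by
  cases h with
  | induction _ _ _ h => exact h.fv_eq_empty
  | _ =>
    ext k
    simp [Formula.fv, Term.fv, Formula.neg]
    try omega

theorem fv_codeAxiom {θ : Formula} (hθ : θ.fv ⊆ {0, 1, 2}) {n : ℕ} {φ : Formula} {x : ℕ}
    (h : φ.fv ⊆ {x}) : (codeAxiom θ n φ x).fv = ∅ := by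
  rw [codeAxiom, Formula.fv_allVar, Set.sdiff_eq_empty]
  intro k
  simp only [Formula.iff, Formula.and, Formula.neg, Formula.fv, Set.union_empty, Set.mem_union]
  have hs : ∀ k, k ∈ (θ.subst fun
    | 0 => .var x
    | 1 => numeral φ.gn
    | 2 => numeral n
    | k + 3 => .var (k + 3)).fv → k ∈ ({x} : Set ℕ) := by
    intro k hk
    obtain ⟨j, hj, hk⟩ := Formula.mem_fv_subst.1 hk
    rcases hθ hj with rfl | rfl | rfl
    · exact hk
    · simp [fv_numeral] at hk
    · simp [fv_numeral] at hk
  rintro ((hk | hk) | (hk | hk))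
  exacts [h hk, hs _ hk, hs _ hk, h hk]

theorem fv_globalAxiom {θ : Formula} (hθ : θ.fv ⊆ {0, 1, 2}) {n : ℕ} {φ : Formula}
    (h : GlobalAxiom θ n φ) : φ.fv = ∅ := by
  cases h with
  | distrib _ _ _ h => exact h.fv_eq_empty
  | know_know _ _ h => exact h.fv_eq_empty
  | arithmetic _ h => exact fv_eaAxiom h
  | code φ x h => exact fv_codeAxiom hθ h.subset

theorem fv_knownAxiom {θ : Formula} (hθ : θ.fv ⊆ {0, 1, 2}) {n : ℕ} {φ : Formula}
    (h : KnownAxiom θ n φ) : φ.fv = ∅ := by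
  induction h with
  | ax _ h => exact fv_globalAxiom hθ h
  | valid _ _ _ h => exact h.fv_eq_empty
  | nec _ _ ih => exact ih

theorem fv_machineAxiom {θ : Formula} (hθ : θ.fv ⊆ {0, 1, 2}) {n : ℕ} {φ : Formula}
    (h : MachineAxiom θ n φ) : φ.fv = ∅ := by
  induction h with
  | base _ h => exact fv_knownAxiom hθ h
  | assignedValid φ s _ => exact Formula.fv_assign s φ
  | nec _ _ ih => exact ih

/-! ## A complete calculus

Free variables serve as Henkin constants: variable `gn φ + 1`, which is not free in `all φ`, is a
witness for the failure of `all φ`. For sets of sentences the calculus derives exactly the entailed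
sentences. -/

open Formula in
/-- The axioms of the calculus. -/
inductive LogicalAxiom : Formula → Prop
  | weaken (φ ψ : Formula) : LogicalAxiom (imp φ (imp ψ φ))
  | distribute (φ ψ χ : Formula) :
      LogicalAxiom (imp (imp φ (imp ψ χ)) (imp (imp φ ψ) (imp φ χ)))
  | dne (φ : Formula) : LogicalAxiom (imp (imp (imp φ bot) bot) φ)
  | instantiate (φ : Formula) (k : ℕ) : LogicalAxiom (imp (all φ) (φ.openAt k))
  | witness (φ : Formula) : LogicalAxiom (imp (φ.openAt (φ.gn + 1)) (all φ))
  | replace (φ : Formula) (i j : ℕ) :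
      LogicalAxiom (imp (eq (.var i) (.var j)) (imp (φ.openAt i) (φ.openAt j)))
  | eq_refl (t : Term) : LogicalAxiom (eq t t)
  | eq_symm (t u : Term) : LogicalAxiom (imp (eq t u) (eq u t))
  | eq_trans (t u v : Term) : LogicalAxiom (imp (eq t u) (imp (eq u v) (eq t v)))
  | eq_succ (t u : Term) : LogicalAxiom (imp (eq t u) (eq (.succ t) (.succ u)))
  | eq_add (t u v w : Term) :
      LogicalAxiom (imp (eq t u) (imp (eq v w) (eq (.add t v) (.add u w))))
  | eq_mul (t u v w : Term) :
      LogicalAxiom (imp (eq t u) (imp (eq v w) (eq (.mul t v) (.mul u w))))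
  | value (t : Term) :
      LogicalAxiom (imp (all (imp (eq (t.subst fun k => .var (k + 1)) (.var 0)) bot)) bot)

/-- Derivability from `Γ`. -/
inductive Derives (Γ : Set Formula) : Formula → Prop
  | hyp (φ : Formula) : φ ∈ Γ → Derives Γ φ
  | ax (φ : Formula) : LogicalAxiom φ → Derives Γ φ
  | mp (φ ψ : Formula) : Derives Γ (.imp φ ψ) → Derives Γ φ → Derives Γ ψ

namespace ModalStructure

/-- Every structure has an assignment under which the Henkin constants are witnesses. -/
theorem exists_henkin_assignment (M : ModalStructure) :
    ∃ s : ℕ → M.carrier, ∀ φ : Formula, M.Sat (φ.openAt (φ.gn + 1)) s → M.Sat (.all φ) s := by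
  classical
  -- Variables receive their values by recursion on the index. At v = `gn φ + 1` the value is a
  -- counterexample to φ, if there is one, given the smaller variables; `ext` pads these with zero.
  let ext : (v : ℕ) → ((k : ℕ) → k < v → M.carrier) → ℕ → M.carrier := fun v f k =>
    if h : k < v then f k h else M.zero
  let step : (v : ℕ) → ((k : ℕ) → k < v → M.carrier) → M.carrier := fun v f =>
    if h : ∃ a, ∃ φ : Formula, φ.gn + 1 = v ∧ ¬ M.Sat φ (consAssignment a (ext v f)) then
      h.choose else M.zero
  let s : ℕ → M.carrier := WellFounded.fix Nat.lt_wfRel.wf step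
  have hs : ∀ v, s v = step v fun k _ => s k := fun v => WellFounded.fix_eq _ step v
  refine ⟨s, fun φ hφ a => ?_⟩
  rw [sat_openAt] at hφ
  -- The free variables of `all φ` have indices below `gn φ + 1`, so the padding is never seen.
  have hloc : ∀ b, M.Sat φ (consAssignment b (ext (φ.gn + 1) fun k _ => s k)) ↔
      M.Sat φ (consAssignment b s) := by
    refine fun b => sat_ext ?_
    rintro (_ | k) hk
    · rfl
    · have : k < φ.gn + 1 := by have := Formula.le_gn_of_mem_fv hk; omega
      exact dif_pos this
  by_contra hcon
  have hex : ∃ a, ∃ ψ : Formula, ψ.gn + 1 = φ.gn + 1 ∧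
      ¬ M.Sat ψ (consAssignment a (ext (φ.gn + 1) fun k _ => s k)) :=
    ⟨a, φ, rfl, fun h => hcon ((hloc a).1 h)⟩
  obtain ⟨ψ, hψ, hsat⟩ := hex.choose_spec
  -- Gödel numbers are injective, so the counterexample stored at this variable is one for φ itself.
  obtain rfl : ψ = φ := Formula.gn_injective (Nat.succ_injective hψ)
  have hv : s (ψ.gn + 1) = hex.choose := by rw [hs]; exact dif_pos hex
  rw [hloc, ← hv] at hsat
  exact hsat hφ

end ModalStructure

open ModalStructure in
theorem LogicalAxiom.sound {φ : Formula} {M : ModalStructure} {s : ℕ → M.carrier}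
    (hs : ∀ φ : Formula, M.Sat (φ.openAt (φ.gn + 1)) s → M.Sat (.all φ) s) (h : LogicalAxiom φ) :
    M.Sat φ s := by
  cases h with
  | weaken φ ψ => exact fun h _ => h
  | distribute φ ψ χ => exact fun h₁ h₂ h₃ => h₁ h₃ (h₂ h₃)
  | dne φ => exact fun h => not_not.1 h
  | instantiate φ k => exact fun h => sat_openAt.2 (h _)
  | witness φ => exact hs φ
  | replace φ i j =>
    intro (h : s i = s j) h'
    rw [sat_openAt] at h' ⊢
    rwa [← h]
  | eq_refl t => exact rfl
  | eq_symm t u => exact fun h => Eq.symm h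
  | eq_trans t u v => exact fun h h' => Eq.trans h h'
  | eq_succ t u => exact fun h => congrArg M.succ h
  | eq_add t u v w => exact fun h h' => congrArg₂ M.add h h'
  | eq_mul t u v w => exact fun h h' => congrArg₂ M.mul h h'
  | value t => exact fun h => h (M.val s t) (val_subst _ _ _)

/-! ### Soundness, finiteness and the deduction theorem. -/

namespace Derives

variable {Γ Δ : Set Formula} {φ ψ χ : Formula}

theorem sound {M : ModalStructure} {s : ℕ → M.carrier} (hΓ : ∀ ψ ∈ Γ, M.Sat ψ s)
    (hs : ∀ φ : Formula, M.Sat (φ.openAt (φ.gn + 1)) s → M.Sat (.all φ) s) (h : Derives Γ φ) :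
    M.Sat φ s := by
  induction h with
  | hyp φ h => exact hΓ φ h
  | ax φ h => exact h.sound hs
  | mp φ ψ _ _ ih₁ ih₂ => exact ih₁ ih₂

theorem mono (hΓ : Γ ⊆ Δ) (h : Derives Γ φ) : Derives Δ φ := by
  induction h with
  | hyp φ h => exact .hyp _ (hΓ h)
  | mp φ ψ _ _ ih₁ ih₂ => exact .mp _ _ ih₁ ih₂
  | ax φ h => exact .ax _ h

theorem exists_finite (h : Derives Γ φ) :
    ∃ Δ : Finset Formula, ↑Δ ⊆ Γ ∧ Derives (Δ : Set Formula) φ := by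
  classical
  induction h with
  | hyp φ h => exact ⟨{φ}, by simpa using h, .hyp _ (by simp)⟩
  | mp φ ψ _ _ ih₁ ih₂ =>
    obtain ⟨Δ₁, hΔ₁, h₁⟩ := ih₁
    obtain ⟨Δ₂, hΔ₂, h₂⟩ := ih₂
    exact ⟨Δ₁ ∪ Δ₂, by simp [hΔ₁, hΔ₂], .mp _ _ (h₁.mono (by simp)) (h₂.mono (by simp))⟩
  | ax φ h => exact ⟨∅, by simp, .ax _ h⟩

theorem imp_of (h : Derives Γ ψ) : Derives Γ (.imp φ ψ) := .mp _ _ (.ax _ (.weaken _ _)) h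

theorem imp_self : Derives Γ (.imp φ φ) :=
  .mp _ _ (.mp _ _ (.ax _ (.distribute φ (.imp φ φ) φ)) (.ax _ (.weaken _ _))) (.ax _ (.weaken _ _))

/-- Modus ponens is the only rule, since quantifiers are governed by axioms. Hence no condition on
the free variables of φ is needed. -/
theorem deduction (h : Derives (insert φ Γ) ψ) : Derives Γ (.imp φ ψ) := by
  induction h with
  | hyp ψ h =>
    rcases h with rfl | h
    · exact imp_self
    · exact imp_of (.hyp _ h)
  | mp ψ χ _ _ ih₁ ih₂ => exact .mp _ _ (.mp _ _ (.ax _ (.distribute _ _ _)) ih₁) ih₂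
  | ax φ h => exact imp_of (.ax _ h)

theorem cut (h : Derives (insert φ Γ) ψ) (hφ : Derives Γ φ) : Derives Γ ψ :=
  .mp _ _ h.deduction hφ

theorem exFalso (h : Derives Γ .bot) : Derives Γ φ := .mp _ _ (.ax _ (.dne _)) (imp_of h)

end Derives

theorem Formula.openAt_subst_liftSubst (φ : Formula) (σ : ℕ → Term) (k : ℕ) :
    (φ.subst (liftSubst σ)).openAt k = φ.subst (consAssignment (.var k) σ) := by
  rw [Formula.openAt, Formula.subst_subst]
  congr 1
  funext j
  cases j with
  | zero => rfl
  | succ j => simp [liftSubst, Term.subst_subst, Term.subst, Term.subst_var]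

/-- A maximal consistent set of formulas. -/
structure MaxConsistent (T : Set Formula) : Prop where
  consistent : ¬ Derives T .bot
  mem_of_consistent : ∀ φ, ¬ Derives (insert φ T) .bot → φ ∈ T

/-- Zorn's lemma: a derivation of falsity from the union of a chain uses finitely many hypotheses,
and these lie in a single member. -/
theorem exists_maxConsistent {Γ : Set Formula} (h : ¬ Derives Γ .bot) :
    ∃ T, Γ ⊆ T ∧ MaxConsistent T := by
  obtain ⟨T, hT, hmax⟩ := zorn_subset_nonempty {Δ | ¬ Derives Δ .bot} (by
    intro c hc hchain hne
    refine ⟨⋃₀ c, fun hbot => ?_, fun _ => Set.subset_sUnion_of_mem⟩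
    obtain ⟨Δ, hΔ, hd⟩ := hbot.exists_finite
    obtain ⟨t, ht, hΔt⟩ := DirectedOn.exists_mem_subset_of_finset_subset_biUnion hne
      (f := id) (by simpa [DirectedOn] using hchain.directedOn)
      (by simpa [Set.sUnion_eq_biUnion] using hΔ)
    exact hc ht (hd.mono hΔt)) Γ h
  exact ⟨T, hT, hmax.prop, fun φ hφ => hmax.le_of_ge hφ (Set.subset_insert _ _)
    (Set.mem_insert _ _)⟩

namespace MaxConsistent

variable {T : Set Formula} (hT : MaxConsistent T) {φ ψ : Formula}
include hT

theorem mem_of_derives (h : Derives T φ) : φ ∈ T :=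
  hT.mem_of_consistent _ fun h' => hT.consistent (h'.cut h)

theorem bot_notMem : Formula.bot ∉ T := fun h => hT.consistent (.hyp _ h)

theorem imp_mem_iff : Formula.imp φ ψ ∈ T ↔ (φ ∈ T → ψ ∈ T) := by
  refine ⟨fun h h' => hT.mem_of_derives (.mp _ _ (.hyp _ h) (.hyp _ h')), fun h => ?_⟩
  by_cases hφ : φ ∈ T
  · exact hT.mem_of_derives (.imp_of (.hyp _ (h hφ)))
  · have : Derives (insert φ T) .bot := by
      by_contra hc
      exact hφ (hT.mem_of_consistent _ hc)
    exact hT.mem_of_derives this.exFalso.deduction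

/-- The `witness` axioms make every maximal consistent set a Henkin set, with no extension of the
language. -/
theorem all_mem_iff : Formula.all φ ∈ T ↔ ∀ k, φ.openAt k ∈ T :=
  ⟨fun h _ => hT.mem_of_derives (.mp _ _ (.ax _ (.instantiate _ _)) (.hyp _ h)),
    fun h => hT.mem_of_derives (.mp _ _ (.ax _ (.witness _)) (.hyp _ (h _)))⟩

theorem eq_symm_mem {t u : Term} (h : Formula.eq t u ∈ T) : Formula.eq u t ∈ T :=
  hT.mem_of_derives (.mp _ _ (.ax _ (.eq_symm _ _)) (.hyp _ h))

theorem eq_trans_mem {t u v : Term} (h : Formula.eq t u ∈ T) (h' : Formula.eq u v ∈ T) :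
    Formula.eq t v ∈ T :=
  hT.mem_of_derives (.mp _ _ (.mp _ _ (.ax _ (.eq_trans _ _ _)) (.hyp _ h)) (.hyp _ h'))

theorem openAt_mem_iff {i j : ℕ} (h : Formula.eq (.var i) (.var j) ∈ T) :
    φ.openAt i ∈ T ↔ φ.openAt j ∈ T :=
  ⟨fun h' => hT.mem_of_derives (.mp _ _ (.mp _ _ (.ax _ (.replace _ _ _)) (.hyp _ h)) (.hyp _ h')),
    fun h' => hT.mem_of_derives (.mp _ _ (.mp _ _ (.ax _ (.replace _ _ _))
      (.hyp _ (hT.eq_symm_mem h))) (.hyp _ h'))⟩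

/-- If t equalled no variable, the Henkin property would put ∀y ¬(t = y) into T, against the axiom
`value`. So variables alone name every element of the term model. -/
theorem exists_var_eq (t : Term) : ∃ k, Formula.eq t (.var k) ∈ T := by
  by_contra! hc
  have h := hT.imp_mem_iff.1 (hT.mem_of_derives (.ax _ (.value t)))
  refine hT.bot_notMem (h (hT.all_mem_iff.2 fun k => ?_))
  have : (Formula.imp (.eq (t.subst fun k => .var (k + 1)) (.var 0)) .bot).openAt k =
      .imp (.eq t (.var k)) .bot := by
    simp only [Formula.openAt, Formula.subst, Term.subst_subst, Term.subst, consAssignment_succ,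
      consAssignment_zero, Term.subst_var]
  rw [this, hT.imp_mem_iff]
  exact fun h => (hc k h).elim

/-- Provable equality of terms. -/
def termSetoid : Setoid Term where
  r t u := Formula.eq t u ∈ T
  iseqv := ⟨fun t => hT.mem_of_derives (.ax _ (.eq_refl t)), hT.eq_symm_mem, hT.eq_trans_mem⟩

/-- The domain of the term model. -/
def Carrier : Type := Quotient hT.termSetoid

/-- The class of a term. -/
def cls (t : Term) : hT.Carrier := Quotient.mk hT.termSetoid t

theorem cls_eq_cls {t u : Term} : hT.cls t = hT.cls u ↔ Formula.eq t u ∈ T :=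
  Quotient.eq (r := hT.termSetoid)

theorem exists_rep (a : hT.Carrier) : ∃ k, hT.cls (.var k) = a := by
  obtain ⟨t, rfl⟩ := Quotient.exists_rep a
  obtain ⟨k, hk⟩ := hT.exists_var_eq t
  exact ⟨k, hT.cls_eq_cls.2 (hT.eq_symm_mem hk)⟩

/-- A variable which denotes the given element. -/
noncomputable def rep (a : hT.Carrier) : ℕ := (hT.exists_rep a).choose

theorem cls_rep (a : hT.Carrier) : hT.cls (.var (hT.rep a)) = a := (hT.exists_rep a).choose_spec

/-- The term model of a maximal consistent set. -/
noncomputable def termModel : ModalStructure where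
  carrier := hT.Carrier
  zero := hT.cls .zero
  succ := Quotient.map (sa := hT.termSetoid) (sb := hT.termSetoid) Term.succ fun t u h =>
    hT.mem_of_derives (.mp _ _ (.ax _ (.eq_succ t u)) (.hyp _ h))
  add := Quotient.map₂ (sa := hT.termSetoid) (sb := hT.termSetoid) (sc := hT.termSetoid) Term.add
    fun t u h v w h' =>
      hT.mem_of_derives (.mp _ _ (.mp _ _ (.ax _ (.eq_add t u v w)) (.hyp _ h)) (.hyp _ h'))
  mul := Quotient.map₂ (sa := hT.termSetoid) (sb := hT.termSetoid) (sc := hT.termSetoid) Term.mul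
    fun t u h v w h' =>
      hT.mem_of_derives (.mp _ _ (.mp _ _ (.ax _ (.eq_mul t u v w)) (.hyp _ h)) (.hyp _ h'))
  -- Elements are named by variables, not by arbitrary terms. Renaming then becomes composition of
  -- substitutions, and a change of names is covered by the axiom `replace`.
  know φ s := Formula.know (φ.subst fun k => .var (hT.rep (s k))) ∈ T
  know_local φ s t h := by
    rw [Formula.subst_ext (τ := fun k => .var (hT.rep (t k))) fun _ hk => by simp only [h _ hk]]
  know_rename φ f s := by
    rw [Formula.subst_subst]
    rfl

theorem val_termModel (s : ℕ → hT.Carrier) (t : Term) :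
    hT.termModel.val s t = hT.cls (t.subst fun k => .var (hT.rep (s k))) := by
  induction t with
  | var k => exact (hT.cls_rep (s k)).symm
  | zero => rfl
  | succ t ih => simp only [ModalStructure.val, ih]; rfl
  | add t u iht ihu => simp only [ModalStructure.val, iht, ihu]; rfl
  | mul t u iht ihu => simp only [ModalStructure.val, iht, ihu]; rfl

theorem sat_termModel (φ : Formula) (s : ℕ → hT.termModel.carrier) :
    hT.termModel.Sat φ s ↔ φ.subst (fun k => .var (hT.rep (s k))) ∈ T := by
  induction φ generalizing s with
  | eq t u =>
    have h := hT.val_termModel s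
    exact (iff_of_eq (congrArg₂ Eq (h t) (h u))).trans hT.cls_eq_cls
  | bot => exact ⟨False.elim, hT.bot_notMem⟩
  | imp φ ψ ihφ ihψ => simp only [ModalStructure.Sat, Formula.subst, hT.imp_mem_iff, ihφ, ihψ]
  | all φ ih =>
    have key : ∀ a : hT.termModel.carrier, φ.subst (fun k => .var (hT.rep (consAssignment a s k))) =
        (φ.subst (liftSubst fun k => .var (hT.rep (s k)))).openAt (hT.rep a) := by
      intro a
      rw [Formula.openAt_subst_liftSubst]
      exact congrArg (Formula.subst · φ) (consAssignment_comp (fun a => Term.var (hT.rep a)) a s)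
    refine (forall_congr' fun a => ih _).trans (Iff.trans ?_ hT.all_mem_iff.symm)
    constructor
    -- The name chosen for the class of variable k may be another variable, but T proves the two
    -- equal.
    · intro h k
      exact (hT.openAt_mem_iff (hT.cls_eq_cls.1 (hT.cls_rep _))).1
        (key (hT.cls (.var k)) ▸ h (hT.cls (.var k)))
    · intro h a
      exact (key a).symm ▸ h _
  | know φ _ => rfl

end MaxConsistent

/-- Soundness and completeness of the calculus for sentences. -/
theorem entails_iff_derives {Γ : Set Formula} (hΓ : ∀ ψ ∈ Γ, ψ.fv = ∅) {φ : Formula}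
    (hφ : φ.fv = ∅) : Entails Γ φ ↔ Derives Γ φ := by
  constructor
  · intro h
    by_contra hd
    have hc : ¬ Derives (insert φ.neg Γ) .bot := fun h' =>
      hd (.mp _ _ (.ax _ (.dne _)) h'.deduction)
    obtain ⟨T, hΓT, hT⟩ := exists_maxConsistent hc
    have hsent : ∀ ψ : Formula, ψ.fv = ∅ → ∀ s, (hT.termModel.Sat ψ s ↔ ψ ∈ T) := by
      intro ψ hψ s
      rw [hT.sat_termModel, Formula.subst_of_fv_eq_empty hψ]
    have hmem : φ ∈ T := (hsent φ hφ fun _ => hT.cls .zero).1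
      (h hT.termModel (fun ψ hψ s => (hsent ψ (hΓ ψ hψ) s).2 (hΓT (Or.inr hψ))) _)
    exact hT.bot_notMem (hT.imp_mem_iff.1 (hΓT (Or.inl rfl)) hmem)
  · intro h M hM s
    -- The `witness` axioms are guaranteed true only under a Henkin assignment. For sentences the
    -- choice of assignment is immaterial.
    obtain ⟨s', hs'⟩ := M.exists_henkin_assignment
    exact (ModalStructure.sat_of_fv_eq_empty hφ s s').2 (h.sound (fun ψ hψ => hM ψ hψ s') hs')

/-- Compactness, from the finiteness of derivations. The premises are folded into one valid
implication so that the machine knows it by an axiom. -/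
theorem Entails.exists_finite {Γ : Set Formula} (hΓ : ∀ ψ ∈ Γ, ψ.fv = ∅) {φ : Formula}
    (hφ : φ.fv = ∅) (h : Entails Γ φ) :
    ∃ Δ : List Formula, (∀ ψ ∈ Δ, ψ ∈ Γ) ∧ Valid (Δ.foldr .imp φ) := by
  obtain ⟨Δ, hΔ, hd⟩ := ((entails_iff_derives hΓ hφ).1 h).exists_finite
  have hΔ' : ∀ ψ ∈ Δ.toList, ψ ∈ Γ := fun ψ hψ => hΔ (Finset.mem_toList.1 hψ)
  refine ⟨Δ.toList, hΔ', fun M s => ?_⟩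
  have hfold : ∀ l : List Formula, ((∀ ψ ∈ l, M.Sat ψ s) → M.Sat φ s) →
      M.Sat (l.foldr .imp φ) s := by
    intro l
    induction l with
    | nil => intro h; exact h (by simp)
    | cons ψ l ih => intro h hψ; exact ih fun hl => h (by simpa using ⟨hψ, hl⟩)
  refine hfold _ fun hs => ?_
  refine (entails_iff_derives (fun ψ hψ => hΓ ψ (hΔ hψ)) hφ).2 hd M (fun ψ hψ s' => ?_) s
  exact (ModalStructure.sat_of_fv_eq_empty (hΓ ψ (hΔ hψ)) s' s).2 (hs ψ (by simpa using hψ))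

/-! ## The intended model: `K(φ)` means that the machine's axioms entail `φ` -/

/-- The standard model in which the knowledge of `φ` at `s` is the entailment of `φ^s` from `Γ`. -/
def entailmentModel (Γ : Set Formula) : ModalStructure where
  carrier := ℕ
  zero := 0
  succ := Nat.succ
  add := fun a b => a + b
  mul := fun a b => a * b
  know φ s := Entails Γ (φ.assign s)
  know_local φ s t h := by
    rw [Formula.assign, Formula.assign, Formula.subst_ext fun k hk => by rw [h k hk]]
  know_rename φ f s := by
    rw [Formula.assign, Formula.subst_subst]
    rfl

/-- The value of a term in the standard model. -/
def natVal (s : ℕ → ℕ) (t : Term) : ℕ := natStructure.val s t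

theorem natVal_var (s : ℕ → ℕ) (k : ℕ) : natVal s (.var k) = s k := rfl

theorem natVal_succ (s : ℕ → ℕ) (t : Term) : natVal s (.succ t) = natVal s t + 1 := rfl

theorem natVal_numeral (s : ℕ → ℕ) (m : ℕ) : natVal s (numeral m) = m := by
  induction m with
  | zero => rfl
  | succ m ih => exact congrArg Nat.succ ih

theorem natVal_subst (s : ℕ → ℕ) (σ : ℕ → Term) (t : Term) :
    natVal s (t.subst σ) = natVal (fun k => natVal s (σ k)) t :=
  ModalStructure.val_subst (M := natStructure) s σ t

theorem natVal_liftSubst (a : ℕ) (s : ℕ → ℕ) (σ : ℕ → Term) :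
    (fun k => natVal (consAssignment a s) (liftSubst σ k)) =
      consAssignment a fun k => natVal s (σ k) :=
  ModalStructure.val_liftSubst (M := natStructure) a s σ

theorem val_entailmentModel (Γ : Set Formula) (s : ℕ → ℕ) (t : Term) :
    (entailmentModel Γ).val s t = natVal s t := by
  induction t with
  | var k => rfl
  | zero => rfl
  | succ t ih => exact congrArg Nat.succ ih
  | add t u iht ihu => exact congrArg₂ (· + ·) iht ihu
  | mul t u iht ihu => exact congrArg₂ (· * ·) iht ihu

/-- Truth in `entailmentModel Γ`. -/
def Holds (Γ : Set Formula) (φ : Formula) (s : ℕ → ℕ) : Prop := (entailmentModel Γ).Sat φ s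

/-! ### Truth conditions in the intended model. -/

section Holds

variable {Γ : Set Formula} {φ ψ : Formula} {s : ℕ → ℕ}

theorem holds_eq {t u : Term} : Holds Γ (.eq t u) s ↔ natVal s t = natVal s u :=
  iff_of_eq (congrArg₂ Eq (val_entailmentModel Γ s t) (val_entailmentModel Γ s u))

theorem holds_imp : Holds Γ (.imp φ ψ) s ↔ (Holds Γ φ s → Holds Γ ψ s) := Iff.rfl

theorem holds_all : Holds Γ (.all φ) s ↔ ∀ a, Holds Γ φ (consAssignment a s) := Iff.rfl

theorem holds_know : Holds Γ (.know φ) s ↔ Entails Γ (φ.assign s) := Iff.rfl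

theorem holds_iff : Holds Γ (φ.iff ψ) s ↔ (Holds Γ φ s ↔ Holds Γ ψ s) := ModalStructure.sat_iff

theorem holds_allVar {x : ℕ} : Holds Γ (φ.allVar x) s ↔ ∀ a, Holds Γ φ (Function.update s x a) :=
  ModalStructure.sat_allVar

theorem holds_exVar {x : ℕ} : Holds Γ (φ.exVar x) s ↔ ∃ a, Holds Γ φ (Function.update s x a) :=
  ModalStructure.sat_exVar

theorem holds_of_isClosure (h : ψ.IsClosure φ) (hφ : ∀ s, Holds Γ φ s) : Holds Γ ψ s :=
  (ModalStructure.sat_isClosure (M := entailmentModel Γ) h).2 hφ s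

theorem holds_of_valid (h : Valid φ) : Holds Γ φ s := h _ _

theorem holds_of_entails (hΓ : ∀ ψ ∈ Γ, ∀ s, Holds Γ ψ s) (h : Entails Γ φ) : Holds Γ φ s :=
  h (entailmentModel Γ) hΓ s

theorem holds_iff_of_arithmetical (h : φ.Arithmetical) : Holds Γ φ s ↔ natStructure.Sat φ s := by
  induction φ generalizing s with
  | eq t u => exact holds_eq
  | bot => rfl
  | imp φ ψ ihφ ihψ => exact imp_congr (ihφ h.1) (ihψ h.2)
  | all φ ih => exact forall_congr' fun a => ih h
  | know φ _ => exact h.elim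

end Holds

/-- A term whose instances by numerals are literally numerals. -/
def Term.IsNumerical (t : Term) : Prop :=
  ∀ s : ℕ → ℕ, t.subst (fun k => numeral (s k)) = numeral (natVal s t)

theorem Term.isNumerical_var (k : ℕ) : (Term.var k).IsNumerical := fun _ => rfl

theorem Term.isNumerical_zero : Term.zero.IsNumerical := fun _ => rfl

theorem Term.IsNumerical.succ {t : Term} (h : t.IsNumerical) : t.succ.IsNumerical :=
  fun s => congrArg Term.succ (h s)

theorem Term.isNumerical_numeral (m : ℕ) : (numeral m).IsNumerical := fun s => by
  rw [subst_numeral, natVal_numeral]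

theorem Term.IsNumerical.liftSubst {σ : ℕ → Term} (h : ∀ k, (σ k).IsNumerical) (k : ℕ) :
    (liftSubst σ k).IsNumerical := by
  intro s
  cases k with
  | zero => rfl
  | succ k =>
    rw [EpistemicArithmetic.liftSubst, Term.subst_subst, natVal_subst]
    exact h k fun j => s (j + 1)

/-- Under K both sides speak of entailment of a formula obtained by substitution, and these formulas
must coincide literally. This is the reason for numerical terms: an instance of x + y is a sum of
two numerals, not the numeral of their sum. -/
theorem holds_subst {Γ : Set Formula} {σ : ℕ → Term} (hσ : ∀ k, (σ k).IsNumerical)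
    {φ : Formula} {s : ℕ → ℕ} :
    Holds Γ (φ.subst σ) s ↔ Holds Γ φ fun k => natVal s (σ k) := by
  induction φ generalizing σ s with
  | eq t u => simp only [Formula.subst, holds_eq, natVal_subst]
  | bot => rfl
  | imp φ ψ ihφ ihψ => exact imp_congr (ihφ hσ) (ihψ hσ)
  | all φ ih =>
    simp only [Formula.subst, holds_all, ih (Term.IsNumerical.liftSubst hσ), natVal_liftSubst]
  | know φ _ =>
    simp only [Formula.subst, holds_know, Formula.assign, Formula.subst_subst, hσ _ s]

theorem holds_assign {Γ : Set Formula} {φ : Formula} {s s' : ℕ → ℕ} :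
    Holds Γ (φ.assign s) s' ↔ Holds Γ φ s := by
  rw [Formula.assign, holds_subst fun k => Term.isNumerical_numeral (s k)]
  simp only [natVal_numeral]

theorem holds_inst {Γ : Set Formula} {t : Term} (ht : t.IsNumerical) {x : ℕ} {φ : Formula}
    {s : ℕ → ℕ} : Holds Γ (φ.inst x t) s ↔ Holds Γ φ (Function.update s x (natVal s t)) := by
  rw [Formula.inst, holds_subst]
  · refine iff_of_eq (congrArg _ (funext fun k => ?_))
    by_cases h : k = x
    · subst h; simp
    · simp [h, natVal_var]
  · intro k
    by_cases h : k = x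
    · subst h; simpa using ht
    · simpa [h] using Term.isNumerical_var k

theorem holds_eaAxiom {Γ : Set Formula} {φ : Formula} (h : EAAxiom φ) (s : ℕ → ℕ) :
    Holds Γ φ s := by
  cases h with
  | succ_ne_zero => exact fun a => Nat.succ_ne_zero a
  | succ_inj => exact fun a b => Nat.succ.inj
  | add_zero => exact fun a => rfl
  | add_succ => exact fun a b => rfl
  | mul_zero => exact fun a => rfl
  | mul_succ => exact fun a b => rfl
  -- The schema substitutes only 0 and S(x), which are numerical, so the substitution is harmless
  -- even inside K.
  | induction φ x _ h =>
    refine holds_of_isClosure h fun s => ?_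
    simp only [holds_imp, holds_allVar, holds_inst Term.isNumerical_zero]
    intro h₀ h₁ a
    induction a with
    | zero => exact h₀
    | succ a ih =>
      have := h₁ a ih
      rw [holds_inst (Term.isNumerical_var x).succ] at this
      simpa [natVal_succ, natVal_var] using this

theorem Formula.assign_of_fv_eq_empty {φ : Formula} (h : φ.fv = ∅) (s : ℕ → ℕ) :
    φ.assign s = φ :=
  subst_of_fv_eq_empty h _

theorem Formula.assign_eq_inst {φ : Formula} {x : ℕ} (h : φ.fv ⊆ {x}) (s : ℕ → ℕ) :
    φ.assign s = φ.inst x (numeral (s x)) :=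
  subst_ext fun k hk => by obtain rfl := h hk; simp

theorem Entails.mp {Γ : Set Formula} {φ ψ : Formula} (h : Entails Γ (.imp φ ψ))
    (h' : Entails Γ φ) : Entails Γ ψ :=
  fun M hM s => h M hM s (h' M hM s)

theorem Entails.of_mem {Γ : Set Formula} {φ : Formula} (h : φ ∈ Γ) : Entails Γ φ :=
  fun _ hM s => hM φ h s

/-- The theory of the machine. -/
def machineTheory (θ : Formula) (n : ℕ) : Set Formula := {ψ | MachineAxiom θ n ψ}

/-- What the machine's axioms entail is known, according to these axioms. -/
theorem Entails.know {θ : Formula} (hθ : θ.fv ⊆ {0, 1, 2}) {n : ℕ} {φ : Formula} (hφ : φ.fv = ∅)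
    (h : Entails (machineTheory θ n) φ) : Entails (machineTheory θ n) (.know φ) := by
  obtain ⟨Δ, hΔ, hv⟩ := h.exists_finite (fun ψ hψ => fv_machineAxiom hθ hψ) hφ
  have hfv : ∀ l : List Formula, (∀ ψ ∈ l, ψ ∈ machineTheory θ n) → (l.foldr .imp φ).fv = ∅ := by
    intro l
    induction l with
    | nil => exact fun _ => hφ
    | cons ψ l ih =>
      intro hl
      simp only [List.foldr_cons, Formula.fv, ih fun χ hχ => hl χ (List.mem_cons_of_mem _ hχ),
        fv_machineAxiom hθ (hl ψ List.mem_cons_self), Set.union_empty]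
  -- A valid sentence is its own φ^s, hence an axiom, and so is K of it.
  have hknow : Entails (machineTheory θ n) (.know (Δ.foldr .imp φ)) := by
    refine .of_mem (.nec _ ?_)
    have := MachineAxiom.assignedValid (θ := θ) (n := n) _ (fun _ => 0) hv
    rwa [Formula.assign_of_fv_eq_empty (hfv Δ hΔ)] at this
  clear hv h
  induction Δ with
  | nil => exact hknow
  | cons ψ l ih =>
    have hl : ∀ χ ∈ l, χ ∈ machineTheory θ n := fun χ hχ => hΔ χ (List.mem_cons_of_mem _ hχ)
    have hψ : ψ ∈ machineTheory θ n := hΔ ψ List.mem_cons_self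
    -- One premise ψ is removed by distribution, using that Kψ is an axiom too.
    refine ih hl (.mp (.mp ?_ hknow) (.of_mem (.nec _ hψ)))
    refine .of_mem (.base _ (.ax _ (.distrib ψ (l.foldr .imp φ) _ (Formula.isClosure_self ?_))))
    simp [Formula.fv, hfv l hl, fv_machineAxiom hθ hψ]

/-! ### Soundness of the systems in the intended model. -/

section Model

variable {θ : Formula} {n : ℕ}

/-- At x = m, the left side is entailment of φ(x|m) by definition of the model, the right side is
⟨m, gn φ⟩ ∈ W_n, and (*) equates the two. -/
theorem holds_codeAxiom (hθ : SaysPairMemW θ) (hn : IsOwnCode θ n) {φ : Formula} {x : ℕ}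
    (hx : φ.fv = {x}) (s : ℕ → ℕ) : Holds (machineTheory θ n) (codeAxiom θ n φ x) s := by
  rw [codeAxiom, holds_allVar]
  intro m
  rw [holds_iff, holds_subst, holds_iff_of_arithmetical hθ.1, hθ.2.2, holds_know,
    Formula.assign_eq_inst hx.subset]
  · simp only [natVal_numeral, natVal_var, Function.update_self]
    rw [show W n = _ from hn]
    constructor
    · exact fun h => ⟨m, φ, x, rfl, hx.subset, h⟩
    · rintro ⟨m', φ', x', hp, hx', h⟩
      obtain ⟨rfl, hgn⟩ := Nat.pair_eq_pair.1 hp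
      obtain rfl := Formula.gn_injective hgn
      -- The variable supplied by (*) is forced because x really occurs free in φ.
      obtain rfl : x = x' := hx' (hx ▸ rfl)
      exact h
  · rintro (_ | _ | _ | k)
    exacts [Term.isNumerical_var _, Term.isNumerical_numeral _, Term.isNumerical_numeral _,
      Term.isNumerical_var _]

theorem holds_globalAxiom (hθ : SaysPairMemW θ) (hn : IsOwnCode θ n) {φ : Formula}
    (h : GlobalAxiom θ n φ) (s : ℕ → ℕ) : Holds (machineTheory θ n) φ s := by
  cases h with
  | distrib φ ψ _ h =>
    refine holds_of_isClosure h fun s => ?_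
    exact fun (h₁ : Entails _ (.imp (φ.assign s) (ψ.assign s))) h₂ => h₁.mp h₂
  | know_know φ _ h =>
    refine holds_of_isClosure h fun s => ?_
    exact fun (h : Entails _ (φ.assign s)) => h.know hθ.2.1 (Formula.fv_assign _ _)
  | arithmetic _ h => exact holds_eaAxiom h s
  | code φ x hx => exact holds_codeAxiom hθ hn hx s

/-- No induction is needed: Kψ for an axiom ψ asserts only that ψ is entailed, not that it is true.
For K of a valid open φ, the instances φ^s must themselves be axioms, as substituting numerals under
K need not preserve validity. -/
theorem holds_machineAxiom (hθ : SaysPairMemW θ) (hn : IsOwnCode θ n) {φ : Formula}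
    (h : MachineAxiom θ n φ) (s : ℕ → ℕ) : Holds (machineTheory θ n) φ s := by
  have know_of_mem : ∀ φ, MachineAxiom θ n φ → Holds (machineTheory θ n) (.know φ) s := by
    intro φ h
    rw [holds_know, Formula.assign_of_fv_eq_empty (fv_machineAxiom hθ.2.1 h)]
    exact .of_mem h
  cases h with
  | base _ h =>
    cases h with
    | ax _ h => exact holds_globalAxiom hθ hn h s
    | valid φ _ hv h =>
      exact holds_of_isClosure h fun s =>
        holds_know.2 (Entails.of_mem (MachineAxiom.assignedValid φ s hv))
    | nec φ h => exact know_of_mem φ (.base _ h)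
  | assignedValid φ s' hv => exact holds_assign.2 (holds_of_valid hv)
  | nec φ h => exact know_of_mem φ h

/-- There is no circularity: K is defined by entailment from the machine's axioms, which have
already been seen to hold in this model. -/
theorem holds_factive (hθ : SaysPairMemW θ) (hn : IsOwnCode θ n) (φ : Formula) (s : ℕ → ℕ) :
    Holds (machineTheory θ n) (.imp (.know φ) φ) s := fun h =>
  holds_assign.1 (holds_of_entails (s := s) (fun _ hψ s => holds_machineAxiom hθ hn hψ s) h)

/-- Each kind of global line preserves entailment of all numeral instances; necessitation does so by
`Entails.know`. -/
theorem entails_of_globalLines (hθ : SaysPairMemW θ) {d : ℕ → Formula} {i : ℕ}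
    (h : ∀ k ≤ i, GlobalLine (systemS θ n).globalAx d k) (s : ℕ → ℕ) :
    Entails (machineTheory θ n) ((d i).assign s) := by
  induction i using Nat.strong_induction_on generalizing s with
  | _ i ih =>
    have ih' : ∀ j < i, ∀ s, Entails (machineTheory θ n) ((d j).assign s) :=
      fun j hj s => ih j hj (fun k hk => h k (hk.trans hj.le)) s
    cases h i le_rfl with
    | ax _ hax =>
      have hax : GlobalAxiom θ n (d i) := hax
      rw [Formula.assign_of_fv_eq_empty (fv_globalAxiom hθ.2.1 hax)]
      exact .of_mem (.base _ (.ax _ hax))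
    | valid _ hv => exact .of_mem (.assignedValid _ s hv)
    | mp _ j k hj hk hd =>
      have := ih' k hk s
      rw [hd] at this
      exact this.mp (ih' j hj s)
    | nec _ j hj _ hd =>
      rw [hd]
      exact (ih' j hj s).know hθ.2.1 (Formula.fv_assign _ _)

theorem holds_of_proves (hθ : SaysPairMemW θ) (hn : IsOwnCode θ n) {φ : Formula}
    (h : (systemS θ n).Proves φ) (s : ℕ → ℕ) : Holds (machineTheory θ n) φ s := by
  obtain ⟨d, N, rfl, hd⟩ := h
  suffices ∀ i ≤ N, ∀ s, Holds (machineTheory θ n) (d i) s from this N le_rfl s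
  intro i
  induction i using Nat.strong_induction_on with
  | _ i ih =>
    intro hi s
    rcases hd i hi with hl | hg
    · obtain ⟨φ, _, hcl⟩ : LocalAxiom (d i) := hl
      exact holds_of_isClosure hcl (holds_factive hθ hn φ)
    · cases hg with
      | ax _ hax => exact holds_globalAxiom hθ hn hax s
      | valid _ hv => exact holds_of_valid hv
      | mp _ j k hj hk he =>
        have := ih k hk (hk.le.trans hi) s
        rw [he] at this
        exact this (ih j hj (hj.le.trans hi) s)
      -- The lines up to j use no local axiom, so line j is not merely true but entailed.
      | nec _ j hj hglob he =>
        rw [he]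
        exact entails_of_globalLines hθ hglob s

theorem omegaConsistent_systemS (hθ : SaysPairMemW θ) (hn : IsOwnCode θ n) :
    (systemS θ n).OmegaConsistent := by
  rintro ⟨φ, x, _, hex, hall⟩
  obtain ⟨m, hm⟩ := holds_exVar.1 (holds_of_proves hθ hn hex fun _ => 0)
  refine holds_of_proves hθ hn (hall m) (fun _ => 0) ((holds_inst ?_).2 ?_)
  · exact Term.isNumerical_numeral m
  · rwa [natVal_numeral]

theorem systemS_proves_know_codeAxiom {φ : Formula} {x : ℕ} (hx : φ.fv = {x}) :
    (systemS θ n).Proves (.know (codeAxiom θ n φ x)) := by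
  let d : ℕ → Formula
    | 0 => codeAxiom θ n φ x
    | _ + 1 => .know (codeAxiom θ n φ x)
  have h₀ : GlobalLine (systemS θ n).globalAx d 0 := .ax _ (.code φ x hx)
  refine ⟨d, 1, rfl, fun i hi => .inr ?_⟩
  obtain rfl | rfl : i = 0 ∨ i = 1 := by omega
  · exact h₀
  · refine .nec _ 0 Nat.zero_lt_one (fun k hk => ?_) rfl
    obtain rfl := Nat.le_zero.1 hk
    exact h₀

end Model

/-! ## Arithmetical definability of recursively enumerable relations -/

/-- A property of assignments that is expressed by a formula of Peano Arithmetic. -/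
def Definable (R : (ℕ → ℕ) → Prop) : Prop :=
  ∃ φ : Formula, φ.Arithmetical ∧ ∀ s, Holds ∅ φ s ↔ R s

/-- A binary relation that is expressed by a formula of Peano Arithmetic. -/
def Definable₂ (R : ℕ → ℕ → Prop) : Prop := Definable fun s => R (s 0) (s 1)

/-- A ternary relation that is expressed by a formula of Peano Arithmetic. -/
def Definable₃ (R : ℕ → ℕ → ℕ → Prop) : Prop := Definable fun s => R (s 0) (s 1) (s 2)

/-- A function of assignments that is expressed by a term. -/
def IsTerm (f : (ℕ → ℕ) → ℕ) : Prop := ∃ t : Term, ∀ s, natVal s t = f s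

namespace IsTerm

variable {f g : (ℕ → ℕ) → ℕ}

theorem var (k : ℕ) : IsTerm fun s => s k := ⟨.var k, fun _ => rfl⟩

theorem const (n : ℕ) : IsTerm fun _ => n := ⟨numeral n, fun _ => natVal_numeral _ _⟩

theorem add (hf : IsTerm f) (hg : IsTerm g) : IsTerm fun s => f s + g s := by
  obtain ⟨t, ht⟩ := hf
  obtain ⟨u, hu⟩ := hg
  exact ⟨.add t u, fun s => congrArg₂ (· + ·) (ht s) (hu s)⟩

theorem mul (hf : IsTerm f) (hg : IsTerm g) : IsTerm fun s => f s * g s := by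
  obtain ⟨t, ht⟩ := hf
  obtain ⟨u, hu⟩ := hg
  exact ⟨.mul t u, fun s => congrArg₂ (· * ·) (ht s) (hu s)⟩

theorem succ (hf : IsTerm f) : IsTerm fun s => f s + 1 := hf.add (const 1)

end IsTerm

theorem Formula.Arithmetical.subst {φ : Formula} (h : φ.Arithmetical) (σ : ℕ → Term) :
    (φ.subst σ).Arithmetical := by
  induction φ generalizing σ with
  | eq t u => trivial
  | bot => trivial
  | imp φ ψ ihφ ihψ => exact ⟨ihφ h.1 σ, ihψ h.2 σ⟩
  | all φ ih => exact ih h _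
  | know φ _ => exact h

theorem natStructure_sat_subst {φ : Formula} (h : φ.Arithmetical) (σ : ℕ → Term) (s : ℕ → ℕ) :
    natStructure.Sat (φ.subst σ) s ↔ natStructure.Sat φ fun k => natVal s (σ k) :=
  ModalStructure.sat_arithmetical_subst (M := natStructure) h σ s

/-! ### Closure properties of definable relations. -/

namespace Definable

variable {R P : (ℕ → ℕ) → Prop}

theorem of_iff (hR : Definable R) (h : ∀ s, P s ↔ R s) : Definable P := by
  rwa [show P = R from funext fun s => propext (h s)]

theorem eq {f g : (ℕ → ℕ) → ℕ} (hf : IsTerm f) (hg : IsTerm g) :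
    Definable fun s => f s = g s := by
  obtain ⟨t, ht⟩ := hf
  obtain ⟨u, hu⟩ := hg
  exact ⟨.eq t u, trivial, fun s => by rw [holds_eq, ht, hu]⟩

theorem imp (hR : Definable R) (hP : Definable P) : Definable fun s => R s → P s := by
  obtain ⟨φ, hφ, hφR⟩ := hR
  obtain ⟨ψ, hψ, hψP⟩ := hP
  exact ⟨.imp φ ψ, ⟨hφ, hψ⟩, fun s => by rw [holds_imp, hφR, hψP]⟩

theorem not (hR : Definable R) : Definable fun s => ¬ R s :=
  hR.imp ⟨.bot, trivial, fun _ => Iff.rfl⟩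

theorem or (hR : Definable R) (hP : Definable P) : Definable fun s => R s ∨ P s :=
  (hR.not.imp hP).of_iff fun _ => or_iff_not_imp_left

theorem and (hR : Definable R) (hP : Definable P) : Definable fun s => R s ∧ P s :=
  (hR.imp hP.not).not.of_iff fun s => by tauto

theorem all {R : ℕ → (ℕ → ℕ) → Prop} (hR : Definable fun s => R (s 0) fun k => s (k + 1)) :
    Definable fun s => ∀ a, R a s := by
  obtain ⟨φ, hφ, hφR⟩ := hR
  exact ⟨.all φ, hφ, fun s => by simp only [holds_all, hφR]; rfl⟩

theorem ex {R : ℕ → (ℕ → ℕ) → Prop} (hR : Definable fun s => R (s 0) fun k => s (k + 1)) :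
    Definable fun s => ∃ a, R a s :=
  (Definable.all (R := fun a s => ¬ R a s) hR.not).not.of_iff fun s => by simp

theorem subst (hR : Definable R) (f : ℕ → (ℕ → ℕ) → ℕ) (hf : ∀ k, IsTerm (f k)) :
    Definable fun s => R fun k => f k s := by
  obtain ⟨φ, hφ, hφR⟩ := hR
  choose σ hσ using hf
  refine ⟨φ.subst σ, hφ.subst σ, fun s => ?_⟩
  rw [holds_iff_of_arithmetical (hφ.subst σ), natStructure_sat_subst hφ,
    ← holds_iff_of_arithmetical (Γ := ∅) hφ, hφR]
  simp only [hσ]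

end Definable

/-- Only terms may be inserted. A value of a function that is merely definable has to be introduced
by its own existential quantifier, which explains the long prefixes below. -/
theorem Definable₂.comp {R : ℕ → ℕ → Prop} (hR : Definable₂ R) {f g : (ℕ → ℕ) → ℕ}
    (hf : IsTerm f) (hg : IsTerm g) : Definable fun s => R (f s) (g s) :=
  Definable.subst hR (fun | 0 => f | _ + 1 => g) (by rintro (_ | _); exacts [hf, hg])

theorem Definable₃.comp {R : ℕ → ℕ → ℕ → Prop} (hR : Definable₃ R) {f g h : (ℕ → ℕ) → ℕ}
    (hf : IsTerm f) (hg : IsTerm g) (hh : IsTerm h) : Definable fun s => R (f s) (g s) (h s) :=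
  Definable.subst hR (fun | 0 => f | 1 => g | _ + 2 => h)
    (by rintro (_ | _ | _); exacts [hf, hg, hh])

theorem definable_lt : Definable₂ (· < ·) :=
  Definable.of_iff (.ex (R := fun a s => s 0 + a + 1 = s 1)
    (.eq (((IsTerm.var 1).add (.var 0)).succ) (.var 2))) fun s =>
      ⟨fun h => ⟨s 1 - s 0 - 1, by omega⟩, fun ⟨a, h⟩ => by omega⟩

theorem definable_pair : Definable₃ fun a b c => Nat.pair a b = c := by
  have h : Definable fun s => (s 0 < s 1 ∧ s 1 * s 1 + s 0 = s 2) ∨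
      (¬ s 0 < s 1 ∧ s 0 * s 0 + s 0 + s 1 = s 2) :=
    ((definable_lt.comp (.var 0) (.var 1)).and
      (.eq (((IsTerm.var 1).mul (.var 1)).add (.var 0)) (.var 2))).or
    ((definable_lt.comp (.var 0) (.var 1)).not.and
      (.eq ((((IsTerm.var 0).mul (.var 0)).add (.var 0)).add (.var 1)) (.var 2)))
  refine h.of_iff fun s => ?_
  show (if s 0 < s 1 then _ else _) = _ ↔ _
  split_ifs with h <;> simp [h]

/-- For c = ⟨a, b⟩ the value is the remainder of a modulo (i + 1)b + 1, expressed through the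
quotient q. -/
theorem definable_beta : Definable₃ fun c i y => Nat.beta c i = y := by
  have h : Definable fun s => ∃ a, ∃ b, ∃ q, Nat.pair a b = s 0 ∧
      q * ((s 1 + 1) * b + 1) + s 2 = a ∧ s 2 < (s 1 + 1) * b + 1 := by
    -- Under the three quantifiers q, b, a are variables 0, 1, 2, and the original variables move up
    -- by three.
    refine .ex (.ex (.ex ?_))
    have hm : IsTerm fun s => (s 4 + 1) * s 1 + 1 := (((IsTerm.var 4).succ).mul (.var 1)).succ
    exact (definable_pair.comp (.var 2) (.var 1) (.var 3)).and
      ((Definable.eq (((IsTerm.var 0).mul hm).add (.var 5)) (.var 2)).and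
        (definable_lt.comp (.var 5) hm))
  refine h.of_iff fun s => ?_
  unfold Nat.beta
  constructor
  · intro h
    refine ⟨(s 0).unpair.1, (s 0).unpair.2, (s 0).unpair.1 / ((s 1 + 1) * (s 0).unpair.2 + 1),
      Nat.pair_unpair _, ?_, ?_⟩
    · rw [← h, mul_comm]
      exact Nat.div_add_mod _ _
    · rw [← h]
      exact Nat.mod_lt _ (Nat.succ_pos _)
  · rintro ⟨a, b, q, hp, ha, hlt⟩
    rw [← hp, Nat.unpair_pair, ← ha]
    simp only [Nat.mul_add_mod', Nat.mod_eq_of_lt hlt]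

/-- A partial function with an arithmetically definable graph. -/
def GraphDefinable (f : ℕ →. ℕ) : Prop := Definable₂ fun a b => b ∈ f a

theorem GraphDefinable.of_iff {f : ℕ →. ℕ}
    {R : ℕ → ℕ → Prop} (h : Definable fun s => R (s 0) (s 1)) (hR : ∀ a b, b ∈ f a ↔ R a b) :
    GraphDefinable f :=
  Definable.of_iff h fun s => hR (s 0) (s 1)

/-- All intermediate values of the recursion are packed into one number c; `Nat.unbeta` provides
such a code for any finite list. -/
theorem mem_primrec_iff_exists_beta {f : ℕ →. ℕ} {g : ℕ →. ℕ} {a n y : ℕ} :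
    y ∈ (Nat.rec (f a) (fun y IH => IH.bind fun i => g (Nat.pair a (Nat.pair y i))) n : Part ℕ) ↔
      ∃ c, Nat.beta c 0 ∈ f a ∧
        (∀ i, i < n → Nat.beta c (i + 1) ∈ g (Nat.pair a (Nat.pair i (Nat.beta c i)))) ∧
        Nat.beta c n = y := by
  set r : ℕ → Part ℕ := fun n =>
    Nat.rec (f a) (fun y IH => IH.bind fun i => g (Nat.pair a (Nat.pair y i))) n with hr
  have hsucc : ∀ n, r (n + 1) = (r n).bind fun i => g (Nat.pair a (Nat.pair n i)) := fun _ => rfl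
  change y ∈ r n ↔ _
  constructor
  · intro h
    have hex : ∀ n y, y ∈ r n → ∃ l : List ℕ, l.length = n + 1 ∧ l.getD 0 0 ∈ f a ∧
        (∀ i, i < n → l.getD (i + 1) 0 ∈ g (Nat.pair a (Nat.pair i (l.getD i 0)))) ∧
        l.getD n 0 = y := by
      intro n
      induction n with
      | zero => exact fun y hy => ⟨[y], rfl, hy, by simp, rfl⟩
      | succ n ih =>
        intro y hy
        rw [hsucc] at hy
        obtain ⟨z, hz, hy⟩ := Part.mem_bind_iff.1 hy
        obtain ⟨l, hlen, h₀, hl, rfl⟩ := ih z hz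
        have hlt : ∀ i, i ≤ n → (l ++ [y]).getD i 0 = l.getD i 0 := fun i hi =>
          List.getD_append _ _ _ _ (by omega)
        have hlast : (l ++ [y]).getD (n + 1) 0 = y := by
          rw [List.getD_append_right _ _ _ _ (by omega)]; simp [hlen]
        refine ⟨l ++ [y], by simp [hlen], by rwa [hlt 0 (by omega)], fun i hi => ?_, hlast⟩
        rw [hlt i (by omega)]
        rcases Nat.lt_succ_iff_lt_or_eq.1 hi with hi | rfl
        · rw [hlt (i + 1) (by omega)]
          exact hl i hi
        · rwa [hlast]
    obtain ⟨l, hlen, h₀, hl, hy⟩ := hex n y h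
    have hb : ∀ i, i ≤ n → Nat.beta (Nat.unbeta l) i = l.getD i 0 := by
      intro i hi
      have := Nat.beta_unbeta_coe l ⟨i, by omega⟩
      rw [List.getD_eq_getElem _ _ (by omega)]
      exact this
    refine ⟨Nat.unbeta l, by rwa [hb 0 (by omega)], fun i hi => ?_, by rwa [hb n le_rfl]⟩
    rw [hb i (by omega), hb (i + 1) (by omega)]
    exact hl i hi
  · rintro ⟨c, h₀, hc, rfl⟩
    have : ∀ i, i ≤ n → Nat.beta c i ∈ r i := by
      intro i
      induction i with
      | zero => exact fun _ => h₀
      | succ i ih =>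
        intro hi
        rw [hsucc]
        exact Part.mem_bind_iff.2 ⟨_, ih (by omega), hc i (by omega)⟩
    exact this n le_rfl

theorem graphDefinable_of_partrec {f : ℕ →. ℕ} (hf : Nat.Partrec f) : GraphDefinable f := by
  induction hf with
  | zero => exact .of_iff (R := fun _ b => b = 0) (.eq (.var 1) (.const 0)) fun _ _ => Part.mem_some_iff
  | succ =>
    exact .of_iff (R := fun a b => b = a + 1) (.eq (.var 1) (IsTerm.var 0).succ)
      fun _ _ => Part.mem_some_iff
  | left =>
    refine .of_iff (R := fun a b => ∃ c, Nat.pair b c = a)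
      (.ex (definable_pair.comp (.var 2) (.var 0) (.var 1))) fun a b => ?_
    refine Part.mem_some_iff.trans ⟨?_, ?_⟩
    · rintro rfl; exact ⟨a.unpair.2, Nat.pair_unpair a⟩
    · rintro ⟨c, rfl⟩; simp
  | right =>
    refine .of_iff (R := fun a b => ∃ c, Nat.pair c b = a)
      (.ex (definable_pair.comp (.var 0) (.var 2) (.var 1))) fun a b => ?_
    refine Part.mem_some_iff.trans ⟨?_, ?_⟩
    · rintro rfl; exact ⟨a.unpair.1, Nat.pair_unpair a⟩
    · rintro ⟨c, rfl⟩; simp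
  | @pair f g _ _ ihf ihg =>
    refine .of_iff (R := fun a y => ∃ b, ∃ c, b ∈ f a ∧ c ∈ g a ∧ Nat.pair b c = y)
      (.ex (.ex ?_)) fun a y => ?_
    · exact (ihf.comp (.var 2) (.var 1)).and ((ihg.comp (.var 2) (.var 0)).and
        (definable_pair.comp (.var 1) (.var 0) (.var 3)))
    · simp [Seq.seq]
  | @comp f g _ _ ihf ihg =>
    refine .of_iff (R := fun a y => ∃ b, b ∈ g a ∧ y ∈ f b)
      (.ex ?_) fun a y => Part.mem_bind_iff
    exact (ihg.comp (.var 1) (.var 0)).and (ihf.comp (.var 0) (.var 2))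
  | @prec f g _ _ ihf ihg =>
    -- Here u and v are consecutive values of the recursion, and q and r build the nested pair on
    -- which g is evaluated.
    refine .of_iff (R := fun p y => ∃ a, ∃ n, ∃ c, Nat.pair a n = p ∧
      (∃ z, Nat.beta c 0 = z ∧ z ∈ f a) ∧ (∀ i, i < n → ∃ u, ∃ v, ∃ q, ∃ r, Nat.beta c i = u ∧
        Nat.beta c (i + 1) = v ∧ Nat.pair i u = q ∧ Nat.pair a q = r ∧ v ∈ g r) ∧
      Nat.beta c n = y) (.ex (.ex (.ex ?_))) fun p y => ?_
    · refine (definable_pair.comp (.var 2) (.var 1) (.var 3)).and (.and (.ex ?_) (.and (.all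
        (.imp ?_ (.ex (.ex (.ex (.ex ?_)))))) (definable_beta.comp (.var 0) (.var 1) (.var 4))))
      · exact (definable_beta.comp (.var 1) (.const 0) (.var 0)).and (ihf.comp (.var 3) (.var 0))
      · exact definable_lt.comp (.var 0) (.var 2)
      · exact (definable_beta.comp (.var 5) (.var 4) (.var 3)).and
          ((definable_beta.comp (.var 5) (IsTerm.var 4).succ (.var 2)).and
          ((definable_pair.comp (.var 4) (.var 3) (.var 1)).and
          ((definable_pair.comp (.var 7) (.var 1) (.var 0)).and (ihg.comp (.var 0) (.var 2)))))
    · simp only [Nat.unpaired, existsAndEq, true_and]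
      refine mem_primrec_iff_exists_beta.trans ⟨?_, ?_⟩
      · rintro h
        exact ⟨_, _, h.imp fun c h => ⟨Nat.pair_unpair p, h⟩⟩
      · rintro ⟨a, n, c, rfl, h⟩
        simp only [Nat.unpair_pair]
        exact ⟨c, h⟩
  | @rfind f _ ih =>
    refine .of_iff (R := fun a n => (∃ p, ∃ z, Nat.pair a n = p ∧ 0 = z ∧ z ∈ f p) ∧
      ∀ m, m < n → ∃ p, ∃ z, Nat.pair a m = p ∧ z ∈ f p ∧ ¬ z = 0)
      (.and (.ex (.ex ?_)) (.all (.imp ?_ (.ex (.ex ?_))))) fun a n => ?_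
    · exact (definable_pair.comp (.var 2) (.var 3) (.var 1)).and
        ((Definable.eq (.const 0) (.var 0)).and (ih.comp (.var 1) (.var 0)))
    · exact definable_lt.comp (.var 0) (.var 2)
    · exact (definable_pair.comp (.var 3) (.var 2) (.var 1)).and
        ((ih.comp (.var 1) (.var 0)).and (Definable.eq (.var 0) (.const 0)).not)
    · refine Nat.mem_rfind.trans ?_
      simp

/-- The universal partial recursive function has a definable graph, and membership in W_e says that
it has a value. -/
theorem exists_saysPairMemW : ∃ θ : Formula, SaysPairMemW θ := by
  have hpart : Nat.Partrec fun p =>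
      (Nat.Partrec.Code.eval (Denumerable.ofNat Nat.Partrec.Code p.unpair.1) p.unpair.2) :=
    Partrec.nat_iff.1 (Nat.Partrec.Code.eval_part.comp
      ((Computable.ofNat _).comp (Computable.fst.comp Computable.unpair))
      (Computable.snd.comp Computable.unpair))
  have hgraph := graphDefinable_of_partrec hpart
  have hdef : Definable fun s => ∃ p, ∃ q, ∃ y, Nat.pair (s 0) (s 1) = p ∧ Nat.pair (s 2) p = q ∧
      y ∈ Nat.Partrec.Code.eval (Denumerable.ofNat Nat.Partrec.Code q.unpair.1) q.unpair.2 :=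
    .ex (.ex (.ex ((definable_pair.comp (.var 3) (.var 4) (.var 2)).and
      ((definable_pair.comp (.var 5) (.var 2) (.var 1)).and (hgraph.comp (.var 1) (.var 0))))))
  obtain ⟨φ, hφ, hφR⟩ := hdef
  -- The defined relation depends on three variables only, so any others left in the formula may be
  -- replaced by zero.
  let σ : ℕ → Term
    | 0 => .var 0
    | 1 => .var 1
    | 2 => .var 2
    | _ + 3 => .zero
  refine ⟨φ.subst σ, hφ.subst σ, ?_, fun s => ?_⟩
  · intro k hk
    obtain ⟨j, _, hk⟩ := Formula.mem_fv_subst.1 hk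
    rcases j with _ | _ | _ | j
    · exact Or.inl hk
    · exact Or.inr (Or.inl hk)
    · exact Or.inr (Or.inr hk)
    · exact hk.elim
  · rw [natStructure_sat_subst hφ, ← holds_iff_of_arithmetical (Γ := ∅) hφ, hφR]
    simp only [existsAndEq, true_and, Nat.unpair_pair]
    exact Part.dom_iff_mem.symm

/-! ## Horn clause programs over the natural numbers -/

/-- Terms built from variables, a parameter and constants by successor and pairing. -/
inductive Pat : Type
  | var : ℕ → Pat
  | param : Pat
  | const : ℕ → Pat
  | succ : Pat → Pat
  | pair : Pat → Pat → Pat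

/-- The value of a pattern, for the value `n` of the parameter and the values `e` of the
variables. -/
def Pat.eval (n : ℕ) (e : List ℕ) : Pat → ℕ
  | var i => e.getD i 0
  | param => n
  | const k => k
  | succ p => p.eval n e + 1
  | pair p q => Nat.pair (p.eval n e) (q.eval n e)

/-- A Horn clause: the head follows from the body. -/
structure Clause : Type where
  body : List Pat
  head : Pat

/-- The least set that is closed under the clauses. -/
inductive Deduces (C : List Clause) (n : ℕ) : ℕ → Prop
  | intro (c : Clause) (e : List ℕ) : c ∈ C → (∀ b ∈ c.body, Deduces C n (b.eval n e)) →
      Deduces C n (c.head.eval n e)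

/-- One round of deductions from the facts `F` by instances of the clauses under `e`. -/
def hornStep (n : ℕ) (e F : List ℕ) : List Clause → List ℕ
  | [] => F
  | c :: C => if ∀ b ∈ c.body, b.eval n e ∈ F then c.head.eval n e :: hornStep n e F C
      else hornStep n e F C

/-- The facts which are deduced when the clauses are applied under the members of `l`. -/
def hornRun (C : List Clause) (n : ℕ) (l : List (List ℕ)) : List ℕ :=
  l.foldr (fun e F => hornStep n e F C) []

section Horn

variable {C : List Clause} {n : ℕ}

theorem mem_hornStep {e F : List ℕ} {x : ℕ} : x ∈ hornStep n e F C ↔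
    x ∈ F ∨ ∃ c ∈ C, (∀ b ∈ c.body, b.eval n e ∈ F) ∧ x = c.head.eval n e := by
  induction C with
  | nil => simp [hornStep]
  | cons c C ih =>
    rw [hornStep]
    split_ifs with h
    · rw [List.mem_cons, ih]
      simp only [List.mem_cons, exists_eq_or_imp]
      tauto
    · simp only [List.mem_cons, ih, exists_eq_or_imp, h, false_and, false_or]

theorem hornRun_append_superset (l l' : List (List ℕ)) : hornRun C n l' ⊆ hornRun C n (l ++ l') := by
  induction l with
  | nil => exact fun _ h => h
  | cons e l ih => exact fun x hx => mem_hornStep.2 (Or.inl (ih hx))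

theorem hornRun_subset_append (l l' : List (List ℕ)) : hornRun C n l ⊆ hornRun C n (l ++ l') := by
  induction l with
  | nil => simp [hornRun]
  | cons e l ih =>
    intro x hx
    rcases mem_hornStep.1 hx with h | ⟨c, hc, hb, rfl⟩
    · exact mem_hornStep.2 (Or.inl (ih h))
    · exact mem_hornStep.2 (Or.inr ⟨c, hc, fun b h => ih (hb b h), rfl⟩)

/-- A derivation tree is flattened to the list of environments it uses. Runs grow under
concatenation on either side, so the lists for the premises can be joined. -/
theorem deduces_iff_exists_hornRun {x : ℕ} : Deduces C n x ↔ ∃ l, x ∈ hornRun C n l := by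
  constructor
  · intro h
    induction h with
    | intro c e hc _ ih =>
      have : ∀ B : List Pat, (∀ b ∈ B, ∃ l, b.eval n e ∈ hornRun C n l) →
          ∃ l, ∀ b ∈ B, b.eval n e ∈ hornRun C n l := by
        intro B
        induction B with
        | nil => simp
        | cons b B ihB =>
          intro h
          obtain ⟨l, hl⟩ := h b List.mem_cons_self
          obtain ⟨l', hl'⟩ := ihB fun b hb => h b (List.mem_cons_of_mem _ hb)
          refine ⟨l ++ l', fun b' hb' => ?_⟩
          rcases List.mem_cons.1 hb' with rfl | hb'
          · exact hornRun_subset_append _ _ hl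
          · exact hornRun_append_superset _ _ (hl' b' hb')
      obtain ⟨l, hl⟩ := this c.body ih
      exact ⟨e :: l, mem_hornStep.2 (Or.inr ⟨c, hc, hl, rfl⟩)⟩
  · rintro ⟨l, hl⟩
    induction l generalizing x with
    | nil => simp [hornRun] at hl
    | cons e l ih =>
      rcases mem_hornStep.1 hl with h | ⟨c, hc, hb, rfl⟩
      · exact ih h
      · exact .intro c e hc fun b h => ih (hb b h)

/-- `D` is closed under the instance of the clause under `e`. -/
def Clause.ClosedAt (D : ℕ → Prop) (n : ℕ) (e : List ℕ) (c : Clause) : Prop :=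
  c.body.foldr (fun b P => D (b.eval n e) → P) (D (c.head.eval n e))

theorem clause_closedAt_iff {D : ℕ → Prop} {e : List ℕ} {c : Clause} :
    c.ClosedAt D n e ↔ ((∀ b ∈ c.body, D (b.eval n e)) → D (c.head.eval n e)) := by
  obtain ⟨B, p⟩ := c
  induction B with
  | nil => simp [Clause.ClosedAt]
  | cons b B ih =>
    simp only [Clause.ClosedAt, List.foldr_cons, List.forall_mem_cons, and_imp] at ih ⊢
    rw [ih]

/-- `D` is closed under the clauses. -/
def ClosedUnder (D : ℕ → Prop) (n : ℕ) : List Clause → Prop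
  | [] => True
  | c :: C => (∀ e, c.ClosedAt D n e) ∧ ClosedUnder D n C

theorem closedUnder_iff {D : ℕ → Prop} :
    ClosedUnder D n C ↔ ∀ c ∈ C, ∀ e, c.ClosedAt D n e := by
  induction C with
  | nil => simp [ClosedUnder]
  | cons c C ih => simp [ClosedUnder, ih]

theorem closedUnder_append {D : ℕ → Prop} {C' : List Clause} :
    ClosedUnder D n (C ++ C') ↔ ClosedUnder D n C ∧ ClosedUnder D n C' := by
  simp only [closedUnder_iff, List.forall_mem_append]

theorem closedUnder_deduces : ClosedUnder (Deduces C n) n C :=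
  closedUnder_iff.2 fun c hc e => clause_closedAt_iff.2 (Deduces.intro c e hc)

theorem Deduces.of_closedUnder {D : ℕ → Prop} (hD : ClosedUnder D n C) {x : ℕ}
    (h : Deduces C n x) : D x := by
  induction h with
  | intro c e hc _ ih => exact clause_closedAt_iff.1 (closedUnder_iff.1 hD c hc e) ih

end Horn

/-! ### Primitive recursiveness of running a program. -/

theorem primrec_pat_eval (p : Pat) : Primrec fun a : ℕ × List ℕ => p.eval a.1 a.2 := by
  induction p with
  | var i => exact (Primrec.list_getD 0).comp Primrec.snd (Primrec.const i)
  | param => exact Primrec.fst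
  | const k => exact Primrec.const k
  | succ p ih => exact Primrec.succ.comp ih
  | pair p q ihp ihq => exact Primrec₂.natPair.comp ihp ihq

theorem primrecRel_list_mem : PrimrecRel fun (x : ℕ) (l : List ℕ) => x ∈ l :=
  (Primrec.nat_lt.comp (Primrec.list_idxOf.comp Primrec.fst Primrec.snd)
    (Primrec.list_length.comp Primrec.snd)).of_eq fun _ => List.idxOf_lt_length_iff

/-- The program is fixed, so the recursion over its clauses takes place outside; only the parameter,
the environment and the facts are data. -/
theorem primrec_hornStep (C : List Clause) :
    Primrec fun a : ℕ × List ℕ × List ℕ => hornStep a.1 a.2.1 a.2.2 C := by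
  have heval : ∀ p : Pat, Primrec fun a : ℕ × List ℕ × List ℕ => p.eval a.1 a.2.1 := fun p =>
    (primrec_pat_eval p).comp (Primrec.fst.pair (Primrec.fst.comp Primrec.snd))
  have hF : Primrec fun a : ℕ × List ℕ × List ℕ => a.2.2 := Primrec.snd.comp Primrec.snd
  induction C with
  | nil => exact hF
  | cons c C ih =>
    have hbody : ∀ B : List Pat,
        PrimrecPred fun a : ℕ × List ℕ × List ℕ => ∀ b ∈ B, b.eval a.1 a.2.1 ∈ a.2.2 := by
      intro B
      induction B with
      | nil => exact (Primrec.eq.comp (Primrec.const 0) (Primrec.const 0)).of_eq fun _ => by simp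
      | cons b B ihB =>
        exact ((primrecRel_list_mem.comp (heval b) hF).and ihB).of_eq fun _ => by simp
    exact Primrec.ite (hbody c.body) (Primrec.list_cons.comp (heval c.head) ih) ih

theorem primrec_hornRun (C : List Clause) :
    Primrec fun a : ℕ × List (List ℕ) => hornRun C a.1 a.2 :=
  Primrec.list_foldr (h := fun (a : ℕ × List (List ℕ)) (p : List ℕ × List ℕ) => hornStep a.1 p.1 p.2 C)
     Primrec.snd (Primrec.const [])
    ((primrec_hornStep C).comp ((Primrec.fst.comp Primrec.fst).pair Primrec.snd))

/-- By Kleene's recursion theorem, some index enumerates what a program deduces from it. -/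
theorem exists_index_of_program (C : List Clause) {g : ℕ → ℕ} (hg : Primrec g) :
    ∃ n, W n = {p | Deduces C n (g p)} := by
  -- The number j is read as a list of environments, and the code's own encoding is the parameter.
  -- The unbounded search over j halts exactly if some run reaches the fact `g p`.
  let test : (Nat.Partrec.Code × ℕ) → ℕ → Bool := fun a j =>
    decide (g a.2 ∈ hornRun C (Encodable.encode a.1)
      (Denumerable.ofNat (List (List ℕ)) j))
  have htest : Computable₂ test := by
    refine (PrimrecPred.decide (p := fun b : (Nat.Partrec.Code × ℕ) × ℕ =>
      g b.1.2 ∈ hornRun C (Encodable.encode b.1.1)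
        (Denumerable.ofNat (List (List ℕ)) b.2)) ?_).to_comp
    exact primrecRel_list_mem.comp
      (hg.comp (Primrec.snd.comp Primrec.fst))
      ((primrec_hornRun C).comp ((Primrec.encode.comp (Primrec.fst.comp Primrec.fst)).pair
        ((Primrec.ofNat _).comp Primrec.snd)))
  obtain ⟨c, hc⟩ := Nat.Partrec.Code.fixed_point₂
    (f := fun c p => Nat.rfind fun j => Part.some (test (c, p) j))
    (Partrec.rfind htest.partrec₂)
  refine ⟨Encodable.encode c, Set.ext fun p => ?_⟩
  simp only [W, Denumerable.ofNat_encode, Set.mem_ofPred_eq, hc]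
  rw [deduces_iff_exists_hornRun]
  refine Nat.rfind_dom'.trans ⟨?_, ?_⟩
  · rintro ⟨j, hj, _⟩
    exact ⟨_, of_decide_eq_true (Part.mem_some_iff.1 hj).symm⟩
  · rintro ⟨l, hl⟩
    refine ⟨Encodable.encode l, ?_, fun _ => trivial⟩
    refine Part.mem_some_iff.2 (decide_eq_true ?_).symm
    rwa [Denumerable.ofNat_encode]

/-! ## Substitutions given by finite lists -/

/-- The Gödel number of a list of terms. -/
def gnTerms : List Term → ℕ
  | [] => 0
  | t :: S => Nat.pair t.gn (gnTerms S) + 1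

theorem gnTerms_injective : Function.Injective gnTerms := by
  intro S
  induction S with
  | nil => intro S' h; cases S' <;> simp_all [gnTerms]
  | cons t S ih =>
    intro S' h
    cases S' with
    | nil => simp [gnTerms] at h
    | cons t' S' =>
      simp only [gnTerms, Nat.add_right_cancel_iff, Nat.pair_eq_pair] at h
      rw [Term.gn_injective h.1, ih h.2]

/-- The substitution given by a list of terms; it is used for variables below the length only. -/
def toSubst (S : List Term) (k : ℕ) : Term := S.getD k .zero

/-- The list gives the values of `σ` for the variables below its length. -/
def Agree (S : List Term) (σ : ℕ → Term) : Prop := ∀ k < S.length, toSubst S k = σ k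

theorem Agree.nil (σ : ℕ → Term) : Agree [] σ := fun _ h => (Nat.not_lt_zero _ h).elim

theorem Agree.cons {S : List Term} {σ : ℕ → Term} (h : Agree S fun k => σ (k + 1)) :
    Agree (σ 0 :: S) σ := by
  rintro (_ | k) hk
  · rfl
  · exact h k (Nat.lt_of_succ_lt_succ hk)

theorem Agree.congr {S : List Term} {σ τ : ℕ → Term} (h : Agree S σ) (hστ : ∀ k, σ k = τ k) :
    Agree S τ := fun k hk => (h k hk).trans (hστ k)

theorem Agree.subst {S : List Term} {σ : ℕ → Term} (h : Agree S σ) {φ : Formula}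
    (hφ : ∀ k ∈ φ.fv, k < S.length) : φ.subst (toSubst S) = φ.subst σ :=
  Formula.subst_ext fun k hk => h k (hφ k hk)

/-- The term with all variables raised by one. -/
def Term.shift (t : Term) : Term := t.subst fun k => .var (k + 1)

theorem toSubst_lift (S : List Term) :
    toSubst (.var 0 :: S.map Term.shift) = liftSubst (toSubst S) := by
  funext k
  cases k with
  | zero => rfl
  | succ k =>
    -- The default value zero is closed, hence fixed by the shift; so the two sides agree beyond the
    -- length of the list as well.
    show (S.map Term.shift).getD k (Term.shift .zero) = _
    rw [List.getD_map]
    rfl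

/-! ## A program for entailment from the machine's axioms -/

/-- The relations between Gödel numbers which the program computes. -/
inductive FactKind : Type
  | term | form | terms | look | substTerm | ident | shift | shifts | substForm | close | allVar
  | single | inst | openAt | lt | free | sentence | closes | numeral | numerals | logical | derives
  | valid | global | known | machine | goal
  deriving DecidableEq

/-- The code of the statement that a relation holds. -/
def fact (r : FactKind) (a b c d : ℕ) : ℕ :=
  Nat.pair r.ctorIdx (Nat.pair a (Nat.pair b (Nat.pair c d)))

theorem fact_inj {r r' : FactKind} {a b c d a' b' c' d' : ℕ} :
    fact r a b c d = fact r' a' b' c' d' ↔ r = r' ∧ a = a' ∧ b = b' ∧ c = c' ∧ d = d' := by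
  have : r.ctorIdx = r'.ctorIdx ↔ r = r' :=
    ⟨fun h => by rw [← FactKind.ofNat_ctorIdx r, h, FactKind.ofNat_ctorIdx], fun h => by rw [h]⟩
  simp [fact, this]

/-- What the relations mean. -/
def Interp (θ : Formula) (n : ℕ) : FactKind → ℕ → ℕ → ℕ → ℕ → Prop
  | .term, a, _, _, _ => ∃ t : Term, t.gn = a
  | .form, a, _, _, _ => ∃ φ : Formula, φ.gn = a
  | .terms, a, _, _, _ => ∃ S, gnTerms S = a
  | .look, a, k, b, _ => ∃ S, k < S.length ∧ gnTerms S = a ∧ (toSubst S k).gn = b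
  | .substTerm, a, b, c, _ => ∃ S, ∃ t : Term, (∀ k ∈ t.fv, k < S.length) ∧
      gnTerms S = a ∧ t.gn = b ∧ (t.subst (toSubst S)).gn = c
  | .ident, i, a, _, _ => ∃ S, Agree S (fun k => .var (i + k)) ∧ gnTerms S = a
  | .shift, a, b, _, _ => ∃ t : Term, t.gn = a ∧ t.shift.gn = b
  | .shifts, a, b, _, _ => ∃ S, gnTerms S = a ∧ gnTerms (S.map Term.shift) = b
  | .substForm, a, b, c, _ => ∃ S, ∃ φ : Formula, (∀ k ∈ φ.fv, k < S.length) ∧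
      gnTerms S = a ∧ φ.gn = b ∧ (φ.subst (toSubst S)).gn = c
  | .close, d, i, a, _ => ∃ S, Agree S (fun k => .var (if k = d then 0 else i + k + 1)) ∧
      gnTerms S = a
  | .allVar, x, a, b, _ => ∃ φ : Formula, φ.gn = a ∧ (φ.allVar x).gn = b
  | .single, d, i, a, b => ∃ t S, Agree S (fun k => if k = d then t else .var (i + k)) ∧
      t.gn = a ∧ gnTerms S = b
  | .inst, x, a, b, c => ∃ (t : Term) (φ : Formula), t.gn = a ∧ φ.gn = b ∧ (φ.inst x t).gn = c
  | .openAt, k, a, b, _ => ∃ φ : Formula, φ.gn = a ∧ (φ.openAt k).gn = b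
  | .lt, a, b, _, _ => a < b
  | .free, x, a, _, _ => ∃ φ : Formula, x ∈ φ.fv ∧ φ.gn = a
  | .sentence, a, _, _, _ => ∃ φ : Formula, φ.fv = ∅ ∧ φ.gn = a
  | .closes, a, b, _, _ => ∃ ψ φ : Formula, ψ.Closes φ ∧ ψ.gn = a ∧ φ.gn = b
  | .numeral, m, a, _, _ => (numeral m).gn = a
  | .numerals, a, _, _, _ => ∃ S, (∃ s : ℕ → ℕ, Agree S fun k => numeral (s k)) ∧ gnTerms S = a
  | .logical, a, _, _, _ => ∃ φ, LogicalAxiom φ ∧ φ.gn = a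
  | .derives, g, a, _, _ => ∃ φ, Derives (if g = 0 then ∅ else machineTheory θ n) φ ∧ φ.gn = a
  | .valid, a, _, _, _ => ∃ φ, Valid φ ∧ φ.gn = a
  | .global, a, _, _, _ => ∃ φ, GlobalAxiom θ n φ ∧ φ.gn = a
  | .known, a, _, _, _ => ∃ φ, KnownAxiom θ n φ ∧ φ.gn = a
  | .machine, a, _, _, _ => ∃ φ, MachineAxiom θ n φ ∧ φ.gn = a
  | .goal, p, _, _, _ => ∃ (m : ℕ) (φ : Formula) (x : ℕ), p = Nat.pair m φ.gn ∧ φ.fv ⊆ {x} ∧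
      Entails (machineTheory θ n) (φ.inst x (numeral m))

/-- The code of a true fact. -/
def TrueFact (θ : Formula) (n p : ℕ) : Prop :=
  ∃ r a b c d, p = fact r a b c d ∧ Interp θ n r a b c d

theorem trueFact_fact {θ : Formula} {n : ℕ} {r : FactKind} {a b c d : ℕ} :
    TrueFact θ n (fact r a b c d) ↔ Interp θ n r a b c d := by
  constructor
  · rintro ⟨r', a', b', c', d', h, h'⟩
    obtain ⟨rfl, rfl, rfl, rfl, rfl⟩ := fact_inj.1 h
    exact h'
  · exact fun h => ⟨r, a, b, c, d, rfl, h⟩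

namespace Pat

/-- The pattern of the statement that a relation holds. -/
def rel (r : FactKind) (a : Pat) (b c d : Pat := .const 0) : Pat :=
  pair (const r.ctorIdx) (pair a (pair b (pair c d)))

theorem eval_rel (n : ℕ) (e : List ℕ) (r : FactKind) (a b c d : Pat) : (rel r a b c d).eval n e =
    fact r (a.eval n e) (b.eval n e) (c.eval n e) (d.eval n e) := rfl

def tVar (k : Pat) : Pat := pair (const 0) k
def tSucc (t : Pat) : Pat := pair (const 2) t
def tAdd (t u : Pat) : Pat := pair (const 3) (pair t u)
def tMul (t u : Pat) : Pat := pair (const 4) (pair t u)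
def fEq (t u : Pat) : Pat := pair (const 0) (pair t u)
def fImp (φ ψ : Pat) : Pat := pair (const 2) (pair φ ψ)
def fAll (φ : Pat) : Pat := pair (const 3) φ
def fKnow (φ : Pat) : Pat := pair (const 4) φ
def tZero : Pat := const Term.zero.gn
def fBot : Pat := const Formula.bot.gn
def fNeg (φ : Pat) : Pat := fImp φ fBot
def fIff (φ ψ : Pat) : Pat := fNeg (fImp (fImp φ ψ) (fNeg (fImp ψ φ)))
def sNil : Pat := const 0
def sCons (t S : Pat) : Pat := succ (pair t S)

end Pat

/-! ### The clauses, grouped by relation. -/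

section Rules

open Pat

def termRules : List Clause :=
  [⟨[], rel .term (tVar (var 0))⟩,
   ⟨[], rel .term tZero⟩,
   ⟨[rel .term (var 0)], rel .term (tSucc (var 0))⟩,
   ⟨[rel .term (var 0), rel .term (var 1)], rel .term (tAdd (var 0) (var 1))⟩,
   ⟨[rel .term (var 0), rel .term (var 1)], rel .term (tMul (var 0) (var 1))⟩]

def formRules : List Clause :=
  [⟨[rel .term (var 0), rel .term (var 1)], rel .form (fEq (var 0) (var 1))⟩,
   ⟨[], rel .form fBot⟩,
   ⟨[rel .form (var 0), rel .form (var 1)], rel .form (fImp (var 0) (var 1))⟩,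
   ⟨[rel .form (var 0)], rel .form (fAll (var 0))⟩,
   ⟨[rel .form (var 0)], rel .form (fKnow (var 0))⟩]

def termsRules : List Clause :=
  [⟨[], rel .terms sNil⟩,
   ⟨[rel .term (var 0), rel .terms (var 1)], rel .terms (sCons (var 0) (var 1))⟩]

def lookRules : List Clause :=
  [⟨[rel .term (var 0), rel .terms (var 1)], rel .look (sCons (var 0) (var 1)) (const 0) (var 0)⟩,
   ⟨[rel .term (var 0), rel .look (var 1) (var 2) (var 3)], rel .look (sCons (var 0) (var 1)) (succ (var 2)) (var 3)⟩]

def substTermRules : List Clause :=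
  [⟨[rel .look (var 0) (var 1) (var 2)], rel .substTerm (var 0) (tVar (var 1)) (var 2)⟩,
   ⟨[rel .terms (var 0)], rel .substTerm (var 0) tZero tZero⟩,
   ⟨[rel .substTerm (var 0) (var 1) (var 2)], rel .substTerm (var 0) (tSucc (var 1)) (tSucc (var 2))⟩,
   ⟨[rel .substTerm (var 0) (var 1) (var 2), rel .substTerm (var 0) (var 3) (var 4)],
      rel .substTerm (var 0) (tAdd (var 1) (var 3)) (tAdd (var 2) (var 4))⟩,
   ⟨[rel .substTerm (var 0) (var 1) (var 2), rel .substTerm (var 0) (var 3) (var 4)],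
      rel .substTerm (var 0) (tMul (var 1) (var 3)) (tMul (var 2) (var 4))⟩]

/-- Yields initial segments of k ↦ variable i + k of every length, so one long enough for a given
formula is always available. -/
def identRules : List Clause :=
  [⟨[], rel .ident (var 0) sNil⟩,
   ⟨[rel .ident (succ (var 0)) (var 1)], rel .ident (var 0) (sCons (tVar (var 0)) (var 1))⟩]

def shiftRules : List Clause :=
  [⟨[rel .ident (const 1) (var 0), rel .substTerm (var 0) (var 1) (var 2)], rel .shift (var 1) (var 2)⟩]

def shiftsRules : List Clause :=
  [⟨[], rel .shifts sNil sNil⟩,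
   ⟨[rel .shift (var 0) (var 1), rel .shifts (var 2) (var 3)], rel .shifts (sCons (var 0) (var 2)) (sCons (var 1) (var 3))⟩]

def substFormRules : List Clause :=
  [⟨[rel .substTerm (var 0) (var 1) (var 2), rel .substTerm (var 0) (var 3) (var 4)],
      rel .substForm (var 0) (fEq (var 1) (var 3)) (fEq (var 2) (var 4))⟩,
   ⟨[rel .terms (var 0)], rel .substForm (var 0) fBot fBot⟩,
   ⟨[rel .substForm (var 0) (var 1) (var 2), rel .substForm (var 0) (var 3) (var 4)],
      rel .substForm (var 0) (fImp (var 1) (var 3)) (fImp (var 2) (var 4))⟩,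
   ⟨[rel .shifts (var 0) (var 1), rel .substForm (sCons (tVar (const 0)) (var 1)) (var 2) (var 3)],
      rel .substForm (var 0) (fAll (var 2)) (fAll (var 3))⟩,
   ⟨[rel .substForm (var 0) (var 1) (var 2)], rel .substForm (var 0) (fKnow (var 1)) (fKnow (var 2))⟩]

/-- In `close`, the first argument is the distance to the variable being bound and the second counts
the variables already passed. `single` works in the same way. -/
def bindRules : List Clause :=
  [⟨[rel .ident (succ (succ (var 0))) (var 1)],
      rel .close (const 0) (var 0) (sCons (tVar (const 0)) (var 1))⟩,
   ⟨[rel .close (var 0) (succ (var 1)) (var 2)], rel .close (succ (var 0)) (var 1) (sCons (tVar (succ (var 1))) (var 2))⟩,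
   ⟨[rel .close (var 0) (const 0) (var 1), rel .substForm (var 1) (var 2) (var 3)], rel .allVar (var 0) (var 2) (fAll (var 3))⟩]

def instRules : List Clause :=
  [⟨[rel .term (var 0), rel .ident (succ (var 1)) (var 2)], rel .single (const 0) (var 1) (var 0) (sCons (var 0) (var 2))⟩,
   ⟨[rel .single (var 0) (succ (var 1)) (var 2) (var 3)], rel .single (succ (var 0)) (var 1) (var 2) (sCons (tVar (var 1)) (var 3))⟩,
   ⟨[rel .single (var 0) (const 0) (var 1) (var 2), rel .substForm (var 2) (var 3) (var 4)], rel .inst (var 0) (var 1) (var 3) (var 4)⟩]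

def openAtRules : List Clause :=
  [⟨[rel .ident (const 0) (var 0), rel .substForm (sCons (tVar (var 1)) (var 0)) (var 2) (var 3)],
      rel .openAt (var 1) (var 2) (var 3)⟩]

/-- Horn clauses have no negation. That x is free in φ is expressed by φ(x|0) having a smaller or
larger Gödel number than φ. A sentence is a formula to which the empty substitution list applies,
since lookup fails beyond the length. -/
def freeRules : List Clause :=
  [⟨[], rel .lt (var 0) (succ (var 0))⟩,
   ⟨[rel .lt (var 0) (var 1)], rel .lt (var 0) (succ (var 1))⟩,
   ⟨[rel .inst (var 0) tZero (var 1) (var 2), rel .lt (var 1) (var 2)], rel .free (var 0) (var 1)⟩,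
   ⟨[rel .inst (var 0) tZero (var 1) (var 2), rel .lt (var 2) (var 1)], rel .free (var 0) (var 1)⟩,
   ⟨[rel .substForm sNil (var 0) (var 0)], rel .sentence (var 0)⟩]

def closesRules : List Clause :=
  [⟨[rel .sentence (var 0)], rel .closes (var 0) (var 0)⟩,
   ⟨[rel .free (var 0) (var 1), rel .allVar (var 0) (var 1) (var 2), rel .closes (var 3) (var 2)], rel .closes (var 3) (var 1)⟩]

def numeralRules : List Clause :=
  [⟨[], rel .numeral (const 0) tZero⟩,
   ⟨[rel .numeral (var 0) (var 1)], rel .numeral (succ (var 0)) (tSucc (var 1))⟩,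
   ⟨[], rel .numerals sNil⟩,
   ⟨[rel .numeral (var 0) (var 1), rel .numerals (var 2)], rel .numerals (sCons (var 1) (var 2))⟩]

def logicalRules : List Clause :=
  [⟨[rel .form (var 0), rel .form (var 1)], rel .logical (fImp (var 0) (fImp (var 1) (var 0)))⟩,
   ⟨[rel .form (var 0), rel .form (var 1), rel .form (var 2)],
      rel .logical (fImp (fImp (var 0) (fImp (var 1) (var 2))) (fImp (fImp (var 0) (var 1)) (fImp (var 0) (var 2))))⟩,
   ⟨[rel .form (var 0)], rel .logical (fImp (fImp (fImp (var 0) fBot) fBot) (var 0))⟩,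
   ⟨[rel .openAt (var 0) (var 1) (var 2)], rel .logical (fImp (fAll (var 1)) (var 2))⟩,
   ⟨[rel .openAt (succ (var 0)) (var 0) (var 1)], rel .logical (fImp (var 1) (fAll (var 0)))⟩,
   ⟨[rel .openAt (var 0) (var 1) (var 2), rel .openAt (var 3) (var 1) (var 4)],
      rel .logical (fImp (fEq (tVar (var 0)) (tVar (var 3))) (fImp (var 2) (var 4)))⟩,
   ⟨[rel .term (var 0)], rel .logical (fEq (var 0) (var 0))⟩,
   ⟨[rel .term (var 0), rel .term (var 1)], rel .logical (fImp (fEq (var 0) (var 1)) (fEq (var 1) (var 0)))⟩,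
   ⟨[rel .term (var 0), rel .term (var 1), rel .term (var 2)],
      rel .logical (fImp (fEq (var 0) (var 1)) (fImp (fEq (var 1) (var 2)) (fEq (var 0) (var 2))))⟩,
   ⟨[rel .term (var 0), rel .term (var 1)],
      rel .logical (fImp (fEq (var 0) (var 1)) (fEq (tSucc (var 0)) (tSucc (var 1))))⟩,
   ⟨[rel .term (var 0), rel .term (var 1), rel .term (var 2), rel .term (var 3)],
      rel .logical (fImp (fEq (var 0) (var 1)) (fImp (fEq (var 2) (var 3)) (fEq (tAdd (var 0) (var 2)) (tAdd (var 1) (var 3)))))⟩,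
   ⟨[rel .term (var 0), rel .term (var 1), rel .term (var 2), rel .term (var 3)],
      rel .logical (fImp (fEq (var 0) (var 1)) (fImp (fEq (var 2) (var 3)) (fEq (tMul (var 0) (var 2)) (tMul (var 1) (var 3)))))⟩,
   ⟨[rel .shift (var 0) (var 1)],
      rel .logical (fImp (fAll (fImp (fEq (var 1) (tVar (const 0))) fBot)) fBot)⟩]

/-- First argument 0 means no hypotheses, 1 means those of the machine. Open valid formulas are
reached through a closure, as completeness covers sentences only. -/
def derivesRules : List Clause :=
  [⟨[rel .logical (var 0)], rel .derives (var 1) (var 0)⟩,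
   ⟨[rel .derives (var 0) (fImp (var 1) (var 2)), rel .derives (var 0) (var 1)], rel .derives (var 0) (var 2)⟩,
   ⟨[rel .machine (var 0)], rel .derives (const 1) (var 0)⟩,
   ⟨[rel .closes (var 0) (var 1), rel .derives (const 0) (var 0)], rel .valid (var 1)⟩]

def arithmeticRules : List Clause :=
  [⟨[], rel .global
      (const (Formula.all (.neg (.eq (.succ (.var 0)) .zero))).gn)⟩,
   ⟨[], rel .global (const (Formula.all (.all (.imp (.eq (.succ (.var 1)) (.succ (.var 0)))
      (.eq (.var 1) (.var 0))))).gn)⟩,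
   ⟨[], rel .global (const (Formula.all (.eq (.add (.var 0) .zero) (.var 0))).gn)⟩,
   ⟨[], rel .global (const (Formula.all (.all (.eq (.add (.var 1) (.succ (.var 0)))
      (.succ (.add (.var 1) (.var 0)))))).gn)⟩,
   ⟨[], rel .global (const (Formula.all (.eq (.mul (.var 0) .zero) .zero)).gn)⟩,
   ⟨[], rel .global (const (Formula.all (.all (.eq (.mul (.var 1) (.succ (.var 0)))
      (.add (.mul (.var 1) (.var 0)) (.var 1))))).gn)⟩,
   ⟨[rel .inst (var 0) tZero (var 1) (var 2), rel .inst (var 0) (tSucc (tVar (var 0))) (var 1) (var 3),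
      rel .allVar (var 0) (fImp (var 1) (var 3)) (var 4), rel .allVar (var 0) (var 1) (var 5),
      rel .closes (var 6) (fImp (var 2) (fImp (var 4) (var 5)))], rel .global (var 6)⟩]

/-- In the last clause, x is free in φ and ∀x φ is a sentence: together, x is the lone free
variable. This is the only clause in which the parameter n occurs. -/
def globalRules (θ : Formula) : List Clause :=
  [⟨[rel .form (var 0), rel .form (var 1),
      rel .closes (var 2) (fImp (fKnow (fImp (var 0) (var 1))) (fImp (fKnow (var 0)) (fKnow (var 1))))], rel .global (var 2)⟩,
   ⟨[rel .form (var 0), rel .closes (var 1) (fImp (fKnow (var 0)) (fKnow (fKnow (var 0))))], rel .global (var 1)⟩,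
   ⟨[rel .free (var 0) (var 1), rel .allVar (var 0) (var 1) (var 2), rel .sentence (var 2), rel .numeral (var 1) (var 3),
      rel .numeral param (var 4),
      rel .substForm (sCons (tVar (var 0)) (sCons (var 3) (sCons (var 4) sNil))) (const θ.gn) (var 5),
      rel .allVar (var 0) (fIff (fKnow (var 1)) (var 5)) (var 6)], rel .global (var 6)⟩]

def machineRules : List Clause :=
  [⟨[rel .global (var 0)], rel .known (var 0)⟩,
   ⟨[rel .valid (var 0), rel .closes (var 1) (fKnow (var 0))], rel .known (var 1)⟩,
   ⟨[rel .known (var 0)], rel .known (fKnow (var 0))⟩,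
   ⟨[rel .known (var 0)], rel .machine (var 0)⟩,
   ⟨[rel .valid (var 0), rel .numerals (var 1), rel .substForm (var 1) (var 0) (var 2)], rel .machine (var 2)⟩,
   ⟨[rel .machine (var 0)], rel .machine (fKnow (var 0))⟩,
   ⟨[rel .allVar (var 0) (var 1) (var 2), rel .sentence (var 2), rel .numeral (var 3) (var 4), rel .inst (var 0) (var 4) (var 1) (var 5),
      rel .derives (const 1) (var 5)], rel .goal (pair (var 3) (var 1))⟩]

end Rules

/-- The program for entailment from the machine's axioms. -/
def program (θ : Formula) : List Clause :=
  termRules ++ (formRules ++ (termsRules ++ (lookRules ++ (substTermRules ++ (identRules ++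
  (shiftRules ++ (shiftsRules ++ (substFormRules ++ (bindRules ++ (instRules ++ (openAtRules ++
  (freeRules ++ (closesRules ++ (numeralRules ++ (logicalRules ++ (derivesRules ++
  (arithmeticRules ++ (globalRules θ ++ machineRules))))))))))))))))))

/-! ### Soundness of the program -/

theorem Formula.inst_of_notMem {φ : Formula} {x : ℕ} (h : x ∉ φ.fv) (t : Term) :
    φ.inst x t = φ := by
  conv_rhs => rw [← φ.subst_var]
  refine subst_ext fun k hk => Function.update_of_ne ?_ _ _
  rintro rfl
  exact h hk

theorem Agree.cons_openAt {S : List Term} (h : Agree S fun k => .var (0 + k)) (k : ℕ) :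
    Agree (.var k :: S) (consAssignment (.var k) .var) :=
  Agree.cons (σ := consAssignment (.var k) .var) (h.congr fun j => by rw [Nat.zero_add]; rfl)

section Soundness

variable {θ : Formula} {n : ℕ}

/-- As in the groups that follow, a clause becomes an implication between interpretations. Premises
are decoded into syntax, and injectivity of Gödel numbering identifies objects that share a number.
-/
theorem termRules_sound : ClosedUnder (TrueFact θ n) n termRules := by
  refine ⟨?_, ?_, ?_, ?_, ?_, trivial⟩ <;>
    (intro e
     simp only [Clause.ClosedAt, List.foldr, Pat.eval_rel, trueFact_fact, Interp, Pat.eval, Pat.tVar, Pat.tSucc, Pat.tAdd, Pat.tMul, Pat.tZero]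
     generalize e.getD 0 0 = x₀, e.getD 1 0 = x₁, e.getD 2 0 = x₂, e.getD 3 0 = x₃,
       e.getD 4 0 = x₄, e.getD 5 0 = x₅, e.getD 6 0 = x₆)
  · exact ⟨.var x₀, rfl⟩
  · exact ⟨.zero, rfl⟩
  · rintro ⟨t, rfl⟩
    exact ⟨.succ t, rfl⟩
  · rintro ⟨t, rfl⟩ ⟨u, rfl⟩
    exact ⟨.add t u, rfl⟩
  · rintro ⟨t, rfl⟩ ⟨u, rfl⟩
    exact ⟨.mul t u, rfl⟩

theorem formRules_sound : ClosedUnder (TrueFact θ n) n formRules := by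
  refine ⟨?_, ?_, ?_, ?_, ?_, trivial⟩ <;>
    (intro e
     simp only [Clause.ClosedAt, List.foldr, Pat.eval_rel, trueFact_fact, Interp, Pat.eval, Pat.fEq, Pat.fBot, Pat.fImp, Pat.fAll, Pat.fKnow]
     generalize e.getD 0 0 = x₀, e.getD 1 0 = x₁, e.getD 2 0 = x₂, e.getD 3 0 = x₃,
       e.getD 4 0 = x₄, e.getD 5 0 = x₅, e.getD 6 0 = x₆)
  · rintro ⟨t, rfl⟩ ⟨u, rfl⟩
    exact ⟨.eq t u, rfl⟩
  · exact ⟨.bot, rfl⟩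
  · rintro ⟨φ, rfl⟩ ⟨ψ, rfl⟩
    exact ⟨.imp φ ψ, rfl⟩
  · rintro ⟨φ, rfl⟩
    exact ⟨.all φ, rfl⟩
  · rintro ⟨φ, rfl⟩
    exact ⟨.know φ, rfl⟩

theorem termsRules_sound : ClosedUnder (TrueFact θ n) n termsRules := by
  refine ⟨?_, ?_, trivial⟩ <;>
    (intro e
     simp only [Clause.ClosedAt, List.foldr, Pat.eval_rel, trueFact_fact, Interp, Pat.eval, Pat.sNil, Pat.sCons]
     generalize e.getD 0 0 = x₀, e.getD 1 0 = x₁, e.getD 2 0 = x₂, e.getD 3 0 = x₃,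
       e.getD 4 0 = x₄, e.getD 5 0 = x₅, e.getD 6 0 = x₆)
  · exact ⟨[], rfl⟩
  · rintro ⟨t, rfl⟩ ⟨S, rfl⟩
    exact ⟨t :: S, rfl⟩

theorem lookRules_sound : ClosedUnder (TrueFact θ n) n lookRules := by
  refine ⟨?_, ?_, trivial⟩ <;>
    (intro e
     simp only [Clause.ClosedAt, List.foldr, Pat.eval_rel, trueFact_fact, Interp, Pat.eval, Pat.sCons]
     generalize e.getD 0 0 = x₀, e.getD 1 0 = x₁, e.getD 2 0 = x₂, e.getD 3 0 = x₃,
       e.getD 4 0 = x₄, e.getD 5 0 = x₅, e.getD 6 0 = x₆)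
  · rintro ⟨t, rfl⟩ ⟨S, rfl⟩
    exact ⟨t :: S, Nat.succ_pos _, rfl, rfl⟩
  · rintro ⟨t, rfl⟩ ⟨S, hk, rfl, rfl⟩
    exact ⟨t :: S, Nat.succ_lt_succ hk, rfl, rfl⟩

theorem substTermRules_sound : ClosedUnder (TrueFact θ n) n substTermRules := by
  refine ⟨?_, ?_, ?_, ?_, ?_, trivial⟩ <;>
    (intro e
     simp only [Clause.ClosedAt, List.foldr, Pat.eval_rel, trueFact_fact, Interp, Pat.eval, Pat.tVar, Pat.tSucc, Pat.tAdd, Pat.tMul, Pat.tZero]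
     generalize e.getD 0 0 = x₀, e.getD 1 0 = x₁, e.getD 2 0 = x₂, e.getD 3 0 = x₃,
       e.getD 4 0 = x₄, e.getD 5 0 = x₅, e.getD 6 0 = x₆)
  · rintro ⟨S, hk, rfl, rfl⟩
    exact ⟨S, .var x₁, by rintro _ rfl; exact hk, rfl, rfl, rfl⟩
  · rintro ⟨S, rfl⟩
    exact ⟨S, .zero, fun _ h => h.elim, rfl, rfl, rfl⟩
  · rintro ⟨S, t, hb, rfl, rfl, rfl⟩
    exact ⟨S, .succ t, hb, rfl, rfl, rfl⟩
  · rintro ⟨S, t, hb, rfl, rfl, rfl⟩ ⟨S', u, hb', hS, rfl, rfl⟩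
    obtain rfl := gnTerms_injective hS
    exact ⟨S', .add t u, fun k hk => hk.elim (hb k) (hb' k), rfl, rfl, rfl⟩
  · rintro ⟨S, t, hb, rfl, rfl, rfl⟩ ⟨S', u, hb', hS, rfl, rfl⟩
    obtain rfl := gnTerms_injective hS
    exact ⟨S', .mul t u, fun k hk => hk.elim (hb k) (hb' k), rfl, rfl, rfl⟩

theorem identRules_sound : ClosedUnder (TrueFact θ n) n identRules := by
  refine ⟨?_, ?_, trivial⟩ <;>
    (intro e
     simp only [Clause.ClosedAt, List.foldr, Pat.eval_rel, trueFact_fact, Interp, Pat.eval, Pat.tVar, Pat.sNil, Pat.sCons]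
     generalize e.getD 0 0 = x₀, e.getD 1 0 = x₁, e.getD 2 0 = x₂, e.getD 3 0 = x₃,
       e.getD 4 0 = x₄, e.getD 5 0 = x₅, e.getD 6 0 = x₆)
  · exact ⟨[], .nil _, rfl⟩
  · rintro ⟨S, hS, rfl⟩
    exact ⟨.var x₀ :: S, Agree.cons (σ := fun k => .var (x₀ + k))
      (hS.congr fun k => congrArg Term.var (by omega)), rfl⟩

theorem shiftRules_sound : ClosedUnder (TrueFact θ n) n shiftRules := by
  refine ⟨?_, trivial⟩ <;>
    (intro e
     simp only [Clause.ClosedAt, List.foldr, Pat.eval_rel, trueFact_fact, Interp, Pat.eval, Pat.tVar]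
     generalize e.getD 0 0 = x₀, e.getD 1 0 = x₁, e.getD 2 0 = x₂, e.getD 3 0 = x₃,
       e.getD 4 0 = x₄, e.getD 5 0 = x₅, e.getD 6 0 = x₆)
  rintro ⟨S, hS, rfl⟩ ⟨S', t, hb, h, rfl, rfl⟩
  obtain rfl := gnTerms_injective h
  refine ⟨t, rfl, congrArg Term.gn (Term.subst_ext fun k hk => ?_)⟩
  rw [hS k (hb k hk), Nat.add_comm]

theorem shiftsRules_sound : ClosedUnder (TrueFact θ n) n shiftsRules := by
  refine ⟨?_, ?_, trivial⟩ <;>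
    (intro e
     simp only [Clause.ClosedAt, List.foldr, Pat.eval_rel, trueFact_fact, Interp, Pat.eval, Pat.sNil, Pat.sCons]
     generalize e.getD 0 0 = x₀, e.getD 1 0 = x₁, e.getD 2 0 = x₂, e.getD 3 0 = x₃,
       e.getD 4 0 = x₄, e.getD 5 0 = x₅, e.getD 6 0 = x₆)
  · exact ⟨[], rfl, rfl⟩
  · rintro ⟨t, rfl, rfl⟩ ⟨S, rfl, rfl⟩
    exact ⟨t :: S, rfl, rfl⟩

theorem substFormRules_sound : ClosedUnder (TrueFact θ n) n substFormRules := by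
  refine ⟨?_, ?_, ?_, ?_, ?_, trivial⟩ <;>
    (intro e
     simp only [Clause.ClosedAt, List.foldr, Pat.eval_rel, trueFact_fact, Interp, Pat.eval, Pat.tVar, Pat.sCons, Pat.fEq, Pat.fBot, Pat.fImp, Pat.fAll, Pat.fKnow]
     generalize e.getD 0 0 = x₀, e.getD 1 0 = x₁, e.getD 2 0 = x₂, e.getD 3 0 = x₃,
       e.getD 4 0 = x₄, e.getD 5 0 = x₅, e.getD 6 0 = x₆)
  · rintro ⟨S, t, hb, rfl, rfl, rfl⟩ ⟨S', u, hb', hS, rfl, rfl⟩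
    obtain rfl := gnTerms_injective hS
    exact ⟨S', .eq t u, fun k hk => hk.elim (hb k) (hb' k), rfl, rfl, rfl⟩
  · rintro ⟨S, rfl⟩
    exact ⟨S, .bot, fun _ h => h.elim, rfl, rfl, rfl⟩
  · rintro ⟨S, φ, hb, rfl, rfl, rfl⟩ ⟨S', ψ, hb', hS, rfl, rfl⟩
    obtain rfl := gnTerms_injective hS
    exact ⟨S', .imp φ ψ, fun k hk => hk.elim (hb k) (hb' k), rfl, rfl, rfl⟩
  · rintro ⟨S, rfl, rfl⟩ ⟨S', φ, hb, h, rfl, rfl⟩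
    obtain rfl : S' = .var 0 :: S.map Term.shift := gnTerms_injective h
    refine ⟨S, .all φ, fun k hk => by simpa using hb (k + 1) hk, rfl, rfl, ?_⟩
    rw [Formula.subst, ← toSubst_lift]
    rfl
  · rintro ⟨S, φ, hb, rfl, rfl, rfl⟩
    exact ⟨S, .know φ, hb, rfl, rfl, rfl⟩

theorem bindRules_sound : ClosedUnder (TrueFact θ n) n bindRules := by
  refine ⟨?_, ?_, ?_, trivial⟩ <;>
    (intro e
     simp only [Clause.ClosedAt, List.foldr, Pat.eval_rel, trueFact_fact, Interp, Pat.eval, Pat.tVar, Pat.sCons, Pat.fAll]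
     generalize e.getD 0 0 = x₀, e.getD 1 0 = x₁, e.getD 2 0 = x₂, e.getD 3 0 = x₃,
       e.getD 4 0 = x₄, e.getD 5 0 = x₅, e.getD 6 0 = x₆)
  · rintro ⟨S, hS, rfl⟩
    exact ⟨.var 0 :: S, Agree.cons (σ := fun k => .var (if k = 0 then 0 else x₀ + k + 1))
      (hS.congr fun k => congrArg Term.var (by rw [if_neg k.succ_ne_zero]; omega)), rfl⟩
  · rintro ⟨S, hS, rfl⟩
    exact ⟨.var (x₁ + 1) :: S,
      Agree.cons (σ := fun k => .var (if k = x₀ + 1 then 0 else x₁ + k + 1))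
        (hS.congr fun k => congrArg Term.var (by split_ifs <;> omega)), rfl⟩
  · rintro ⟨S, hS, rfl⟩ ⟨S', φ, hb, h, rfl, rfl⟩
    obtain rfl := gnTerms_injective h
    refine ⟨φ, rfl, ?_⟩
    rw [hS.subst hb]
    simp only [Nat.zero_add]
    rfl

theorem instRules_sound : ClosedUnder (TrueFact θ n) n instRules := by
  refine ⟨?_, ?_, ?_, trivial⟩ <;>
    (intro e
     simp only [Clause.ClosedAt, List.foldr, Pat.eval_rel, trueFact_fact, Interp, Pat.eval, Pat.tVar, Pat.sCons]
     generalize e.getD 0 0 = x₀, e.getD 1 0 = x₁, e.getD 2 0 = x₂, e.getD 3 0 = x₃,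
       e.getD 4 0 = x₄, e.getD 5 0 = x₅, e.getD 6 0 = x₆)
  · rintro ⟨t, rfl⟩ ⟨S, hS, rfl⟩
    refine ⟨t, t :: S, Agree.cons (σ := fun k => if k = 0 then t else .var (x₁ + k))
      (hS.congr fun k => ?_), rfl, rfl⟩
    rw [if_neg k.succ_ne_zero, Nat.add_right_comm, Nat.add_assoc]
  · rintro ⟨t, S, hS, rfl, rfl⟩
    refine ⟨t, .var x₁ :: S, Agree.cons (σ := fun k => if k = x₀ + 1 then t else .var (x₁ + k))
      (hS.congr fun k => ?_), rfl, rfl⟩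
    simp only [Nat.add_right_cancel_iff, Nat.add_right_comm, Nat.add_assoc]
  · rintro ⟨t, S, hS, rfl, rfl⟩ ⟨S', φ, hb, h, rfl, rfl⟩
    obtain rfl := gnTerms_injective h
    refine ⟨t, φ, rfl, rfl, ?_⟩
    rw [hS.subst hb, Formula.inst]
    congr 2
    funext k
    simp [Function.update_apply]

theorem openAtRules_sound : ClosedUnder (TrueFact θ n) n openAtRules := by
  refine ⟨?_, trivial⟩ <;>
    (intro e
     simp only [Clause.ClosedAt, List.foldr, Pat.eval_rel, trueFact_fact, Interp, Pat.eval, Pat.tVar, Pat.sCons]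
     generalize e.getD 0 0 = x₀, e.getD 1 0 = x₁, e.getD 2 0 = x₂, e.getD 3 0 = x₃,
       e.getD 4 0 = x₄, e.getD 5 0 = x₅, e.getD 6 0 = x₆)
  rintro ⟨S, hS, rfl⟩ ⟨S', φ, hb, h, rfl, rfl⟩
  obtain rfl : S' = .var x₁ :: S := gnTerms_injective h
  exact ⟨φ, rfl, by rw [(hS.cons_openAt x₁).subst hb, Formula.openAt]⟩

theorem freeRules_sound : ClosedUnder (TrueFact θ n) n freeRules := by
  refine ⟨?_, ?_, ?_, ?_, ?_, trivial⟩ <;>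
    (intro e
     simp only [Clause.ClosedAt, List.foldr, Pat.eval_rel, trueFact_fact, Interp, Pat.eval, Pat.tZero, Pat.sNil]
     generalize e.getD 0 0 = x₀, e.getD 1 0 = x₁, e.getD 2 0 = x₂, e.getD 3 0 = x₃,
       e.getD 4 0 = x₄, e.getD 5 0 = x₅, e.getD 6 0 = x₆)
  · exact Nat.lt_succ_self _
  · exact Nat.lt_succ_of_lt
  · rintro ⟨t, φ, _, rfl, rfl⟩ hlt
    refine ⟨φ, by_contra fun h => ?_, rfl⟩
    rw [Formula.inst_of_notMem h] at hlt
    exact hlt.ne rfl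
  · rintro ⟨t, φ, _, rfl, rfl⟩ hlt
    refine ⟨φ, by_contra fun h => ?_, rfl⟩
    rw [Formula.inst_of_notMem h] at hlt
    exact hlt.ne rfl
  · rintro ⟨S, φ, hb, h, rfl, _⟩
    obtain rfl : S = [] := gnTerms_injective h
    exact ⟨φ, Set.eq_empty_of_forall_notMem fun k hk => Nat.not_lt_zero _ (hb k hk), rfl⟩

theorem closesRules_sound : ClosedUnder (TrueFact θ n) n closesRules := by
  refine ⟨?_, ?_, trivial⟩ <;>
    (intro e
     simp only [Clause.ClosedAt, List.foldr, Pat.eval_rel, trueFact_fact, Interp, Pat.eval]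
     generalize e.getD 0 0 = x₀, e.getD 1 0 = x₁, e.getD 2 0 = x₂, e.getD 3 0 = x₃,
       e.getD 4 0 = x₄, e.getD 5 0 = x₅, e.getD 6 0 = x₆)
  · rintro ⟨φ, hφ, rfl⟩
    exact ⟨φ, φ, .refl φ hφ, rfl, rfl⟩
  · rintro ⟨φ, hx, rfl⟩ ⟨φ', h, rfl⟩ ⟨ψ, χ, hc, rfl, h'⟩
    obtain rfl := Formula.gn_injective h
    obtain rfl := Formula.gn_injective h'
    exact ⟨ψ, φ', .step _ _ x₀ hx hc, rfl, rfl⟩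

theorem numeralRules_sound : ClosedUnder (TrueFact θ n) n numeralRules := by
  refine ⟨?_, ?_, ?_, ?_, trivial⟩ <;>
    (intro e
     simp only [Clause.ClosedAt, List.foldr, Pat.eval_rel, trueFact_fact, Interp, Pat.eval, Pat.tZero, Pat.tSucc, Pat.sNil, Pat.sCons]
     generalize e.getD 0 0 = x₀, e.getD 1 0 = x₁, e.getD 2 0 = x₂, e.getD 3 0 = x₃,
       e.getD 4 0 = x₄, e.getD 5 0 = x₅, e.getD 6 0 = x₆)
  · rfl
  · rintro rfl
    rfl
  · exact ⟨[], ⟨fun _ => 0, .nil _⟩, rfl⟩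
  · rintro rfl ⟨S, ⟨s, hs⟩, rfl⟩
    exact ⟨numeral x₀ :: S, ⟨consAssignment x₀ s,
      Agree.cons (σ := fun k => numeral (consAssignment x₀ s k)) hs⟩, rfl⟩

theorem logicalRules_sound : ClosedUnder (TrueFact θ n) n logicalRules := by
  refine ⟨?_, ?_, ?_, ?_, ?_, ?_, ?_, ?_, ?_, ?_, ?_, ?_, ?_, trivial⟩ <;>
    (intro e
     simp only [Clause.ClosedAt, List.foldr, Pat.eval_rel, trueFact_fact, Interp, Pat.eval, Pat.tVar, Pat.tSucc, Pat.tAdd, Pat.tMul, Pat.fEq, Pat.fBot, Pat.fImp, Pat.fAll]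
     generalize e.getD 0 0 = x₀, e.getD 1 0 = x₁, e.getD 2 0 = x₂, e.getD 3 0 = x₃,
       e.getD 4 0 = x₄, e.getD 5 0 = x₅, e.getD 6 0 = x₆)
  · rintro ⟨φ, rfl⟩ ⟨ψ, rfl⟩
    exact ⟨_, .weaken φ ψ, rfl⟩
  · rintro ⟨φ, rfl⟩ ⟨ψ, rfl⟩ ⟨χ, rfl⟩
    exact ⟨_, .distribute φ ψ χ, rfl⟩
  · rintro ⟨φ, rfl⟩
    exact ⟨_, .dne φ, rfl⟩
  · rintro ⟨φ, rfl, rfl⟩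
    exact ⟨_, .instantiate φ x₀, rfl⟩
  · rintro ⟨φ, rfl, rfl⟩
    exact ⟨_, .witness φ, rfl⟩
  · rintro ⟨φ, rfl, rfl⟩ ⟨φ', h, rfl⟩
    obtain rfl := Formula.gn_injective h
    exact ⟨_, .replace φ' x₀ x₃, rfl⟩
  · rintro ⟨t, rfl⟩
    exact ⟨_, .eq_refl t, rfl⟩
  · rintro ⟨t, rfl⟩ ⟨u, rfl⟩
    exact ⟨_, .eq_symm t u, rfl⟩
  · rintro ⟨t, rfl⟩ ⟨u, rfl⟩ ⟨v, rfl⟩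
    exact ⟨_, .eq_trans t u v, rfl⟩
  · rintro ⟨t, rfl⟩ ⟨u, rfl⟩
    exact ⟨_, .eq_succ t u, rfl⟩
  · rintro ⟨t, rfl⟩ ⟨u, rfl⟩ ⟨v, rfl⟩ ⟨w, rfl⟩
    exact ⟨_, .eq_add t u v w, rfl⟩
  · rintro ⟨t, rfl⟩ ⟨u, rfl⟩ ⟨v, rfl⟩ ⟨w, rfl⟩
    exact ⟨_, .eq_mul t u v w, rfl⟩
  · rintro ⟨t, rfl, rfl⟩
    exact ⟨_, .value t, rfl⟩

/-- The clause for modus ponens sees only a number of the shape of an implication; the decoded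
formula must be shown to be one. -/
theorem Formula.exists_imp_of_gn_eq {χ : Formula} {a b : ℕ}
    (h : χ.gn = Nat.pair 2 (Nat.pair a b)) : ∃ φ ψ, χ = imp φ ψ ∧ φ.gn = a ∧ ψ.gn = b := by
  cases χ with
  | imp φ ψ =>
    simp only [gn, Nat.pair_eq_pair, true_and] at h
    exact ⟨φ, ψ, rfl, h⟩
  | _ => simp [gn] at h

theorem derivesRules_sound : ClosedUnder (TrueFact θ n) n derivesRules := by
  refine ⟨?_, ?_, ?_, ?_, trivial⟩ <;>
    (intro e
     simp only [Clause.ClosedAt, List.foldr, Pat.eval_rel, trueFact_fact, Interp, Pat.eval, Pat.fImp]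
     generalize e.getD 0 0 = x₀, e.getD 1 0 = x₁, e.getD 2 0 = x₂, e.getD 3 0 = x₃,
       e.getD 4 0 = x₄, e.getD 5 0 = x₅, e.getD 6 0 = x₆)
  · rintro ⟨φ, h, rfl⟩
    exact ⟨φ, .ax _ h, rfl⟩
  · rintro ⟨χ, hχ, h⟩ ⟨φ, hφ, rfl⟩
    obtain ⟨φ', ψ, rfl, h', rfl⟩ := Formula.exists_imp_of_gn_eq h
    obtain rfl := Formula.gn_injective h'
    exact ⟨ψ, .mp _ _ hχ hφ, rfl⟩
  · rintro ⟨φ, h, rfl⟩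
    exact ⟨φ, .hyp _ h, rfl⟩
  · rintro ⟨ψ, φ, hc, rfl, rfl⟩ ⟨ψ', hd, h⟩
    obtain rfl := Formula.gn_injective h
    refine ⟨φ, (valid_iff_of_isClosure (Formula.isClosure_iff.2 hc)).2 ?_, rfl⟩
    exact entails_empty_iff.1 ((entails_iff_derives (by simp) hc.fv_eq_empty).2 hd)

theorem arithmeticRules_sound : ClosedUnder (TrueFact θ n) n arithmeticRules := by
  refine ⟨?_, ?_, ?_, ?_, ?_, ?_, ?_, trivial⟩ <;>
    (intro e
     simp only [Clause.ClosedAt, List.foldr, Pat.eval_rel, trueFact_fact, Interp, Pat.eval, Pat.tVar, Pat.tZero, Pat.tSucc, Pat.fImp]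
     generalize e.getD 0 0 = x₀, e.getD 1 0 = x₁, e.getD 2 0 = x₂, e.getD 3 0 = x₃,
       e.getD 4 0 = x₄, e.getD 5 0 = x₅, e.getD 6 0 = x₆)
  · exact ⟨_, .arithmetic _ .succ_ne_zero, rfl⟩
  · exact ⟨_, .arithmetic _ .succ_inj, rfl⟩
  · exact ⟨_, .arithmetic _ .add_zero, rfl⟩
  · exact ⟨_, .arithmetic _ .add_succ, rfl⟩
  · exact ⟨_, .arithmetic _ .mul_zero, rfl⟩
  · exact ⟨_, .arithmetic _ .mul_succ, rfl⟩
  · rintro ⟨t, φ, ht, rfl, rfl⟩ ⟨t', φ', ht', h', rfl⟩ ⟨χ, hχ, rfl⟩ ⟨φ'', h'', rfl⟩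
      ⟨ψ, χ', hc, rfl, hχ'⟩
    obtain rfl := Term.gn_injective ht
    obtain rfl : t' = .succ (.var x₀) := Term.gn_injective ht'
    obtain rfl := Formula.gn_injective h'
    obtain rfl := Formula.gn_injective h''
    obtain rfl : χ = .imp φ'' (φ''.inst x₀ (.succ (.var x₀))) := Formula.gn_injective hχ
    obtain rfl : χ' = .imp _ (.imp _ _) := Formula.gn_injective hχ'
    exact ⟨ψ, .arithmetic _ (.induction φ'' x₀ _ (Formula.isClosure_iff.2 hc)), rfl⟩

theorem substTerms_eq_codeAxiom_subst (hθ : θ.fv ⊆ {0, 1, 2}) (φ : Formula) (x : ℕ) :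
    θ.subst (toSubst [.var x, numeral φ.gn, numeral n]) = θ.subst fun
      | 0 => .var x
      | 1 => numeral φ.gn
      | 2 => numeral n
      | k + 3 => .var (k + 3) := by
  refine Formula.subst_ext fun k hk => ?_
  rcases hθ hk with rfl | rfl | rfl <;> rfl

theorem globalRules_sound (hθ : θ.fv ⊆ {0, 1, 2}) : ClosedUnder (TrueFact θ n) n (globalRules θ) := by
  refine ⟨?_, ?_, ?_, trivial⟩ <;>
    (intro e
     simp only [Clause.ClosedAt, List.foldr, Pat.eval_rel, trueFact_fact, Interp, Pat.eval, Pat.tVar, Pat.sNil, Pat.sCons, Pat.fIff, Pat.fNeg, Pat.fBot, Pat.fImp, Pat.fKnow]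
     generalize e.getD 0 0 = x₀, e.getD 1 0 = x₁, e.getD 2 0 = x₂, e.getD 3 0 = x₃,
       e.getD 4 0 = x₄, e.getD 5 0 = x₅, e.getD 6 0 = x₆)
  · rintro ⟨φ, rfl⟩ ⟨ψ, rfl⟩ ⟨χ, χ', hc, rfl, h⟩
    obtain rfl : χ' = .imp (.know (.imp φ ψ)) (.imp (.know φ) (.know ψ)) :=
      Formula.gn_injective h
    exact ⟨χ, .distrib φ ψ χ (Formula.isClosure_iff.2 hc), rfl⟩
  · rintro ⟨φ, rfl⟩ ⟨χ, χ', hc, rfl, h⟩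
    obtain rfl : χ' = .imp (.know φ) (.know (.know φ)) := Formula.gn_injective h
    exact ⟨χ, .know_know φ χ (Formula.isClosure_iff.2 hc), rfl⟩
  · rintro ⟨φ, hx, rfl⟩ ⟨φ', h, rfl⟩ ⟨ψ, hψ, h'⟩ rfl rfl ⟨S, θ', _, hS, h'', rfl⟩ ⟨χ, hχ, rfl⟩
    obtain rfl := Formula.gn_injective h
    obtain rfl := Formula.gn_injective h'
    obtain rfl := Formula.gn_injective h''
    obtain rfl : S = [.var x₀, numeral φ'.gn, numeral n] := gnTerms_injective hS
    rw [substTerms_eq_codeAxiom_subst hθ] at hχ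
    obtain rfl : χ = .iff (.know φ') _ := Formula.gn_injective hχ
    refine ⟨_, .code φ' x₀ ?_, rfl⟩
    rw [Formula.fv_allVar, Set.sdiff_eq_empty] at hψ
    exact hψ.antisymm (Set.singleton_subset_iff.2 hx)

theorem machineRules_sound (hθ : θ.fv ⊆ {0, 1, 2}) : ClosedUnder (TrueFact θ n) n machineRules := by
  refine ⟨?_, ?_, ?_, ?_, ?_, ?_, ?_, trivial⟩ <;>
    (intro e
     simp only [Clause.ClosedAt, List.foldr, Pat.eval_rel, trueFact_fact, Interp, Pat.eval, Pat.fKnow]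
     generalize e.getD 0 0 = x₀, e.getD 1 0 = x₁, e.getD 2 0 = x₂, e.getD 3 0 = x₃,
       e.getD 4 0 = x₄, e.getD 5 0 = x₅, e.getD 6 0 = x₆)
  · rintro ⟨φ, h, rfl⟩
    exact ⟨φ, .ax _ h, rfl⟩
  · rintro ⟨φ, hv, rfl⟩ ⟨χ, φ', hc, rfl, h⟩
    obtain rfl : φ' = .know φ := Formula.gn_injective h
    exact ⟨χ, .valid φ χ hv (Formula.isClosure_iff.2 hc), rfl⟩
  · rintro ⟨φ, h, rfl⟩
    exact ⟨_, .nec φ h, rfl⟩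
  · rintro ⟨φ, h, rfl⟩
    exact ⟨φ, .base _ h, rfl⟩
  · rintro ⟨φ, hv, rfl⟩ ⟨S, ⟨s, hs⟩, rfl⟩ ⟨S', φ', hb, h, h', rfl⟩
    obtain rfl := gnTerms_injective h
    obtain rfl := Formula.gn_injective h'
    exact ⟨_, .assignedValid φ' s hv, congrArg Formula.gn (hs.subst hb).symm⟩
  · rintro ⟨φ, h, rfl⟩
    exact ⟨_, .nec φ h, rfl⟩
  · rintro ⟨φ, rfl, rfl⟩ ⟨ψ, hψ, h⟩ rfl ⟨t, φ', ht, h', rfl⟩ ⟨χ, hd, h''⟩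
    obtain rfl := Formula.gn_injective h
    obtain rfl := Term.gn_injective ht
    obtain rfl := Formula.gn_injective h'
    obtain rfl := Formula.gn_injective h''
    rw [Formula.fv_allVar, Set.sdiff_eq_empty] at hψ
    refine ⟨x₃, φ', x₀, rfl, hψ, ?_⟩
    exact (entails_iff_derives (fun ψ h => fv_machineAxiom hθ h)
      (Formula.fv_inst_numeral hψ x₃)).2 hd

theorem program_sound (hθ : θ.fv ⊆ {0, 1, 2}) :
    ClosedUnder (TrueFact θ n) n (program θ) := by
  simp only [program, closedUnder_append]
  exact ⟨termRules_sound, formRules_sound, termsRules_sound, lookRules_sound,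
    substTermRules_sound, identRules_sound, shiftRules_sound, shiftsRules_sound,
    substFormRules_sound, bindRules_sound, instRules_sound, openAtRules_sound, freeRules_sound,
    closesRules_sound, numeralRules_sound, logicalRules_sound, derivesRules_sound,
    arithmeticRules_sound, globalRules_sound hθ, machineRules_sound hθ⟩

theorem interp_of_deduces (hθ : θ.fv ⊆ {0, 1, 2}) {r : FactKind} {a b c d : ℕ}
    (h : Deduces (program θ) n (fact r a b c d)) : Interp θ n r a b c d :=
  trueFact_fact.1 (h.of_closedUnder (program_sound hθ))

end Soundness

/-! ### Completeness of the program -/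

/-- The program deduces that the relation holds. -/
def Computes (θ : Formula) (n : ℕ) (r : FactKind) (a : ℕ) (b c d : ℕ := 0) : Prop :=
  Deduces (program θ) n (fact r a b c d)

section Completeness

variable {θ : Formula} {n : ℕ}

/-- Closure unfolds to a conjunction of curried implications, so each clause can be used as a
function of a list of values for its variables and of its premises. -/
theorem rules_closed {C : List Clause} (h : ∀ c ∈ C, c ∈ program θ) :
    ClosedUnder (Deduces (program θ) n) n C :=
  closedUnder_iff.2 fun c hc => closedUnder_iff.1 closedUnder_deduces c (h c hc)

theorem computes_term (t : Term) : Computes θ n .term t.gn := by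
  obtain ⟨hvar, hzero, hsucc, hadd, hmul, -⟩ := rules_closed (θ := θ) (n := n) (C := termRules)
    fun c hc => by simp [program, hc]
  induction t with
  | var k => exact hvar [k]
  | zero => exact hzero []
  | succ t ih => exact hsucc [t.gn] ih
  | add t u iht ihu => exact hadd [t.gn, u.gn] iht ihu
  | mul t u iht ihu => exact hmul [t.gn, u.gn] iht ihu

theorem computes_form (φ : Formula) : Computes θ n .form φ.gn := by
  obtain ⟨heq, hbot, himp, hall, hknow, -⟩ := rules_closed (θ := θ) (n := n) (C := formRules)
    fun c hc => by simp [program, hc]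
  induction φ with
  | eq t u => exact heq [t.gn, u.gn] (computes_term t) (computes_term u)
  | bot => exact hbot []
  | imp φ ψ ihφ ihψ => exact himp [φ.gn, ψ.gn] ihφ ihψ
  | all φ ih => exact hall [φ.gn] ih
  | know φ ih => exact hknow [φ.gn] ih

theorem computes_terms (S : List Term) : Computes θ n .terms (gnTerms S) := by
  obtain ⟨hnil, hcons, -⟩ := rules_closed (θ := θ) (n := n) (C := termsRules)
    fun c hc => by simp [program, hc]
  induction S with
  | nil => exact hnil []
  | cons t S ih => exact hcons [t.gn, gnTerms S] (computes_term t) ih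

theorem computes_look {S : List Term} {k : ℕ} (hk : k < S.length) :
    Computes θ n .look (gnTerms S) k (toSubst S k).gn := by
  obtain ⟨hzero, hsucc, -⟩ := rules_closed (θ := θ) (n := n) (C := lookRules)
    fun c hc => by simp [program, hc]
  induction S generalizing k with
  | nil => exact (Nat.not_lt_zero _ hk).elim
  | cons t S ih =>
    cases k with
    | zero => exact hzero [t.gn, gnTerms S] (computes_term t) (computes_terms S)
    | succ k =>
      exact hsucc [t.gn, gnTerms S, k, (toSubst S k).gn] (computes_term t)
        (ih (Nat.lt_of_succ_lt_succ hk))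

theorem computes_substTerm {S : List Term} {t : Term} (h : ∀ k ∈ t.fv, k < S.length) :
    Computes θ n .substTerm (gnTerms S) t.gn (t.subst (toSubst S)).gn := by
  obtain ⟨hvar, hzero, hsucc, hadd, hmul, -⟩ := rules_closed (θ := θ) (n := n)
    (C := substTermRules) fun c hc => by simp [program, hc]
  induction t with
  | var k => exact hvar [gnTerms S, k, (toSubst S k).gn] (computes_look (h k rfl))
  | zero => exact hzero [gnTerms S] (computes_terms S)
  | succ t ih => exact hsucc [gnTerms S, t.gn, (t.subst (toSubst S)).gn] (ih h)
  | add t u iht ihu =>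
    exact hadd [gnTerms S, t.gn, (t.subst (toSubst S)).gn, u.gn, (u.subst (toSubst S)).gn]
      (iht fun k hk => h k (Or.inl hk)) (ihu fun k hk => h k (Or.inr hk))
  | mul t u iht ihu =>
    exact hmul [gnTerms S, t.gn, (t.subst (toSubst S)).gn, u.gn, (u.subst (toSubst S)).gn]
      (iht fun k hk => h k (Or.inl hk)) (ihu fun k hk => h k (Or.inr hk))

theorem exists_computes_ident (L i : ℕ) :
    ∃ S, L ≤ S.length ∧ Computes θ n .ident i (gnTerms S) := by
  obtain ⟨hnil, hcons, -⟩ := rules_closed (θ := θ) (n := n) (C := identRules)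
    fun c hc => by simp [program, hc]
  induction L generalizing i with
  | zero => exact ⟨[], le_rfl, hnil [i]⟩
  | succ L ih =>
    obtain ⟨S, hL, hS⟩ := ih (i + 1)
    exact ⟨.var i :: S, Nat.succ_le_succ hL, hcons [i, gnTerms S] hS⟩

theorem exists_computes_close (d i L : ℕ) :
    ∃ S, L ≤ S.length ∧ Computes θ n .close d i (gnTerms S) := by
  obtain ⟨hzero, hsucc, -⟩ := rules_closed (θ := θ) (n := n) (C := bindRules)
    fun c hc => by simp [program, hc]
  induction d generalizing i with
  | zero =>
    obtain ⟨S, hL, hS⟩ := exists_computes_ident (θ := θ) (n := n) L (i + 2)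
    exact ⟨.var 0 :: S, Nat.le_succ_of_le hL, hzero [i, gnTerms S] hS⟩
  | succ d ih =>
    obtain ⟨S, hL, hS⟩ := ih (i + 1)
    exact ⟨.var (i + 1) :: S, Nat.le_succ_of_le hL, hsucc [d, i, gnTerms S] hS⟩

theorem exists_computes_single (t : Term) (d i L : ℕ) :
    ∃ S, L ≤ S.length ∧ Computes θ n .single d i t.gn (gnTerms S) := by
  obtain ⟨hzero, hsucc, -⟩ := rules_closed (θ := θ) (n := n) (C := instRules)
    fun c hc => by simp [program, hc]
  induction d generalizing i with
  | zero =>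
    obtain ⟨S, hL, hS⟩ := exists_computes_ident (θ := θ) (n := n) L (i + 1)
    exact ⟨t :: S, Nat.le_succ_of_le hL, hzero [t.gn, i, gnTerms S] (computes_term t) hS⟩
  | succ d ih =>
    obtain ⟨S, hL, hS⟩ := ih (i + 1)
    exact ⟨.var i :: S, Nat.le_succ_of_le hL, hsucc [d, i, t.gn, gnTerms S] hS⟩

variable (hθ : θ.fv ⊆ {0, 1, 2})
include hθ

theorem interp_of_computes {r : FactKind} {a b c d : ℕ} (h : Computes θ n r a b c d) :
    Interp θ n r a b c d :=
  interp_of_deduces hθ h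

/-- Some output is deduced by means of a long enough list, and soundness then identifies it. The
same device serves for `allVar`, `inst` and `openAt`. -/
theorem computes_shift (t : Term) : Computes θ n .shift t.gn t.shift.gn := by
  obtain ⟨hshift, -⟩ := rules_closed (θ := θ) (n := n) (C := shiftRules)
    fun c hc => by simp [program, hc]
  obtain ⟨S, hL, hS⟩ := exists_computes_ident (θ := θ) (n := n) (t.gn + 1) 1
  have hb : ∀ k ∈ t.fv, k < S.length := fun k hk =>
    (Nat.lt_succ_of_le (Term.le_gn_of_mem_fv hk)).trans_le hL
  have h : Computes θ n .shift t.gn (t.subst (toSubst S)).gn :=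
    hshift [gnTerms S, t.gn, (t.subst (toSubst S)).gn] hS (computes_substTerm hb)
  obtain ⟨t', ht', h'⟩ := interp_of_computes hθ h
  obtain rfl := Term.gn_injective ht'
  rwa [← h'] at h

theorem computes_shifts (S : List Term) :
    Computes θ n .shifts (gnTerms S) (gnTerms (S.map Term.shift)) := by
  obtain ⟨hnil, hcons, -⟩ := rules_closed (θ := θ) (n := n) (C := shiftsRules)
    fun c hc => by simp [program, hc]
  induction S with
  | nil => exact hnil []
  | cons t S ih =>
    exact hcons [t.gn, t.shift.gn, gnTerms S, gnTerms (S.map Term.shift)]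
      (computes_shift hθ t) ih

theorem computes_substForm {S : List Term} {φ : Formula} (h : ∀ k ∈ φ.fv, k < S.length) :
    Computes θ n .substForm (gnTerms S) φ.gn (φ.subst (toSubst S)).gn := by
  obtain ⟨heq, hbot, himp, hall, hknow, -⟩ := rules_closed (θ := θ) (n := n)
    (C := substFormRules) fun c hc => by simp [program, hc]
  induction φ generalizing S with
  | eq t u =>
    exact heq [gnTerms S, t.gn, (t.subst (toSubst S)).gn, u.gn, (u.subst (toSubst S)).gn]
      (computes_substTerm fun k hk => h k (Or.inl hk))
      (computes_substTerm fun k hk => h k (Or.inr hk))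
  | bot => exact hbot [gnTerms S] (computes_terms S)
  | imp φ ψ ihφ ihψ =>
    exact himp [gnTerms S, φ.gn, (φ.subst (toSubst S)).gn, ψ.gn, (ψ.subst (toSubst S)).gn]
      (ihφ fun k hk => h k (Or.inl hk)) (ihψ fun k hk => h k (Or.inr hk))
  | all φ ih =>
    rw [Formula.subst, ← toSubst_lift]
    have hφ := ih (S := .var 0 :: S.map Term.shift) (by
      rintro (_ | k) hk
      · exact Nat.succ_pos _
      · simpa using h k hk)
    exact hall [gnTerms S, gnTerms (S.map Term.shift), φ.gn,
      (φ.subst (toSubst (.var 0 :: S.map Term.shift))).gn] (computes_shifts hθ S) hφ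
  | know φ ih => exact hknow [gnTerms S, φ.gn, (φ.subst (toSubst S)).gn] (ih h)

theorem computes_allVar (x : ℕ) (φ : Formula) :
    Computes θ n .allVar x φ.gn (φ.allVar x).gn := by
  obtain ⟨-, -, hallVar, -⟩ := rules_closed (θ := θ) (n := n) (C := bindRules)
    fun c hc => by simp [program, hc]
  obtain ⟨N, hN⟩ := φ.fv_finite
  obtain ⟨S, hL, hS⟩ := exists_computes_close (θ := θ) (n := n) x 0 N
  have h : Computes θ n .allVar x φ.gn (Formula.all (φ.subst (toSubst S))).gn :=
    hallVar [x, gnTerms S, φ.gn, (φ.subst (toSubst S)).gn] hS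
      (computes_substForm hθ fun k hk => (hN k hk).trans_le hL)
  obtain ⟨φ', hφ', h'⟩ := interp_of_computes hθ h
  obtain rfl := Formula.gn_injective hφ'
  rwa [← h'] at h

theorem computes_inst (x : ℕ) (t : Term) (φ : Formula) :
    Computes θ n .inst x t.gn φ.gn (φ.inst x t).gn := by
  obtain ⟨-, -, hinst, -⟩ := rules_closed (θ := θ) (n := n) (C := instRules)
    fun c hc => by simp [program, hc]
  obtain ⟨N, hN⟩ := φ.fv_finite
  obtain ⟨S, hL, hS⟩ := exists_computes_single (θ := θ) (n := n) t x 0 N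
  have h : Computes θ n .inst x t.gn φ.gn (φ.subst (toSubst S)).gn :=
    hinst [x, t.gn, gnTerms S, φ.gn, (φ.subst (toSubst S)).gn] hS
      (computes_substForm hθ fun k hk => (hN k hk).trans_le hL)
  obtain ⟨t', φ', ht', hφ', h'⟩ := interp_of_computes hθ h
  obtain rfl := Term.gn_injective ht'
  obtain rfl := Formula.gn_injective hφ'
  rwa [← h'] at h

theorem computes_openAt (k : ℕ) (φ : Formula) :
    Computes θ n .openAt k φ.gn (φ.openAt k).gn := by
  obtain ⟨hopen, -⟩ := rules_closed (θ := θ) (n := n) (C := openAtRules)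
    fun c hc => by simp [program, hc]
  obtain ⟨N, hN⟩ := φ.fv_finite
  obtain ⟨S, hL, hS⟩ := exists_computes_ident (θ := θ) (n := n) N 0
  have h : Computes θ n .openAt k φ.gn (φ.subst (toSubst (.var k :: S))).gn :=
    hopen [gnTerms S, k, φ.gn, (φ.subst (toSubst (.var k :: S))).gn] hS
      (computes_substForm hθ (S := .var k :: S)
        fun k hk => ((hN k hk).trans_le hL).trans (Nat.lt_succ_self _))
  obtain ⟨φ', hφ', h'⟩ := interp_of_computes hθ h
  obtain rfl := Formula.gn_injective hφ'
  rwa [← h'] at h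

omit hθ in
theorem computes_lt {a b : ℕ} (h : a < b) : Computes θ n .lt a b := by
  obtain ⟨hself, hsucc, -⟩ := rules_closed (θ := θ) (n := n) (C := freeRules)
    fun c hc => by simp [program, hc]
  induction b, h using Nat.le_induction with
  | base => exact hself [a]
  | succ b _ ih => exact hsucc [a, b] ih

theorem computes_free {x : ℕ} {φ : Formula} (h : x ∈ φ.fv) : Computes θ n .free x φ.gn := by
  obtain ⟨-, -, hlt, hgt, -⟩ := rules_closed (θ := θ) (n := n) (C := freeRules)
    fun c hc => by simp [program, hc]
  -- The variable x is free in φ but no longer in φ(x|0), so the two formulas differ.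
  have hne : φ.gn ≠ (φ.inst x .zero).gn := by
    intro he
    rw [Formula.gn_injective he] at h
    obtain ⟨j, _, hx⟩ := Formula.mem_fv_subst.1 h
    by_cases hj : j = x
    · subst hj; simp [Term.fv] at hx
    · rw [Function.update_of_ne hj] at hx
      exact hj hx.symm
  rcases hne.lt_or_gt with h | h
  · exact hlt [x, φ.gn, (φ.inst x .zero).gn] (computes_inst hθ x .zero φ) (computes_lt h)
  · exact hgt [x, φ.gn, (φ.inst x .zero).gn] (computes_inst hθ x .zero φ) (computes_lt h)

theorem computes_sentence {φ : Formula} (h : φ.fv = ∅) : Computes θ n .sentence φ.gn := by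
  obtain ⟨-, -, -, -, hsent, -⟩ := rules_closed (θ := θ) (n := n) (C := freeRules)
    fun c hc => by simp [program, hc]
  have hs := computes_substForm (n := n) hθ (S := []) (φ := φ) fun k hk => by simp [h] at hk
  rw [Formula.subst_of_fv_eq_empty h] at hs
  exact hsent [φ.gn] hs

theorem computes_closes {ψ φ : Formula} (h : ψ.Closes φ) :
    Computes θ n .closes ψ.gn φ.gn := by
  obtain ⟨hrefl, hstep, -⟩ := rules_closed (θ := θ) (n := n) (C := closesRules)
    fun c hc => by simp [program, hc]
  induction h with
  | refl φ h => exact hrefl [φ.gn] (computes_sentence hθ h)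
  | step φ ψ x hx _ ih =>
    exact hstep [x, φ.gn, (φ.allVar x).gn, ψ.gn] (computes_free hθ hx) (computes_allVar hθ x φ) ih

theorem computes_closes_of_isClosure {ψ φ : Formula} (h : ψ.IsClosure φ) :
    Computes θ n .closes ψ.gn φ.gn :=
  computes_closes hθ (Formula.isClosure_iff.1 h)

omit hθ in
theorem computes_numeral (m : ℕ) : Computes θ n .numeral m (numeral m).gn := by
  obtain ⟨hzero, hsucc, -⟩ := rules_closed (θ := θ) (n := n) (C := numeralRules)
    fun c hc => by simp [program, hc]
  induction m with
  | zero => exact hzero []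
  | succ m ih => exact hsucc [m, (numeral m).gn] ih

omit hθ in
theorem computes_numerals (l : List ℕ) :
    Computes θ n .numerals (gnTerms (l.map numeral)) := by
  obtain ⟨-, -, hnil, hcons, -⟩ := rules_closed (θ := θ) (n := n) (C := numeralRules)
    fun c hc => by simp [program, hc]
  induction l with
  | nil => exact hnil []
  | cons m l ih => exact hcons [m, (numeral m).gn, gnTerms (l.map numeral)] (computes_numeral m) ih

theorem computes_logical {φ : Formula} (h : LogicalAxiom φ) : Computes θ n .logical φ.gn := by
  obtain ⟨hweaken, hdist, hdne, hinst, hwit, hrepl, hrefl, hsymm, htrans, hsucc, hadd, hmul,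
    hval, -⟩ := rules_closed (θ := θ) (n := n) (C := logicalRules)
      fun c hc => by simp [program, hc]
  have hf := computes_form (θ := θ) (n := n)
  have ht := computes_term (θ := θ) (n := n)
  cases h with
  | weaken φ ψ => exact hweaken [φ.gn, ψ.gn] (hf φ) (hf ψ)
  | distribute φ ψ χ => exact hdist [φ.gn, ψ.gn, χ.gn] (hf φ) (hf ψ) (hf χ)
  | dne φ => exact hdne [φ.gn] (hf φ)
  | instantiate φ k => exact hinst [k, φ.gn, (φ.openAt k).gn] (computes_openAt hθ k φ)
  | witness φ => exact hwit [φ.gn, (φ.openAt (φ.gn + 1)).gn] (computes_openAt hθ _ φ)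
  | replace φ i j =>
    exact hrepl [i, φ.gn, (φ.openAt i).gn, j, (φ.openAt j).gn] (computes_openAt hθ i φ)
      (computes_openAt hθ j φ)
  | eq_refl t => exact hrefl [t.gn] (ht t)
  | eq_symm t u => exact hsymm [t.gn, u.gn] (ht t) (ht u)
  | eq_trans t u v => exact htrans [t.gn, u.gn, v.gn] (ht t) (ht u) (ht v)
  | eq_succ t u => exact hsucc [t.gn, u.gn] (ht t) (ht u)
  | eq_add t u v w => exact hadd [t.gn, u.gn, v.gn, w.gn] (ht t) (ht u) (ht v) (ht w)
  | eq_mul t u v w => exact hmul [t.gn, u.gn, v.gn, w.gn] (ht t) (ht u) (ht v) (ht w)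
  | value t => exact hval [t.gn, t.shift.gn] (computes_shift hθ t)

theorem computes_derives {Γ : Set Formula} {g : ℕ}
    (hΓ : ∀ ψ ∈ Γ, Computes θ n .derives g ψ.gn) {φ : Formula} (h : Derives Γ φ) :
    Computes θ n .derives g φ.gn := by
  obtain ⟨hax, hmp, -⟩ := rules_closed (θ := θ) (n := n) (C := derivesRules)
    fun c hc => by simp [program, hc]
  induction h with
  | hyp φ h => exact hΓ φ h
  | ax φ h => exact hax [φ.gn, g] (computes_logical hθ h)
  | mp φ ψ _ _ ih₁ ih₂ => exact hmp [g, φ.gn, ψ.gn] ih₁ ih₂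

theorem computes_valid {φ : Formula} (h : Valid φ) : Computes θ n .valid φ.gn := by
  obtain ⟨-, -, -, hvalid, -⟩ := rules_closed (θ := θ) (n := n) (C := derivesRules)
    fun c hc => by simp [program, hc]
  obtain ⟨ψ, hψ⟩ := φ.exists_isClosure
  have hd : Derives ∅ ψ := (entails_iff_derives (by simp) hψ.fv_eq_empty).1
    (entails_empty_iff.2 ((valid_iff_of_isClosure hψ).1 h))
  exact hvalid [ψ.gn, φ.gn] (computes_closes_of_isClosure hθ hψ)
    (computes_derives hθ (fun _ h => h.elim) hd)

theorem computes_arithmetic {ψ : Formula} (h : EAAxiom ψ) : Computes θ n .global ψ.gn := by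
  obtain ⟨h₁, h₂, h₃, h₄, h₅, h₆, hind, -⟩ := rules_closed (θ := θ) (n := n)
    (C := arithmeticRules) fun c hc => by simp [program, hc]
  cases h with
  | succ_ne_zero => exact h₁ []
  | succ_inj => exact h₂ []
  | add_zero => exact h₃ []
  | add_succ => exact h₄ []
  | mul_zero => exact h₅ []
  | mul_succ => exact h₆ []
  | induction φ x _ h =>
    have hc := computes_closes_of_isClosure (n := n) hθ h
    exact hind [x, φ.gn, (φ.inst x .zero).gn, (φ.inst x (.succ (.var x))).gn,
      (Formula.allVar x (.imp φ (φ.inst x (.succ (.var x))))).gn, (φ.allVar x).gn, ψ.gn]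
      (computes_inst hθ x .zero φ) (computes_inst hθ x (.succ (.var x)) φ)
      (computes_allVar hθ x (.imp φ (φ.inst x (.succ (.var x))))) (computes_allVar hθ x φ)
      hc

theorem computes_code {φ : Formula} {x : ℕ} (h : φ.fv = {x}) :
    Computes θ n .global (codeAxiom θ n φ x).gn := by
  obtain ⟨-, -, hcode, -⟩ := rules_closed (θ := θ) (n := n) (C := globalRules θ)
    fun c hc => by simp [program, hc]
  have hsent : (φ.allVar x).fv = ∅ := by rw [Formula.fv_allVar, h, Set.sdiff_self]
  have hsub := computes_substForm (n := n) hθ (S := [.var x, numeral φ.gn, numeral n]) (φ := θ)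
    fun k hk => by rcases hθ hk with rfl | rfl | rfl <;> simp
  rw [substTerms_eq_codeAxiom_subst hθ] at hsub
  rw [codeAxiom]
  generalize θ.subst _ = χ at hsub ⊢
  have hiff := computes_allVar (n := n) hθ x (.iff (.know φ) χ)
  have hfree := computes_free (n := n) hθ (show x ∈ φ.fv from h ▸ rfl)
  generalize hψ : Formula.allVar x (.iff (.know φ) χ) = ψ at hiff ⊢
  exact hcode [x, φ.gn, (φ.allVar x).gn, (numeral φ.gn).gn, (numeral n).gn, χ.gn, ψ.gn]
    hfree (computes_allVar hθ x φ) (computes_sentence hθ hsent)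
    (computes_numeral φ.gn) (computes_numeral n) hsub hiff

theorem computes_global {χ : Formula} (h : GlobalAxiom θ n χ) :
    Computes θ n .global χ.gn := by
  obtain ⟨hdist, hknow, -⟩ := rules_closed (θ := θ) (n := n) (C := globalRules θ)
    fun c hc => by simp [program, hc]
  cases h with
  | distrib φ ψ _ h =>
    have hc := computes_closes_of_isClosure (n := n) hθ h
    exact hdist [φ.gn, ψ.gn, χ.gn] (computes_form φ) (computes_form ψ)
      hc
  | know_know φ _ h =>
    have hc := computes_closes_of_isClosure (n := n) hθ h
    exact hknow [φ.gn, χ.gn] (computes_form φ) hc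
  | arithmetic _ h => exact computes_arithmetic hθ h
  | code φ x h => exact computes_code hθ h

theorem computes_known {φ : Formula} (h : KnownAxiom θ n φ) : Computes θ n .known φ.gn := by
  obtain ⟨hax, hvalid, hnec, -⟩ := rules_closed (θ := θ) (n := n) (C := machineRules)
    fun c hc => by simp [program, hc]
  induction h with
  | ax φ h => exact hax [φ.gn] (computes_global hθ h)
  | valid φ χ hv h =>
    have hc := computes_closes_of_isClosure (n := n) hθ h
    exact hvalid [φ.gn, χ.gn] (computes_valid hθ hv) hc
  | nec φ _ ih => exact hnec [φ.gn] ih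

theorem computes_machine {φ : Formula} (h : MachineAxiom θ n φ) :
    Computes θ n .machine φ.gn := by
  obtain ⟨-, -, -, hbase, hassign, hnec, -⟩ := rules_closed (θ := θ) (n := n) (C := machineRules)
    fun c hc => by simp [program, hc]
  induction h with
  | base φ h => exact hbase [φ.gn] (computes_known hθ h)
  | assignedValid φ s hv =>
    obtain ⟨N, hN⟩ := φ.fv_finite
    -- The first N numerals of s suffice, as all free variables of φ lie below N.
    set S : List Term := ((List.range N).map s).map numeral with hS
    have hlen : S.length = N := by simp [hS]
    have hagree : Agree S fun k => numeral (s k) := by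
      intro k hk
      rw [toSubst, List.getD_eq_getElem _ _ hk]
      simp [hS]
    have hsub := computes_substForm (n := n) hθ (S := S) (φ := φ)
      fun k hk => hlen.symm ▸ hN k hk
    rw [hagree.subst fun k hk => hlen.symm ▸ hN k hk] at hsub
    exact hassign [φ.gn, gnTerms S, (φ.assign s).gn] (computes_valid hθ hv)
      (computes_numerals _) hsub
  | nec φ _ ih => exact hnec [φ.gn] ih

theorem computes_goal {m : ℕ} {φ : Formula} {x : ℕ} (hx : φ.fv ⊆ {x})
    (h : Entails (machineTheory θ n) (φ.inst x (numeral m))) :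
    Computes θ n .goal (Nat.pair m φ.gn) := by
  obtain ⟨-, -, hhyp, -⟩ := rules_closed (θ := θ) (n := n) (C := derivesRules)
    fun c hc => by simp [program, hc]
  obtain ⟨-, -, -, -, -, -, hgoal, -⟩ := rules_closed (θ := θ) (n := n) (C := machineRules)
    fun c hc => by simp [program, hc]
  have hd := (entails_iff_derives (fun ψ h => fv_machineAxiom hθ h)
    (Formula.fv_inst_numeral hx m)).1 h
  have hsent : (φ.allVar x).fv = ∅ := by rwa [Formula.fv_allVar, Set.sdiff_eq_empty]
  exact hgoal [x, φ.gn, (φ.allVar x).gn, m, (numeral m).gn, (φ.inst x (numeral m)).gn]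
    (computes_allVar hθ x φ) (computes_sentence hθ hsent) (computes_numeral m)
    (computes_inst hθ x (numeral m) φ)
    (computes_derives hθ (fun ψ hψ => hhyp [ψ.gn] (computes_machine hθ hψ)) hd)

theorem exists_isOwnCode : ∃ n, IsOwnCode θ n := by
  obtain ⟨n, hn⟩ := exists_index_of_program (program θ) (g := fun p => fact .goal p 0 0 0)
    (Primrec₂.natPair.comp (Primrec.const _) (Primrec₂.natPair.comp Primrec.id (Primrec.const _)))
  refine ⟨n, hn.trans (Set.ext fun p => ⟨interp_of_computes hθ, ?_⟩)⟩
  rintro ⟨m, φ, x, rfl, hx, h⟩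
  exact computes_goal hθ hx h

end Completeness

end EpistemicArithmetic

/-! ### The theorem. -/

theorem mainTheorem1 :
    (∃ θ : EpistemicArithmetic.Formula, EpistemicArithmetic.SaysPairMemW θ) ∧
    ∀ θ : EpistemicArithmetic.Formula, EpistemicArithmetic.SaysPairMemW θ →
      (∃ n : ℕ, EpistemicArithmetic.IsOwnCode θ n) ∧
      ∀ n : ℕ, EpistemicArithmetic.IsOwnCode θ n →
        (EpistemicArithmetic.systemS θ n).OmegaConsistent ∧
        ∀ (φ : EpistemicArithmetic.Formula) (x : ℕ), φ.fv = {x} →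
          (EpistemicArithmetic.systemS θ n).Proves
            (EpistemicArithmetic.Formula.know (EpistemicArithmetic.codeAxiom θ n φ x)) :=
  ⟨EpistemicArithmetic.exists_saysPairMemW, fun _ hθ =>
    ⟨EpistemicArithmetic.exists_isOwnCode hθ.2.1, fun _ hn =>
      ⟨EpistemicArithmetic.omegaConsistent_systemS hθ hn,
        fun _ _ hx => EpistemicArithmetic.systemS_proves_know_codeAxiom hx⟩⟩⟩
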